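/- Let $n>2$ and let $\Gamma_n$ be $\mathrm{SL}(n,\mathbb Z)$ or, for even $n=2s$, $\mathrm{Sp}(n,\mathbb Z)=\{x\in \mathrm{GL}(n,\mathbb Z) : xJx^{\top}=J\}$ with $J=\begin{pmatrix}0_s&1_s\\-1_s&0_s\end{pmatrix}$. For an integer $m\ge 1$ let $\Gamma_{n,m}$ be the principal congruence subgroup of level $m$, i.e. the kernel of entrywise reduction modulo $m$ on $\Gamma_n$. A subgroup $H\le\Gamma_n$ is called arithmetic if its index in $\Gamma_n$ is finite. Then: 1. If $H\le \Gamma_n$ is arithmetic and $c=|\Gamma_n:H|$, then $\Gamma_{n,c!}\le H$. 2. Computing the level of a principal congruence subgroup in an arithmetic group is decidable: for each of the two families ($\mathrm{SL}$ and $\mathrm{Sp}$) there is an algorithm (a partial recursive function) which takes as input a degree $n>2$ (even for $\mathrm{Sp}$) and a finite list of matrices in $\Gamma_n$ and which, whenever these matrices generate an arithmetic subgroup $H\le\Gamma_n$, halts and outputs an integer $m\ge 1$ such that $\Gamma_{n,m}\le H$. -/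

import Mathlib

open Matrix Nat

/-- The principal congruence subgroup of level `m` of `SL(n, ℤ)`: the kernel of the entrywise
reduction modulo `m`. -/
def slPCS (n m : ℕ) : Subgroup (SpecialLinearGroup (Fin n) ℤ) :=
  (SpecialLinearGroup.map (n := Fin n) (Int.castRingHom (ZMod m))).ker

/-- The entrywise reduction modulo `m` on `Sp(2s, ℤ)`. Mathlib's symplectic group consists of the
`2s × 2s` matrices `A` with `A * J * Aᵀ = J`, where `J` has blocks `0, -1, 1, 0`; replacing `J` by
`-J` gives the same group. -/
def spReduction (s m : ℕ) :
    symplecticGroup (Fin s) ℤ →* Matrix (Fin s ⊕ Fin s) (Fin s ⊕ Fin s) (ZMod m) :=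
  (Int.castRingHom (ZMod m)).mapMatrix.toMonoidHom.comp (symplecticGroup (Fin s) ℤ).subtype

/-- The principal congruence subgroup of level `m` of `Sp(2s, ℤ)`: the kernel of the entrywise
reduction modulo `m`. -/
def spPCS (s m : ℕ) : Subgroup (symplecticGroup (Fin s) ℤ) :=
  (spReduction s m).ker

/-- An integer matrix written out as the list of its rows: the form in which matrices are handed
to an algorithm. -/
def matrixRows {n : ℕ} (A : Matrix (Fin n) (Fin n) ℤ) : List (List ℤ) :=
  List.ofFn fun i => List.ofFn fun j => A i j

/-- The input that describes a subgroup of `SL(n, ℤ)` by a finite list of generators: the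
degree `n`, and the generating matrices. -/
def slInput (n : ℕ) (S : List (SpecialLinearGroup (Fin n) ℤ)) : ℕ × List (List (List ℤ)) :=
  (n, S.map fun A => matrixRows (A : Matrix (Fin n) (Fin n) ℤ))

/-- The input that describes a subgroup of `Sp(2s, ℤ)` by a finite list of generators: the
degree `2s`, and the generating matrices (rows and columns in the usual order, first block
first). -/
def spInput (s : ℕ) (S : List (symplecticGroup (Fin s) ℤ)) : ℕ × List (List (List ℤ)) :=
  (2 * s, S.map fun A => matrixRows (A.1.reindex finSumFinEquiv finSumFinEquiv))

/-! Let `H` have finite index `c`. For every `x` in the group, `x ^ c!` lies in every conjugate of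
`H`, so the normal core of `H` contains the `c!`-th powers of the elementary matrices, that is, the
elementary matrices of level `c!`. The first claim thus follows from the congruence subgroup theorem
in this form: a normal subgroup `N` that contains the elementary matrices of level `m` contains the
principal congruence subgroup of level `m` (`slPCS_le_of_transvection_mem`,
`IsSpElementary.spPCS_le`).

That theorem is proved in the manner of Mennicke and Bass–Milnor–Serre. Row operations of level `m`
reduce a matrix of the congruence subgroup to a smaller corner (`IsSLElementary.slPCS_succ_le`,
`IsSpElementary.spPCS_succ_le`), down to a copy of SL(2, ℤ) inside SL(3, ℤ) or Sp(4, ℤ). On this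
copy the class modulo `N` depends on the first row `(a, b)` only; this is the Mennicke symbol
`rowSymbol`. It does not change under `a ↦ a + t * b`, nor under `b ↦ b + t * a` with `m ∣ t`, and
replacing `b` by `b * c ^ 2` multiplies it by a factor that depends on `a` and `c` only. Dirichlet's
theorem on primes in progressions and Fermat's little theorem then force the symbol to be trivial
(`eq_one_of_mem_slPCS_two`).

For the second claim, finiteness of the index has a finite certificate: a list `T` of matrices
containing the identity, with words in the generators of `H` which show that `T * x ⊆ H * T` for all
generators `x` of the ambient group. Then `H * T` is everything, the index is at most the length of
`T`, and the factorial of this length is a level. Certificates can be checked primitive recursively,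
and one exists whenever the index is finite, so an unbounded search halts
(`exists_partrec_factorial`). -/

theorem mem_slPCS_iff {n m : ℕ} {A : SpecialLinearGroup (Fin n) ℤ} :
    A ∈ slPCS n m ↔ ∀ i j, (m : ℤ) ∣ A i j - (1 : Matrix (Fin n) (Fin n) ℤ) i j := by
  rw [slPCS, MonoidHom.mem_ker, Matrix.SpecialLinearGroup.ext_iff]
  refine forall₂_congr fun i j => ?_
  rw [← ZMod.intCast_zmod_eq_zero_iff_dvd, Int.cast_sub, sub_eq_zero]
  simp [Matrix.one_apply]

instance slPCS_normal (n m : ℕ) : (slPCS n m).Normal := MonoidHom.normal_ker _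

/-! ### The Mennicke symbol of a row of SL(2, ℤ). -/

/-- The unipotent matrix with rows `(1, t)` and `(0, 1)`. -/
def upperUnip (t : ℤ) : SpecialLinearGroup (Fin 2) ℤ := ⟨!![1, t; 0, 1], by simp⟩

/-- The unipotent matrix with rows `(1, 0)` and `(t, 1)`. -/
def lowerUnip (t : ℤ) : SpecialLinearGroup (Fin 2) ℤ := ⟨!![1, 0; t, 1], by simp⟩

@[simp]
theorem coe_upperUnip (t : ℤ) : (upperUnip t : Matrix (Fin 2) (Fin 2) ℤ) = !![1, t; 0, 1] := rfl

@[simp]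
theorem coe_lowerUnip (t : ℤ) : (lowerUnip t : Matrix (Fin 2) (Fin 2) ℤ) = !![1, 0; t, 1] := rfl

theorem lowerUnip_inv (t : ℤ) : (lowerUnip t)⁻¹ = lowerUnip (-t) := by
  rw [inv_eq_iff_mul_eq_one]
  ext i j
  fin_cases i <;> fin_cases j <;> simp

theorem mem_slPCS_two_iff {m : ℕ} {A : SpecialLinearGroup (Fin 2) ℤ} :
    A ∈ slPCS 2 m ↔ (m : ℤ) ∣ A 0 0 - 1 ∧ (m : ℤ) ∣ A 0 1 ∧ (m : ℤ) ∣ A 1 0 ∧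
      (m : ℤ) ∣ A 1 1 - 1 := by
  simp [mem_slPCS_iff, Fin.forall_fin_two, and_assoc]

/-- A coprime row congruent to `(1, 0)` completes to a matrix in the congruence subgroup. -/
theorem exists_mem_slPCS_two_row {m : ℕ} {a b : ℤ} (hab : IsCoprime a b) (ha : (m : ℤ) ∣ a - 1)
    (hb : (m : ℤ) ∣ b) : ∃ A ∈ slPCS 2 m, A 0 0 = a ∧ A 0 1 = b := by
  have ham : IsCoprime a m := by
    obtain ⟨k, hk⟩ := ha
    exact ⟨1, -k, by linear_combination hk⟩
  -- Bézout is applied to `a` and `b * m`, not to `a` and `b`, so that the lower left entry becomes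
  -- a multiple of `m`.
  obtain ⟨u, v, huv⟩ := hab.mul_right ham
  let A : SpecialLinearGroup (Fin 2) ℤ :=
    ⟨!![a, b; -(m * v), u], by rw [det_fin_two_of]; linear_combination huv⟩
  refine ⟨A, ?_, rfl, rfl⟩
  rw [mem_slPCS_two_iff]
  refine ⟨ha, hb, ⟨-v, by simp [A]⟩, ?_⟩
  obtain ⟨k, hk⟩ := ha
  exact ⟨-(u * k) - v * b, by simp [A]; linear_combination huv - u * hk⟩

section Symbol

variable {m : ℕ} {C : Type*} [Group C] (f : SpecialLinearGroup (Fin 2) ℤ →* C)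

/-- Two matrices with the same first row differ by a lower unipotent factor on the left, whose
parameter is divisible by `m` if both are in the congruence subgroup. This makes the symbol well
defined. -/
theorem map_eq_of_row_eq (hL : ∀ t, (m : ℤ) ∣ t → f (lowerUnip t) = 1)
    {A B : SpecialLinearGroup (Fin 2) ℤ} (hA : A ∈ slPCS 2 m) (hB : B ∈ slPCS 2 m)
    (h0 : A 0 0 = B 0 0) (h1 : A 0 1 = B 0 1) : f A = f B := by
  have dA : A 0 0 * A 1 1 - A 0 1 * A 1 0 = 1 := by rw [← det_fin_two]; exact A.2
  have dB : B 0 0 * B 1 1 - B 0 1 * B 1 0 = 1 := by rw [← det_fin_two]; exact B.2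
  have key : A = lowerUnip (A 1 0 * B 1 1 - A 1 1 * B 1 0) * B := by
    ext i j
    fin_cases i <;> fin_cases j <;>
      simp [Matrix.mul_apply, Fin.sum_univ_two, h0, h1]
    · rw [h0, h1] at dA; linear_combination A 1 0 * (-dB) + B 1 0 * dA
    · rw [h0, h1] at dA; linear_combination A 1 1 * (-dB) + B 1 1 * dA
  rw [mem_slPCS_two_iff] at hA hB
  rw [key, map_mul, hL _ (dvd_sub (hA.2.2.1.mul_right _) (hB.2.2.1.mul_left _)), one_mul]

open Classical in
/-- The value of `f` on the matrices of the congruence subgroup with first row `(a, b)`. -/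
noncomputable def rowSymbol (m : ℕ) {C : Type*} [Group C] (f : SpecialLinearGroup (Fin 2) ℤ →* C)
    (a b : ℤ) : C :=
  if h : ∃ A ∈ slPCS 2 m, A 0 0 = a ∧ A 0 1 = b then f h.choose else 1

variable {f}

theorem rowSymbol_eq (hL : ∀ t, (m : ℤ) ∣ t → f (lowerUnip t) = 1)
    {A : SpecialLinearGroup (Fin 2) ℤ} (hA : A ∈ slPCS 2 m) {a b : ℤ} (ha : A 0 0 = a)
    (hb : A 0 1 = b) : rowSymbol m f a b = f A := by
  have h : ∃ A ∈ slPCS 2 m, A 0 0 = a ∧ A 0 1 = b := ⟨A, hA, ha, hb⟩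
  rw [rowSymbol, dif_pos h]
  obtain ⟨h1, h2, h3⟩ := h.choose_spec
  exact map_eq_of_row_eq f hL h1 hA (h2.trans ha.symm) (h3.trans hb.symm)

/-- Conjugation by a lower unipotent matrix changes the first row in this way. The integer `t` is
arbitrary, in contrast to `rowSymbol_add_mul_right`, because the congruence subgroup is normal and
`hconj` covers all of level one. -/
theorem rowSymbol_add_mul_left (hL : ∀ t, (m : ℤ) ∣ t → f (lowerUnip t) = 1)
    (hconj : ∀ A ∈ slPCS 2 m, ∀ t, f (lowerUnip t * A * (lowerUnip t)⁻¹) = f A)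
    {a b : ℤ} (hab : IsCoprime a b) (ha : (m : ℤ) ∣ a - 1) (hb : (m : ℤ) ∣ b) (t : ℤ) :
    rowSymbol m f (a + t * b) b = rowSymbol m f a b := by
  obtain ⟨A, hA, h0, h1⟩ := exists_mem_slPCS_two_row hab ha hb
  rw [rowSymbol_eq hL hA h0 h1, ← hconj A hA (-t)]
  refine rowSymbol_eq hL ((slPCS_normal 2 m).conj_mem A hA _) ?_ ?_ <;>
    simp [lowerUnip_inv, Matrix.mul_apply, Fin.sum_univ_two, Matrix.vecMul, dotProduct, h0, h1,
      mul_comm]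

theorem rowSymbol_add_mul_right (hL : ∀ t, (m : ℤ) ∣ t → f (lowerUnip t) = 1)
    (hU : ∀ t, (m : ℤ) ∣ t → f (upperUnip t) = 1)
    {a b : ℤ} (hab : IsCoprime a b) (ha : (m : ℤ) ∣ a - 1) (hb : (m : ℤ) ∣ b) (t : ℤ)
    (ht : (m : ℤ) ∣ t) : rowSymbol m f a (b + t * a) = rowSymbol m f a b := by
  obtain ⟨A, hA, h0, h1⟩ := exists_mem_slPCS_two_row hab ha hb
  have hU' : upperUnip t ∈ slPCS 2 m := by
    rw [mem_slPCS_two_iff]; simpa using ht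
  rw [rowSymbol_eq hL hA h0 h1, rowSymbol_eq hL (A := A * upperUnip t) (mul_mem hA hU'),
    map_mul, hU t ht, mul_one] <;>
  simp [Matrix.mul_apply, Fin.sum_univ_two, h0, h1]
  ring

/-- Since `a ≡ 1` modulo `m`, a multiple of `e * m` turns `a` into `1`, and `(1, e * m)` is the
first row of an upper unipotent matrix of level `m`. -/
theorem rowSymbol_self (hL : ∀ t, (m : ℤ) ∣ t → f (lowerUnip t) = 1)
    (hU : ∀ t, (m : ℤ) ∣ t → f (upperUnip t) = 1)
    (hconj : ∀ A ∈ slPCS 2 m, ∀ t, f (lowerUnip t * A * (lowerUnip t)⁻¹) = f A)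
    {a e : ℤ} (ha : (m : ℤ) ∣ a - 1) (he : e * e = 1) : rowSymbol m f a (e * m) = 1 := by
  obtain ⟨k, hk⟩ := ha
  have h1 : a = 1 + k * e * (e * m) := by linear_combination hk - m * k * he
  rw [h1, rowSymbol_add_mul_left hL hconj isCoprime_one_left (by simp) (dvd_mul_left _ _)]
  have hmem : upperUnip (e * m) ∈ slPCS 2 m := by
    rw [mem_slPCS_two_iff]; simp
  rw [rowSymbol_eq hL hmem (by simp) (by simp), hU _ (dvd_mul_left _ _)]

theorem isCoprime_natCast_of_dvd_sub_one {a : ℤ} (ha : (m : ℤ) ∣ a - 1) : IsCoprime a m := by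
  obtain ⟨k, hk⟩ := ha
  exact ⟨1, -k, by linear_combination hk⟩

/-- As `-1` is not a square modulo `p`, one of `x` and `-x` is. -/
theorem exists_sq_of_prime_mod_four {p : ℕ} (hp : p.Prime) (h4 : p % 4 = 3) (x : ℤ) :
    ∃ e r : ℤ, e * e = 1 ∧ (p : ℤ) ∣ x - e * r ^ 2 := by
  have := Fact.mk hp
  have hneg : ¬ IsSquare (-1 : ZMod p) := by
    rw [ZMod.exists_sq_eq_neg_one_iff]; simpa using h4
  have hcases : IsSquare (x : ZMod p) ∨ IsSquare (-(x : ZMod p)) := by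
    by_cases h0 : (x : ZMod p) = 0
    · exact Or.inl (h0 ▸ IsSquare.zero)
    have hm := legendreSym.mul p (-1) x
    rw [(legendreSym.eq_neg_one_iff p (a := -1)).mpr (by simpa using hneg)] at hm
    rcases legendreSym.eq_one_or_neg_one p h0 with h | h
    · exact Or.inl ((legendreSym.eq_one_iff p h0).mp h)
    · have h0' : ((-1 * x : ℤ) : ZMod p) ≠ 0 := by simpa using h0
      have h2 := (legendreSym.eq_one_iff p h0').mp (by rw [hm, h]; norm_num)
      exact Or.inr (by simpa using h2)
  rcases hcases with ⟨r, hr⟩ | ⟨r, hr⟩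
  · refine ⟨1, (r.val : ℤ), by norm_num, ?_⟩
    rw [← ZMod.intCast_zmod_eq_zero_iff_dvd]
    push_cast
    rw [ZMod.natCast_zmod_val, hr]; ring
  · refine ⟨-1, (r.val : ℤ), by norm_num, ?_⟩
    rw [← ZMod.intCast_zmod_eq_zero_iff_dvd]
    push_cast
    rw [ZMod.natCast_zmod_val]; linear_combination -hr

/-! ### Choice of primes, and triviality of the symbol. -/

/-- A prime congruent to a given one modulo `m * l`, to `3` modulo `4`, and not to `1` modulo a
given prime. -/
theorem exists_prime_not_one_mod {m p l k : ℕ} (hm : 0 < m) (hp : p.Prime) (hl : l.Prime)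
    (hk : k.Prime) (hpm : m ∣ p + 1) (hpl : p + 1 < l) (N : ℕ) :
    ∃ q > N, q.Prime ∧ (q : ℤ) ≡ p [ZMOD (m * l : ℕ)] ∧ q % 4 = 3 ∧ ¬ k ∣ (q - 1) / 2 := by
  have h2 := hp.two_le
  have hlm : Nat.Coprime l m := by
    refine (Nat.Prime.coprime_iff_not_dvd hl).mpr fun h => ?_
    exact absurd (Nat.le_of_dvd (Nat.succ_pos p) (h.trans hpm)) (by omega)
  have hl4 : Nat.Coprime l 4 := by
    refine (Nat.Prime.coprime_iff_not_dvd hl).mpr fun h => ?_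
    have : l ∣ 2 ^ 2 := h
    have := Nat.le_of_dvd two_pos (hl.dvd_of_dvd_pow this)
    omega
  -- The prime `q` will satisfy `q ≡ p` modulo `m * l` and `q ≡ -1` modulo `L`. The two congruences
  -- are compatible because the gcd of the moduli divides `p + 1`.
  obtain ⟨L, hL0, hL4, hLg, hLk⟩ : ∃ L : ℕ, 0 < L ∧ 4 ∣ L ∧ Nat.gcd (m * l) L ∣ p + 1 ∧
      (k ≠ 2 → ¬ k ∣ m * l → k ∣ L) := by
    by_cases h : k ≠ 2 ∧ ¬ k ∣ m * l
    · refine ⟨4 * k, by have := hk.pos; omega, dvd_mul_right _ _, ?_, fun _ _ => dvd_mul_left _ _⟩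
      have hc : Nat.Coprime (m * l) k := ((Nat.Prime.coprime_iff_not_dvd hk).mpr h.2).symm
      rw [Nat.Coprime.gcd_mul_right_cancel_right 4 hc.symm,
        Nat.Coprime.gcd_mul_right_cancel m hl4]
      exact (Nat.gcd_dvd_left _ _).trans hpm
    · refine ⟨4, by norm_num, dvd_rfl, ?_, fun h1 h2 => absurd ⟨h1, h2⟩ h⟩
      rw [Nat.Coprime.gcd_mul_right_cancel m hl4]
      exact (Nat.gcd_dvd_left _ _).trans hpm
  obtain ⟨j, hj⟩ := hLg
  have hbez := Nat.gcd_eq_gcd_ab (m * l) L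
  set x := Nat.gcdA (m * l) L
  set y := Nat.gcdB (m * l) L
  have hj' : (p : ℤ) + 1 = ((m * l : ℕ) * x + L * y) * j := by rw [← hbez]; exact_mod_cast hj
  have hpml : IsCoprime (p : ℤ) (m * l : ℕ) := by
    rw [Nat.isCoprime_iff_coprime]
    refine Nat.Coprime.mul_right ?_ ?_
    · refine (Nat.Prime.coprime_iff_not_dvd hp).mpr fun h => ?_
      have h3 := (Nat.dvd_add_right (dvd_refl p)).mp (h.trans hpm)
      exact hp.one_lt.ne' (Nat.dvd_one.mp h3)
    · rw [Nat.coprime_primes hp hl]; omega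
  -- The residue `p - m * l * x * j` solves both congruences, by the Bézout identity `hj'`; it is
  -- prime to both moduli, so Dirichlet's theorem applies.
  obtain ⟨q, hqN, hq, hqc⟩ := Nat.forall_exists_prime_gt_and_zmodEq (N + m * l) (q := m * l * L)
    (a := p - (m * l : ℕ) * x * j)
    (by have := hl.pos; positivity) (by
      push_cast
      refine IsCoprime.mul_right ?_ ?_
      · obtain ⟨u, v, huv⟩ := hpml
        exact ⟨u, v + u * x * j, by push_cast at huv ⊢; linear_combination huv⟩
      · exact ⟨-1, y * j, by push_cast at hj' ⊢; linear_combination -hj'⟩)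
  have hq1 : (q : ℤ) ≡ p [ZMOD (m * l : ℕ)] := by
    refine (hqc.of_dvd (by push_cast; exact dvd_mul_right _ _)).trans ?_
    rw [Int.modEq_iff_dvd]
    exact ⟨x * j, by ring⟩
  have hq2 : (q : ℤ) ≡ -1 [ZMOD L] := by
    refine (hqc.of_dvd (by push_cast; exact dvd_mul_left _ _)).trans ?_
    rw [Int.modEq_iff_dvd]
    exact ⟨-(y * j), by linear_combination -hj'⟩
  have hq3 : q % 4 = 3 := by
    have h := hq2.of_dvd (Int.natCast_dvd_natCast.mpr hL4)
    have : (q : ℤ) % 4 = -1 % 4 := h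
    omega
  refine ⟨q, by omega, hq, hq1, hq3, fun hdiv => ?_⟩
  have hk2 : k ≠ 2 := by rintro rfl; omega
  have hdq : (k : ℤ) ∣ q - 1 := by
    have h5 : k ∣ q - 1 := hdiv.trans ⟨2, by omega⟩
    have := Int.natCast_dvd_natCast.mpr h5
    rwa [Nat.cast_sub hq.one_le, Nat.cast_one] at this
  have hodd : ∀ z : ℤ, (k : ℤ) ∣ z - 1 → (k : ℤ) ∣ z + 1 → False := fun z h1 h2 => by
    have h3 : (k : ℤ) ∣ 2 := by
      have h4 := dvd_sub h2 h1
      rwa [show z + 1 - (z - 1) = 2 by ring] at h4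
    exact hk2 ((Nat.prime_dvd_prime_iff_eq hk Nat.prime_two).mp (by exact_mod_cast h3))
  -- For odd `k` dividing `q - 1`: if `k ∣ m` then `p ≡ -1` modulo `k`, if `k = l` then `0 < p - 1 <
  -- l`, and if neither holds then `q ≡ -1` modulo `k`. Each case is contradictory.
  by_cases hkml : k ∣ m * l
  · have h6 : (k : ℤ) ∣ p - 1 := by
      have := (hq1.of_dvd (Int.natCast_dvd_natCast.mpr hkml)).dvd
      simpa using dvd_add this hdq
    rcases (Nat.Prime.dvd_mul hk).mp hkml with h | h
    · exact hodd p h6 (by exact_mod_cast h.trans hpm)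
    · rw [Nat.prime_dvd_prime_iff_eq hk hl] at h
      subst h
      have := Int.le_of_dvd (by omega) h6
      omega
  · refine hodd q hdq ?_
    have := (hq2.of_dvd (Int.natCast_dvd_natCast.mpr (hLk hk2 hkml))).symm.dvd
    simpa using this

section Symbol

variable {m : ℕ} {C : Type*} [Group C] {f : SpecialLinearGroup (Fin 2) ℤ →* C}

/-- Modulo `p`, the quotient `b / m` is `± c ^ 2` with `m ∣ c`. By the square law the symbol of
`(-p, ± m * c ^ (2 * k))` is `σ ^ k`, so the symbol of `(-p, b)` is `σ`. By Fermat `c ^ (p - 1) ≡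
1`, so the exponent `(p - 1) / 2` leads to the row `(-p, ± m)`, where `rowSymbol_self` applies. -/
theorem rowSymbol_pow_eq_one
    (hL : ∀ t, (m : ℤ) ∣ t → f (lowerUnip t) = 1)
    (hU : ∀ t, (m : ℤ) ∣ t → f (upperUnip t) = 1)
    (hconj : ∀ A ∈ slPCS 2 m, ∀ t, f (lowerUnip t * A * (lowerUnip t)⁻¹) = f A)
    (hsq : ∀ a c : ℤ, (m : ℤ) ∣ a - 1 → (m : ℤ) ∣ c → IsCoprime a c → ∃ σ : C,
      ∀ A ∈ slPCS 2 m, ∀ B ∈ slPCS 2 m, A 0 0 = a → B 0 0 = a → B 0 1 = A 0 1 * c ^ 2 →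
        f B = f A * σ)
    {p : ℕ} (hp : p.Prime) (h4 : p % 4 = 3) (hpm : (m : ℤ) ∣ p + 1) {b : ℤ} (hmb : (m : ℤ) ∣ b)
    (hpb : IsCoprime (p : ℤ) b) : rowSymbol m f (-p) b ^ ((p - 1) / 2) = 1 := by
  have ha : (m : ℤ) ∣ -p - 1 := by
    rw [show -(p : ℤ) - 1 = -(p + 1) by ring]
    exact dvd_neg.mpr hpm
  obtain ⟨l, rfl⟩ := hmb
  obtain ⟨e, r, he, hr⟩ := exists_sq_of_prime_mod_four hp h4 l
  have hpm' := isCoprime_natCast_of_dvd_sub_one ha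
  obtain ⟨u, v, huv⟩ := hpm'
  -- Since `v * m ≡ 1` modulo `p`, this is a representative of `r` modulo `p` that is divisible by
  -- `m`, as the square law requires.
  set c : ℤ := v * m * r with hc
  have hcr : (p : ℤ) ∣ c - r := ⟨u * r, by rw [hc]; linear_combination r * huv⟩
  have hlc : (p : ℤ) ∣ l - e * c ^ 2 := by
    have : l - e * c ^ 2 = (l - e * r ^ 2) - (c - r) * (e * (c + r)) := by ring
    rw [this]
    exact dvd_sub hr (hcr.mul_right _)
  have hpp : Prime (p : ℤ) := Nat.prime_iff_prime_int.mp hp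
  have hpc' : ¬ (p : ℤ) ∣ c := fun h => by
    have h1 : (p : ℤ) ∣ l := by
      have h2 := dvd_add hlc ((h.mul_right c).mul_left e)
      rwa [show l - e * c ^ 2 + e * (c * c) = l by ring] at h2
    exact hpp.not_isUnit (hpb.isUnit_of_dvd' dvd_rfl (h1.mul_left _))
  have hpc : IsCoprime (p : ℤ) c := (hpp.coprime_iff_not_dvd).mpr hpc'
  have hac : IsCoprime (-(p : ℤ)) c := hpc.neg_left
  have hmc : (m : ℤ) ∣ c := ⟨v * r, by rw [hc]; ring⟩
  obtain ⟨σ, hσ⟩ := hsq (-p) c ha hmc hac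
  have hcop : ∀ k : ℕ, IsCoprime (-(p : ℤ)) (e * m * c ^ (2 * k)) := fun k =>
    ((IsCoprime.of_mul_right_left (y := e) (by rw [he]; exact isCoprime_one_right)).mul_right
      (isCoprime_natCast_of_dvd_sub_one ha)).mul_right hac.pow_right
  have hdvd : ∀ k : ℕ, (m : ℤ) ∣ e * m * c ^ (2 * k) := fun k => (dvd_mul_left _ _).mul_right _
  have hpow : ∀ k : ℕ, rowSymbol m f (-p) (e * m * c ^ (2 * k)) = σ ^ k := by
    intro k
    induction k with
    | zero => simpa using rowSymbol_self hL hU hconj ha he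
    | succ k ih =>
      obtain ⟨A, hA, hA0, hA1⟩ := exists_mem_slPCS_two_row (hcop k) ha (hdvd k)
      obtain ⟨B, hB, hB0, hB1⟩ := exists_mem_slPCS_two_row (hcop (k + 1)) ha (hdvd (k + 1))
      rw [rowSymbol_eq hL hB hB0 hB1, hσ A hA B hB hA0 hB0 (by rw [hA1, hB1]; ring), pow_succ,
        ← ih, rowSymbol_eq hL hA hA0 hA1]
  have hshift : ∀ b b' : ℤ, IsCoprime (-(p : ℤ)) (m * b) → (p : ℤ) ∣ b' - b →
      rowSymbol m f (-p) (m * b') = rowSymbol m f (-p) (m * b) := by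
    rintro b b' hb ⟨t, ht⟩
    rw [← rowSymbol_add_mul_right hL hU hb ha (dvd_mul_right _ _) (-(m * t)) (by simp)]
    congr 1
    linear_combination m * ht
  have h1 : rowSymbol m f (-p) (m * l) = σ := by
    rw [hshift (e * c ^ 2) l (by convert hcop 1 using 1; ring) hlc, ← pow_one σ, ← hpow 1]
    congr 1
    ring
  rw [h1, ← hpow, show e * m * c ^ (2 * ((p - 1) / 2)) = m * (e * c ^ (p - 1)) by
    rw [show 2 * ((p - 1) / 2) = p - 1 by omega]; ring, hshift e]
  · rw [mul_comm]
    exact rowSymbol_self hL hU hconj ha he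
  · convert hcop 0 using 1
    ring
  · have := Int.ModEq.pow_card_sub_one_eq_one hp hpc.symm
    rw [← _root_.mul_sub_one]
    exact (Int.modEq_iff_dvd.mp this.symm).mul_left e

/-- A homomorphism from `SL(2, ℤ)` that is trivial on the elementary matrices of level `m`,
invariant under conjugation on the congruence subgroup, and satisfies the square law, is trivial on
the congruence subgroup. -/
theorem eq_one_of_mem_slPCS_two (hm : 0 < m)
    (hL : ∀ t, (m : ℤ) ∣ t → f (lowerUnip t) = 1)
    (hU : ∀ t, (m : ℤ) ∣ t → f (upperUnip t) = 1)
    (hconj : ∀ A ∈ slPCS 2 m, ∀ t, f (lowerUnip t * A * (lowerUnip t)⁻¹) = f A)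
    (hsq : ∀ a c : ℤ, (m : ℤ) ∣ a - 1 → (m : ℤ) ∣ c → IsCoprime a c → ∃ σ : C,
      ∀ A ∈ slPCS 2 m, ∀ B ∈ slPCS 2 m, A 0 0 = a → B 0 0 = a → B 0 1 = A 0 1 * c ^ 2 →
        f B = f A * σ)
    {A : SpecialLinearGroup (Fin 2) ℤ} (hA : A ∈ slPCS 2 m) : f A = 1 := by
  suffices main : ∀ a b : ℤ, IsCoprime a b → (m : ℤ) ∣ a - 1 → (m : ℤ) ∣ b → b ≠ 0 →
      rowSymbol m f a b = 1 by
    have hco : IsCoprime (A 0 0) (A 0 1) := A.isCoprime_row 0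
    have hA' := mem_slPCS_two_iff.mp hA
    rw [← rowSymbol_eq hL hA rfl rfl]
    by_cases hb : A 0 1 = 0
    · rw [← rowSymbol_add_mul_right hL hU hco hA'.1 hA'.2.1 m dvd_rfl]
      refine main _ _ (IsCoprime.add_mul_right_right hco m) hA'.1
        (dvd_add hA'.2.1 (dvd_mul_right _ _)) ?_
      rw [hb] at hco ⊢
      have : A 0 0 ≠ 0 := by
        intro h
        rw [h] at hco
        exact not_isCoprime_zero_zero hco
      have : (m : ℤ) ≠ 0 := by exact_mod_cast hm.ne'
      simp_all
    · exact main _ _ hco hA'.1 hA'.2.1 hb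
  intro a b hab ha hmb hb
  -- Dirichlet's theorem, first use: modulo `b` the entry `a` is replaced by the negative of a
  -- prime.
  obtain ⟨p, -, hp, hpa⟩ := Nat.forall_exists_prime_gt_and_zmodEq 0 (q := b.natAbs) (a := -a)
    (by simpa using hb) (by simpa [IsCoprime.abs_right_iff, IsCoprime.neg_left_iff] using hab)
  obtain ⟨t, ht⟩ : b ∣ -a - p := by simpa using hpa.dvd
  have hpe : -(p : ℤ) = a + t * b := by linear_combination ht
  rw [← rowSymbol_add_mul_left hL hconj hab ha hmb t, ← hpe]
  have hpb : IsCoprime (-(p : ℤ)) b := by rw [hpe]; exact IsCoprime.add_mul_right_left hab t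
  have hpm : (m : ℤ) ∣ -p - 1 := by
    rw [hpe, show a + t * b - 1 = (a - 1) + t * b by ring]
    exact dvd_add ha (hmb.mul_left t)
  obtain ⟨b₀, rfl⟩ := hmb
  have hpb₀ : IsCoprime b₀ p := (IsCoprime.neg_left_iff _ _).mp (hpb.of_mul_right_right) |>.symm
  -- Second use: `b` becomes `m * l` with `l` prime. The prime factors of the modulus are now `l`
  -- and those of `m`, which divide `p + 1`; this is what the choice of `q` below depends on.
  obtain ⟨l, hlp, hl, hlb⟩ := Nat.forall_exists_prime_gt_and_zmodEq (p + 1) hp.ne_zero hpb₀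
  obtain ⟨s, hs⟩ := hlb.symm.dvd
  have hbl : ((m * l : ℕ) : ℤ) = m * b₀ + (-(m * s)) * -p := by
    push_cast
    linear_combination m * hs
  rw [← rowSymbol_add_mul_right hL hU hpb hpm (dvd_mul_right _ _) (-(m * s)) (by simp), ← hbl]
  have hpl : IsCoprime (-(p : ℤ)) (m * l : ℕ) := by
    rw [hbl]
    exact IsCoprime.add_mul_right_right hpb _
  have hmp : m ∣ p + 1 := by
    rw [show -(p : ℤ) - 1 = -((p + 1 : ℕ) : ℤ) by push_cast; ring, dvd_neg] at hpm
    exact Int.natCast_dvd_natCast.mp hpm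
  have hprime : ∀ q : ℕ, q.Prime → (q : ℤ) ≡ p [ZMOD (m * l : ℕ)] → q % 4 = 3 →
      rowSymbol m f (-p) (m * l : ℕ) ^ ((q - 1) / 2) = 1 := by
    intro q hq hqp h4
    obtain ⟨t, ht⟩ := hqp.dvd
    have hqe : -(q : ℤ) = -p + t * (m * l : ℕ) := by linear_combination ht
    have hmq : (m : ℤ) ∣ q + 1 := by
      have h1 : (m : ℤ) ∣ p + 1 := by exact_mod_cast hmp
      rw [show (q : ℤ) + 1 = (p + 1) - (m : ℤ) * (l * t) by push_cast at ht; linear_combination -ht]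
      exact dvd_sub h1 (dvd_mul_right _ _)
    rw [← rowSymbol_add_mul_left hL hconj hpl hpm (by simp) t, ← hqe]
    refine rowSymbol_pow_eq_one hL hU hconj hsq hq h4 hmq (by simp) ?_
    rw [← IsCoprime.neg_left_iff, hqe]
    exact IsCoprime.add_mul_right_left hpl t
  -- The symbol is killed by `(q - 1) / 2` for every admissible prime `q`, and no prime `k` divides
  -- all these exponents, so its order is one.
  by_contra hne
  obtain ⟨k, hk, hkd⟩ := Nat.exists_prime_and_dvd (mt orderOf_eq_one_iff.mp hne)
  obtain ⟨q, -, hq, hqp, h4, hnd⟩ := exists_prime_not_one_mod hm hp hl hk hmp hlp 0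
  exact hnd (hkd.trans (orderOf_dvd_of_pow_eq_one (hprime q hq hqp h4)))

end Symbol

/-! ### Reduction of SL(n + 1, ℤ) to SL(n, ℤ) by row operations. -/

/-- Among the integers `x + k * y` one is coprime to a given nonzero `g`, if the three integers
`x`, `y`, `g` generate the unit ideal. -/
theorem exists_isCoprime_add_mul {x y g : ℤ} (hg : g ≠ 0)
    (h : ∀ p : ℕ, p.Prime → (p : ℤ) ∣ x → (p : ℤ) ∣ y → ¬ (p : ℤ) ∣ g) :
    ∃ k, IsCoprime (x + k * y) g := by
  classical
  -- The product of the primes that divide `g` but not `x`. A prime factor of `g` then divides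
  -- exactly one of `x` and `k * y`: if it divides `x`, it divides neither `k` nor `y`.
  let k : ℕ := ∏ p ∈ g.natAbs.primeFactors.filter fun p : ℕ => ¬ (p : ℤ) ∣ x, p
  refine ⟨k, ?_⟩
  rw [Int.isCoprime_iff_gcd_eq_one]
  by_contra hne
  obtain ⟨p, hp, hpd⟩ := Nat.exists_prime_and_dvd hne
  have h1 : (p : ℤ) ∣ x + k * y := (Int.natCast_dvd_natCast.mpr hpd).trans (Int.gcd_dvd_left ..)
  have h2 : (p : ℤ) ∣ g := (Int.natCast_dvd_natCast.mpr hpd).trans (Int.gcd_dvd_right ..)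
  by_cases hx : (p : ℤ) ∣ x
  · have h3 : (p : ℤ) ∣ k * y := by simpa using dvd_sub h1 hx
    rcases (Nat.prime_iff_prime_int.mp hp).dvd_or_dvd h3 with h4 | h4
    · rw [Int.natCast_dvd_natCast, Prime.dvd_finsetProd_iff hp.prime] at h4
      obtain ⟨q, hq, hpq⟩ := h4
      rw [Finset.mem_filter] at hq
      rw [Nat.prime_dvd_prime_iff_eq hp (Nat.prime_of_mem_primeFactors hq.1)] at hpq
      exact hq.2 (hpq ▸ hx)
    · exact h p hp hx h4 h2
  · have h5 : (p : ℤ) ∣ k := by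
      rw [Int.natCast_dvd_natCast]
      refine Finset.dvd_prod_of_mem _ (Finset.mem_filter.mpr ⟨?_, hx⟩)
      exact Nat.mem_primeFactors.mpr ⟨hp, by rwa [← Int.natCast_dvd], by simpa using hg⟩
    exact hx (by simpa using dvd_sub h1 (h5.mul_right y))

section Elementary

variable {ι : Type*} [DecidableEq ι] [Fintype ι]

/-- A product of commuting transvections, written additively. -/
theorem exists_mem_eq_one_add_sum (N : Subgroup (SpecialLinearGroup ι ℤ)) {κ : Type*}
    (s : Finset κ) (p q : κ → ι) (c : κ → ℤ) (hpq : ∀ j ∈ s, ∀ k ∈ s, q j ≠ p k)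
    (hN : ∀ j ∈ s, ∀ h : p j ≠ q j, SpecialLinearGroup.transvection h (c j) ∈ N) :
    ∃ U ∈ N, (U : Matrix ι ι ℤ) = 1 + ∑ j ∈ s, Matrix.single (p j) (q j) (c j) := by
  classical
  induction s using Finset.induction_on with
  | empty => exact ⟨1, one_mem _, by simp⟩
  | insert a s ha ih =>
    obtain ⟨U, hU, hUe⟩ := ih (fun j hj k hk => hpq j (Finset.mem_insert_of_mem hj) k
      (Finset.mem_insert_of_mem hk)) (fun j hj => hN j (Finset.mem_insert_of_mem hj))
    have hne : p a ≠ q a := (hpq a (Finset.mem_insert_self _ _) a (Finset.mem_insert_self _ _)).symm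
    refine ⟨U * SpecialLinearGroup.transvection hne (c a),
      mul_mem hU (hN a (Finset.mem_insert_self _ _) hne), ?_⟩
    rw [Matrix.SpecialLinearGroup.coe_mul, hUe, SpecialLinearGroup.transvection_coe,
      Finset.sum_insert ha, mul_add, mul_one, add_mul, one_mul,
      Finset.sum_mul, Finset.sum_eq_zero (s := s) (f := fun j => _ * _)]
    · abel
    · intro j hj
      exact Matrix.single_mul_single_of_ne _ _ _ _ (hpq j (Finset.mem_insert_of_mem hj) a
        (Finset.mem_insert_self _ _)) _

end Elementary

/-- The matrix with lower right corner `A`, upper left entry `1` and zeros elsewhere. -/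
def cornerMatrix {n : ℕ} (A : Matrix (Fin n) (Fin n) ℤ) : Matrix (Fin (n + 1)) (Fin (n + 1)) ℤ :=
  Matrix.of (Fin.cons (Fin.cons 1 0) fun i => Fin.cons 0 (A i))

section cornerMatrix

variable {n : ℕ} (A B : Matrix (Fin n) (Fin n) ℤ)

@[simp] theorem cornerMatrix_zero_zero : cornerMatrix A 0 0 = 1 := rfl
@[simp] theorem cornerMatrix_zero_succ (j : Fin n) : cornerMatrix A 0 j.succ = 0 := rfl
@[simp] theorem cornerMatrix_succ_zero (i : Fin n) : cornerMatrix A i.succ 0 = 0 := rfl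
@[simp] theorem cornerMatrix_succ_succ (i j : Fin n) : cornerMatrix A i.succ j.succ = A i j := rfl

theorem det_cornerMatrix : (cornerMatrix A).det = A.det := by
  rw [det_succ_row_zero, Fin.sum_univ_succ]
  simp
  rfl

theorem cornerMatrix_one : cornerMatrix (1 : Matrix (Fin n) (Fin n) ℤ) = 1 := by
  ext i j
  refine Fin.cases ?_ (fun i => ?_) i <;> refine Fin.cases ?_ (fun j => ?_) j <;>
    simp [Matrix.one_apply, Fin.succ_ne_zero, (Fin.succ_ne_zero _).symm]

theorem cornerMatrix_mul : cornerMatrix (A * B) = cornerMatrix A * cornerMatrix B := by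
  ext i j
  refine Fin.cases ?_ (fun i => ?_) i <;> refine Fin.cases ?_ (fun j => ?_) j <;>
    simp [Matrix.mul_apply, Fin.sum_univ_succ]

end cornerMatrix

/-- The embedding of `SL(n, ℤ)` into `SL(n + 1, ℤ)` as the lower right corner. -/
def slSucc (n : ℕ) : SpecialLinearGroup (Fin n) ℤ →* SpecialLinearGroup (Fin (n + 1)) ℤ where
  toFun A := ⟨cornerMatrix A.1, by rw [det_cornerMatrix]; exact A.2⟩
  map_one' := Subtype.ext cornerMatrix_one
  map_mul' A B := Subtype.ext (cornerMatrix_mul A.1 B.1)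

section slSucc

variable {n : ℕ} (A : SpecialLinearGroup (Fin n) ℤ)

@[simp] theorem slSucc_zero_zero : slSucc n A 0 0 = 1 := rfl
@[simp] theorem slSucc_zero_succ (j : Fin n) : slSucc n A 0 j.succ = 0 := rfl
@[simp] theorem slSucc_succ_zero (i : Fin n) : slSucc n A i.succ 0 = 0 := rfl
@[simp] theorem slSucc_succ_succ (i j : Fin n) : slSucc n A i.succ j.succ = A i j := rfl

theorem slSucc_transvection {i j : Fin n} (h : i ≠ j) (t : ℤ) :
    slSucc n (SpecialLinearGroup.transvection h t) =
      SpecialLinearGroup.transvection (fun e => h (Fin.succ_injective n e)) t := by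
  ext a b
  refine Fin.cases ?_ (fun a => ?_) a <;> refine Fin.cases ?_ (fun b => ?_) b <;>
    simp [SpecialLinearGroup.transvection_coe, Matrix.one_apply,
      Matrix.single_apply, Fin.succ_ne_zero, (Fin.succ_ne_zero _).symm]

end slSucc

/-- A subgroup that contains the elementary matrices of level `m` and is normalized by all
elementary matrices. -/
structure IsSLElementary {n : ℕ} (m : ℕ) (N : Subgroup (SpecialLinearGroup (Fin n) ℤ)) : Prop where
  mem {i j : Fin n} (h : i ≠ j) {t : ℤ} (ht : (m : ℤ) ∣ t) : SpecialLinearGroup.transvection h t ∈ N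
  conj_mem {i j : Fin n} (h : i ≠ j) (t : ℤ) {A : SpecialLinearGroup (Fin n) ℤ} (hA : A ∈ N) :
    SpecialLinearGroup.transvection h t * A * (SpecialLinearGroup.transvection h t)⁻¹ ∈ N

namespace IsSLElementary

variable {n m : ℕ} {N : Subgroup (SpecialLinearGroup (Fin (n + 1)) ℤ)}

theorem transvection_mem_slPCS {i j : Fin n} (h : i ≠ j) {t : ℤ} (ht : (m : ℤ) ∣ t) :
    SpecialLinearGroup.transvection h t ∈ slPCS n m := by
  rw [mem_slPCS_iff]
  intro a b
  simp only [SpecialLinearGroup.transvection_coe, Matrix.add_apply,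
    add_sub_cancel_left, Matrix.single_apply]
  split_ifs
  exacts [ht, dvd_zero _]

/-- With corner `1`, operations of level `m` clear the rest of the first row and column. They are
taken in `N ⊓ slPCS (n + 1) m`, so the remaining block lies in the smaller congruence subgroup. -/
theorem mem_of_apply_zero_zero_eq_one (hN : IsSLElementary m N)
    (hsub : ∀ B ∈ slPCS n m, slSucc n B ∈ N) {A : SpecialLinearGroup (Fin (n + 1)) ℤ}
    (hA : A ∈ slPCS (n + 1) m) (h : A 0 0 = 1) : A ∈ N := by
  have hA' := mem_slPCS_iff.mp hA
  have hr : ∀ j : Fin n, (m : ℤ) ∣ -A 0 j.succ := fun j => by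
    simpa [(Fin.succ_ne_zero j).symm] using hA' 0 j.succ
  have hc : ∀ j : Fin n, (m : ℤ) ∣ -A j.succ 0 := fun j => by
    simpa [Fin.succ_ne_zero j] using hA' j.succ 0
  obtain ⟨U, hUN, hUe⟩ := exists_mem_eq_one_add_sum (N ⊓ slPCS (n + 1) m) Finset.univ
    (fun _ : Fin n => 0) Fin.succ (fun j => -A 0 j.succ) (fun j _ k _ => Fin.succ_ne_zero j)
    (fun j _ h => ⟨hN.mem h (hr j), transvection_mem_slPCS h (hr j)⟩)
  obtain ⟨V, hVN, hVe⟩ := exists_mem_eq_one_add_sum (N ⊓ slPCS (n + 1) m) Finset.univ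
    Fin.succ (fun _ : Fin n => 0) (fun j => -A j.succ 0) (fun j _ k _ => (Fin.succ_ne_zero k).symm)
    (fun j _ h => ⟨hN.mem h (hc j), transvection_mem_slPCS h (hc j)⟩)
  obtain ⟨hU, hU'⟩ := Subgroup.mem_inf.mp hUN
  obtain ⟨hV, hV'⟩ := Subgroup.mem_inf.mp hVN
  have hB : V * A * U ∈ slPCS (n + 1) m := mul_mem (mul_mem hV' hA) hU'
  have hU0 : ∀ i, U i 0 = (1 : Matrix (Fin (n + 1)) (Fin (n + 1)) ℤ) i 0 := fun i => by
    simp [hUe, Matrix.sum_apply, Fin.succ_ne_zero]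
  have hU1 : ∀ i j, U i (Fin.succ j) = (1 : Matrix (Fin (n + 1)) (Fin (n + 1)) ℤ) i j.succ + if 0 = i then -A 0 j.succ else 0 :=
    fun i j => by
    simp [hUe, Matrix.sum_apply, Matrix.single_apply, Fin.succ_inj, ite_and]
  have hV0 : ∀ i, V 0 i = (1 : Matrix (Fin (n + 1)) (Fin (n + 1)) ℤ) 0 i := fun i => by
    simp [hVe, Matrix.sum_apply, Fin.succ_ne_zero]
  have hV1 : ∀ i j, V (Fin.succ j) i = (1 : Matrix (Fin (n + 1)) (Fin (n + 1)) ℤ) j.succ i + if 0 = i then -A j.succ 0 else 0 :=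
    fun i j => by
    simp [hVe, Matrix.sum_apply, Matrix.single_apply, Fin.succ_inj, ite_and]
  have hB0 : ∀ j, (V * A * U) 0 j = (1 : Matrix (Fin (n + 1)) (Fin (n + 1)) ℤ) 0 j := by
    intro j
    rw [Matrix.SpecialLinearGroup.coe_mul, Matrix.mul_apply]
    have : ∀ k, (V * A) 0 k = A 0 k := fun k => by
      rw [Matrix.SpecialLinearGroup.coe_mul, Matrix.mul_apply]
      simp [hV0, Matrix.one_apply]
    simp only [this]
    refine Fin.cases ?_ (fun j => ?_) j
    · simp [hU0, Matrix.one_apply, h]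
    · simp [hU1, Matrix.one_apply, mul_add, Finset.sum_add_distrib, h, (Fin.succ_ne_zero j).symm]
  have hB1 : ∀ i, (V * A * U) i 0 = (1 : Matrix (Fin (n + 1)) (Fin (n + 1)) ℤ) i 0 := by
    intro i
    rw [mul_assoc, Matrix.SpecialLinearGroup.coe_mul, Matrix.mul_apply]
    have : ∀ k, (A * U) k 0 = A k 0 := fun k => by
      rw [Matrix.SpecialLinearGroup.coe_mul, Matrix.mul_apply]
      simp [hU0, Matrix.one_apply]
    simp only [this]
    refine Fin.cases ?_ (fun j => ?_) i
    · simp [hV0, Matrix.one_apply, h]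
    · simp [hV1, Matrix.one_apply, add_mul, Finset.sum_add_distrib, h, Fin.succ_ne_zero j]
  let B' : SpecialLinearGroup (Fin n) ℤ :=
    ⟨(V * A * U).1.submatrix Fin.succ Fin.succ, by
      have := (V * A * U).2
      rw [det_succ_row_zero, Fin.sum_univ_succ] at this
      simpa [hB0, Matrix.one_apply, (Fin.succ_ne_zero _).symm] using this⟩
  have hBe : V * A * U = slSucc n B' := by
    ext i j
    refine Fin.cases ?_ (fun i => ?_) i <;> refine Fin.cases ?_ (fun j => ?_) j
    · simp [hB0]
    · rw [hB0]; simp [(Fin.succ_ne_zero _).symm]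
    · rw [hB1]; simp [Fin.succ_ne_zero]
    · rfl
  have hB'm : B' ∈ slPCS n m := by
    rw [mem_slPCS_iff] at hB ⊢
    intro i j
    have := hB i.succ j.succ
    simpa [hBe, Matrix.one_apply, Fin.succ_inj] using this
  have := hsub B' hB'm
  rw [← hBe] at this
  rwa [N.mul_mem_cancel_right hU, N.mul_mem_cancel_left hV] at this

theorem mul_transvection_apply (A : SpecialLinearGroup (Fin n) ℤ) {i j : Fin n} (h : i ≠ j) (t : ℤ)
    (a b : Fin n) : (A * SpecialLinearGroup.transvection h t) a b =
      A a b + if b = j then A a i * t else 0 := by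
  rw [Matrix.SpecialLinearGroup.coe_mul, SpecialLinearGroup.transvection_coe,
    ← Matrix.transvection.eq_1]
  split_ifs with hb
  · rw [hb, Matrix.mul_transvection_apply_same, mul_comm t]
  · rw [Matrix.mul_transvection_apply_of_ne _ _ _ _ hb, add_zero]

theorem inv_transvection_mul_apply (A : SpecialLinearGroup (Fin n) ℤ) {i j : Fin n} (h : i ≠ j)
    (t : ℤ) (a b : Fin n) (ha : a ≠ i) :
    ((SpecialLinearGroup.transvection h t)⁻¹ * A) a b = A a b := by
  rw [SpecialLinearGroup.transvection_inv, Matrix.SpecialLinearGroup.coe_mul,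
    SpecialLinearGroup.transvection_coe, ← Matrix.transvection.eq_1, Matrix.transvection_mul_apply_of_ne _ _ _ _ ha]

/-- Conjugation by an elementary matrix of level one moves `A 0 0 + A 0 i` into the corner. Here the
normalization hypothesis `conj_mem` enters. -/
theorem mem_of_apply_add_apply_eq_one (hN : IsSLElementary m N)
    (hsub : ∀ B ∈ slPCS n m, slSucc n B ∈ N) {A : SpecialLinearGroup (Fin (n + 1)) ℤ}
    (hA : A ∈ slPCS (n + 1) m) {i : Fin (n + 1)} (hi : i ≠ 0) (h : A 0 0 + A 0 i = 1) : A ∈ N := by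
  set T := SpecialLinearGroup.transvection hi (1 : ℤ) with hT
  have h1 : T⁻¹ * (A * T) ∈ N := by
    refine hN.mem_of_apply_zero_zero_eq_one hsub ?_ ?_
    · have := (slPCS_normal (n + 1) m).conj_mem A hA T⁻¹
      rwa [inv_inv, mul_assoc] at this
    · rw [inv_transvection_mul_apply _ _ _ _ _ hi.symm, mul_transvection_apply]
      simpa using h
  have := hN.conj_mem hi 1 h1
  rw [← hT] at this
  simpa [mul_assoc] using this

/-- Multiples of columns `0` and `i` are added to column `j` to achieve `A 0 0 + A 0 j = 1`. The
defect `1 - A 0 0 - A 0 j` is divisible by `m`, so the operations have level `m`. -/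
theorem mem_of_isCoprime (hN : IsSLElementary m N)
    (hsub : ∀ B ∈ slPCS n m, slSucc n B ∈ N) {A : SpecialLinearGroup (Fin (n + 1)) ℤ}
    (hA : A ∈ slPCS (n + 1) m) {i j : Fin (n + 1)} (hj : 0 ≠ j) (hij : i ≠ j)
    (h : IsCoprime (A 0 0) (A 0 i)) : A ∈ N := by
  obtain ⟨u, v, huv⟩ := h
  have hA' := mem_slPCS_iff.mp hA
  have hd : (m : ℤ) ∣ 1 - A 0 0 - A 0 j := by
    have h0 := hA' 0 0
    have h1 := hA' 0 j
    rw [Matrix.one_apply_ne hj, sub_zero] at h1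
    rw [Matrix.one_apply_eq] at h0
    rw [show 1 - A 0 0 - A 0 j = -(A 0 0 - 1) - A 0 j by ring]
    exact dvd_sub (dvd_neg.mpr h0) h1
  set T := SpecialLinearGroup.transvection hj (u * (1 - A 0 0 - A 0 j))
  set S := SpecialLinearGroup.transvection hij (v * (1 - A 0 0 - A 0 j))
  have hT := hN.mem hj (hd.mul_left u)
  have hS := hN.mem hij (hd.mul_left v)
  have h1 : A * T * S ∈ N := by
    refine hN.mem_of_apply_add_apply_eq_one hsub (mul_mem (mul_mem hA ?_) ?_) hj.symm ?_
    · exact transvection_mem_slPCS _ (hd.mul_left u)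
    · exact transvection_mem_slPCS _ (hd.mul_left v)
    · simp only [S, T, mul_transvection_apply, hj, hij, if_true, if_false]
      linear_combination (1 - A 0 0 - A 0 j) * huv
  rwa [N.mul_mem_cancel_right hS, N.mul_mem_cancel_right hT] at h1

/-- The first row is unimodular, as the first column of `A⁻¹` shows. Adding `k * m` times a
combination of the columns other than `0` and `i` makes `A 0 i` coprime to `A 0 0`; the factor `m`
is harmless, since `A 0 0 ≡ 1` modulo `m`. -/
theorem mem_of_ne_zero (hN : IsSLElementary m N)
    (hsub : ∀ B ∈ slPCS n m, slSucc n B ∈ N) {A : SpecialLinearGroup (Fin (n + 1)) ℤ}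
    (hA : A ∈ slPCS (n + 1) m) {i j : Fin (n + 1)} (hi : 0 ≠ i) (hj : 0 ≠ j) (hij : i ≠ j)
    (h : A 0 0 ≠ 0) : A ∈ N := by
  have hA' := mem_slPCS_iff.mp hA
  set s : Finset (Fin (n + 1)) := {0, i}ᶜ with hs
  have hrow : A 0 0 * A⁻¹ 0 0 + A 0 i * A⁻¹ i 0 + ∑ k ∈ s, A 0 k * A⁻¹ k 0 = 1 := by
    have h1 : (A * A⁻¹) 0 0 = 1 := by simp
    rw [Matrix.SpecialLinearGroup.coe_mul, Matrix.mul_apply,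
      ← Finset.sum_add_sum_compl {0, i}, Finset.sum_pair hi] at h1
    exact h1
  set g := ∑ k ∈ s, A 0 k * A⁻¹ k 0 with hg
  obtain ⟨k, hk⟩ : ∃ k, IsCoprime (A 0 i + k * (m * g)) (A 0 0) := by
    refine exists_isCoprime_add_mul h fun p hp h1 h2 h3 => ?_
    have hpp := Nat.prime_iff_prime_int.mp hp
    have hpm : ¬ (p : ℤ) ∣ m := fun hpm => by
      have h0 := hpm.trans (hA' 0 0)
      rw [Matrix.one_apply_eq] at h0
      exact hpp.not_isUnit (isUnit_of_dvd_one (by simpa using dvd_sub h3 h0))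
    have h4 := (hpp.dvd_or_dvd h2).resolve_left hpm
    refine hpp.not_isUnit (isUnit_of_dvd_one ?_)
    rw [← hrow]
    exact dvd_add (dvd_add (h3.mul_right _) (h1.mul_right _)) h4
  have hd : ∀ l ∈ s, (m : ℤ) ∣ m * (k * A⁻¹ l 0) := fun l _ => dvd_mul_right _ _
  obtain ⟨U, hUN, hUe⟩ := exists_mem_eq_one_add_sum (N ⊓ slPCS (n + 1) m) s id
    (fun _ => i) (fun l => m * (k * A⁻¹ l 0)) (by rintro - - l hl rfl; simp [hs] at hl)
    (fun l hl h => ⟨hN.mem h (hd l hl), transvection_mem_slPCS h (hd l hl)⟩)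
  obtain ⟨hU, hU'⟩ := Subgroup.mem_inf.mp hUN
  have hAU : ∀ b, (A * U) 0 b = A 0 b + if b = i then k * (m * g) else 0 := by
    intro b
    rw [Matrix.SpecialLinearGroup.coe_mul, hUe, mul_add, mul_one, Matrix.add_apply,
      Finset.mul_sum, Matrix.sum_apply]
    congr 1
    split_ifs with hb
    · subst hb
      simp only [Matrix.mul_single_apply_same, hg, id, Finset.mul_sum]
      exact Finset.sum_congr rfl fun l _ => by ring
    · exact Finset.sum_eq_zero fun l _ => Matrix.mul_single_apply_of_ne _ _ _ _ _ hb _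
  have h1 : A * U ∈ N := by
    refine hN.mem_of_isCoprime hsub (mul_mem hA hU') hj hij ?_
    rw [hAU, hAU, if_neg hi, if_pos rfl, add_zero]
    exact hk.symm
  simpa using mul_mem h1 (inv_mem hU)

/-- Reduction of the congruence subgroup of `SL(n + 1, ℤ)` to that of `SL(n, ℤ)`. -/
theorem slPCS_succ_le (hm : 0 < m) (hn : 2 ≤ n) (hN : IsSLElementary m N)
    (hsub : ∀ B ∈ slPCS n m, slSucc n B ∈ N) : slPCS (n + 1) m ≤ N := by
  intro A hA
  obtain ⟨k, rfl⟩ := Nat.exists_eq_add_of_le' hn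
  have h01 : (0 : Fin (k + 2 + 1)) ≠ 1 := by simp
  have h02 : (0 : Fin (k + 2 + 1)) ≠ ⟨2, by omega⟩ := by simp [Fin.ext_iff]
  have h12 : (1 : Fin (k + 2 + 1)) ≠ ⟨2, by omega⟩ := by simp [Fin.ext_iff]
  -- A zero corner can occur for `m = 1` only; adding `m` times another column repairs it.
  by_cases h : A 0 0 = 0
  · obtain ⟨j, hj⟩ : ∃ j, A 0 j ≠ 0 := by
      by_contra! h0
      exact A.row_ne_zero 0 (funext h0)
    have hj0 : j ≠ 0 := by rintro rfl; exact hj h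
    have h1 : A * SpecialLinearGroup.transvection hj0 (m : ℤ) ∈ N := by
      refine hN.mem_of_ne_zero hsub (mul_mem hA (transvection_mem_slPCS _ dvd_rfl)) h01 h02 h12 ?_
      rw [mul_transvection_apply, if_pos rfl, h, zero_add]
      exact mul_ne_zero hj (by exact_mod_cast hm.ne')
    simpa using mul_mem h1 (inv_mem (hN.mem hj0 dvd_rfl))
  · exact hN.mem_of_ne_zero hsub hA h01 h02 h12 h

end IsSLElementary

/-! ### Generation of SL(n, ℤ) by elementary matrices. -/

theorem slPCS_one (n : ℕ) : slPCS n 1 = ⊤ :=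
  eq_top_iff.mpr fun A _ => mem_slPCS_iff.mpr fun i j => by simp

theorem upperUnip_eq_transvection (t : ℤ) :
    upperUnip t = SpecialLinearGroup.transvection (zero_ne_one : (0 : Fin 2) ≠ 1) t := by
  ext i j
  fin_cases i <;> fin_cases j <;> simp [SpecialLinearGroup.transvection_coe]

theorem lowerUnip_eq_transvection (t : ℤ) :
    lowerUnip t = SpecialLinearGroup.transvection (one_ne_zero : (1 : Fin 2) ≠ 0) t := by
  ext i j
  fin_cases i <;> fin_cases j <;> simp [SpecialLinearGroup.transvection_coe]

/-- The set of elementary matrices with off-diagonal entry `1`. -/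
def slElementary (n : ℕ) : Set (SpecialLinearGroup (Fin n) ℤ) :=
  {A | ∃ (i j : Fin n) (h : i ≠ j), A = SpecialLinearGroup.transvection h 1}

theorem transvection_pow {n : ℕ} {i j : Fin n} (h : i ≠ j) (t : ℤ) (k : ℕ) :
    SpecialLinearGroup.transvection h t ^ k = SpecialLinearGroup.transvection h (k * t) := by
  induction k with
  | zero => simp
  | succ k ih =>
    rw [pow_succ, ih, ← SpecialLinearGroup.transvection_add]
    congr 1
    push_cast
    ring

theorem transvection_mem_of_dvd {n m : ℕ} {N : Subgroup (SpecialLinearGroup (Fin n) ℤ)}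
    {i j : Fin n} (h : i ≠ j) (hN : SpecialLinearGroup.transvection h (m : ℤ) ∈ N) {t : ℤ}
    (ht : (m : ℤ) ∣ t) : SpecialLinearGroup.transvection h t ∈ N := by
  obtain ⟨k, rfl⟩ := ht
  obtain ⟨k, rfl | rfl⟩ := k.eq_nat_or_neg
  · rw [mul_comm, ← transvection_pow]
    exact pow_mem hN k
  · rw [mul_neg, ← SpecialLinearGroup.transvection_inv, mul_comm, ← transvection_pow]
    exact inv_mem (pow_mem hN k)

theorem transvection_mem_closure {n : ℕ} {i j : Fin n} (h : i ≠ j) (t : ℤ) :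
    SpecialLinearGroup.transvection h t ∈ Subgroup.closure (slElementary n) :=
  have h1 : SpecialLinearGroup.transvection h ((1 : ℕ) : ℤ) ∈ slElementary n := ⟨i, j, h, by simp⟩
  transvection_mem_of_dvd h (Subgroup.subset_closure h1) (by simp)

/-- `SL(n, ℤ)` is generated by elementary matrices. -/
theorem closure_slElementary {n : ℕ} (hn : 2 ≤ n) : Subgroup.closure (slElementary n) = ⊤ := by
  induction n, hn using Nat.le_induction with
  | base =>
    rw [eq_top_iff, ← SpecialLinearGroup.SL2Z_generators, Subgroup.closure_le]
    have hU := fun t => upperUnip_eq_transvection t ▸ transvection_mem_closure (zero_ne_one : (0 : Fin 2) ≠ 1) t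
    have hL := fun t => lowerUnip_eq_transvection t ▸ transvection_mem_closure (one_ne_zero : (1 : Fin 2) ≠ 0) t
    rintro A (rfl | rfl)
    · have h : ModularGroup.S = upperUnip (-1) * lowerUnip 1 * upperUnip (-1) := by
        ext i j
        fin_cases i <;> fin_cases j <;> simp [ModularGroup.S]
      rw [h]
      exact mul_mem (mul_mem (hU _) (hL _)) (hU _)
    · have h : ModularGroup.T = upperUnip 1 := by
        ext i j
        fin_cases i <;> fin_cases j <;> simp [ModularGroup.T]
      rw [h]
      exact hU 1
  | succ n hn ih =>
    -- At level one the congruence subgroup is the whole group, so the reduction step is also the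
    -- inductive step for generation.
    have hE : IsSLElementary 1 (Subgroup.closure (slElementary (n + 1))) :=
      ⟨fun h t _ => transvection_mem_closure h t, fun h t A hA => mul_mem (mul_mem
        (transvection_mem_closure h t) hA) (inv_mem (transvection_mem_closure h t))⟩
    rw [eq_top_iff, ← slPCS_one]
    refine hE.slPCS_succ_le one_pos hn fun B _ => ?_
    have hB : B ∈ Subgroup.closure (slElementary n) := ih ▸ Subgroup.mem_top B
    have hle : Subgroup.closure (slElementary n) ≤
        (Subgroup.closure (slElementary (n + 1))).comap (slSucc n) := by
      rw [Subgroup.closure_le]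
      rintro _ ⟨i, j, h, rfl⟩
      rw [SetLike.mem_coe, Subgroup.mem_comap, slSucc_transvection]
      exact transvection_mem_closure _ _
    exact hle hB

/-- An element of a group commutes modulo a normal subgroup with everything, if it does so with
generators. -/
theorem commute_mk_of_closure_eq_top {G : Type*} [Group G] {N : Subgroup G} [N.Normal] {s : Set G}
    (hs : Subgroup.closure s = ⊤) {x : G}
    (h : ∀ y ∈ s, Commute (QuotientGroup.mk' N y) (QuotientGroup.mk' N x)) (y : G) :
    Commute (QuotientGroup.mk' N y) (QuotientGroup.mk' N x) := by
  have hle : Subgroup.closure s ≤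
      (Subgroup.centralizer {QuotientGroup.mk' N x}).comap (QuotientGroup.mk' N) := by
    rw [Subgroup.closure_le]
    intro y hy
    simpa [Subgroup.mem_centralizer_singleton_iff] using (h y hy).eq
  have := hle (hs ▸ Subgroup.mem_top y)
  rwa [Subgroup.mem_comap, Subgroup.mem_centralizer_singleton_iff] at this

/-! ### The corner SL(2, ℤ) in SL(3, ℤ). -/

section SLThree

variable {m : ℕ} {N : Subgroup (SpecialLinearGroup (Fin 3) ℤ)} [N.Normal]

theorem coe_transvection_fin_three {i j : Fin 3} (h : i ≠ j) (t : ℤ) :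
    (SpecialLinearGroup.transvection h t : Matrix (Fin 3) (Fin 3) ℤ) =
      !![1, if i = 0 ∧ j = 1 then t else 0, if i = 0 ∧ j = 2 then t else 0;
        if i = 1 ∧ j = 0 then t else 0, 1, if i = 1 ∧ j = 2 then t else 0;
        if i = 2 ∧ j = 0 then t else 0, if i = 2 ∧ j = 1 then t else 0, 1] := by
  ext a b
  fin_cases a <;> fin_cases b <;>
    simp [SpecialLinearGroup.transvection_coe, Matrix.single_apply] <;>
    exact fun h1 h2 => absurd (h1.trans h2.symm) h

theorem coe_slSucc_two (A : SpecialLinearGroup (Fin 2) ℤ) :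
    (slSucc 2 A : Matrix (Fin 3) (Fin 3) ℤ) =
      !![1, 0, 0; 0, A 0 0, A 0 1; 0, A 1 0, A 1 1] := by
  ext a b
  fin_cases a <;> fin_cases b <;> rfl

/-- Conjugation by `slSucc 2 A` acts on the transvections of the first row and of the first column
through `A`, which is trivial modulo `m`, so it fixes them modulo `N`. The transvections in the
other two positions are commutators of these. -/
theorem commute_mk_transvection_slSucc (hN : ∀ (i j : Fin 3) (h : i ≠ j) (t : ℤ), (m : ℤ) ∣ t →
      SpecialLinearGroup.transvection h t ∈ N)
    {A : SpecialLinearGroup (Fin 2) ℤ} (hA : A ∈ slPCS 2 m) (g : SpecialLinearGroup (Fin 3) ℤ) :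
    Commute (QuotientGroup.mk' N g) (QuotientGroup.mk' N (slSucc 2 A)) := by
  obtain ⟨ha, hb, hc, hd⟩ := mem_slPCS_two_iff.mp hA
  have hdet : A 0 0 * A 1 1 - A 0 1 * A 1 0 = 1 := by rw [← det_fin_two]; exact A.2
  have hmk : ∀ x n n' : SpecialLinearGroup (Fin 3) ℤ, n ∈ N → n' ∈ N →
      slSucc 2 A * x = x * (n * n') * slSucc 2 A →
      Commute (QuotientGroup.mk' N x) (QuotientGroup.mk' N (slSucc 2 A)) := by
    intro x n n' hn hn' h
    have h1 := congrArg (QuotientGroup.mk' N) h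
    have hn1 : QuotientGroup.mk' N n = 1 := (QuotientGroup.eq_one_iff n).mpr hn
    have hn1' : QuotientGroup.mk' N n' = 1 := (QuotientGroup.eq_one_iff n').mpr hn'
    rw [map_mul, map_mul, map_mul, map_mul, hn1, hn1', mul_one, mul_one] at h1
    exact h1.symm
  have h01 : (0 : Fin 3) ≠ 1 := by decide
  have h02 : (0 : Fin 3) ≠ 2 := by decide
  have h10 : (1 : Fin 3) ≠ 0 := by decide
  have h20 : (2 : Fin 3) ≠ 0 := by decide
  have c01 := hmk (.transvection h01 1) (.transvection h01 (A 1 1 - 1)) (.transvection h02 (-A 0 1))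
    (hN _ _ _ _ hd) (hN _ _ _ _ (by simpa using hb)) (by
      refine Subtype.ext ?_
      simp only [Matrix.SpecialLinearGroup.coe_mul, coe_transvection_fin_three, coe_slSucc_two]
      ext i j
      fin_cases i <;> fin_cases j <;> simp
      all_goals first | ring1 | linear_combination hdet | linear_combination -hdet)
  have c02 := hmk (.transvection h02 1) (.transvection h01 (-A 1 0)) (.transvection h02 (A 0 0 - 1))
    (hN _ _ _ _ (by simpa using hc)) (hN _ _ _ _ ha) (by
      refine Subtype.ext ?_
      simp only [Matrix.SpecialLinearGroup.coe_mul, coe_transvection_fin_three, coe_slSucc_two]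
      ext i j
      fin_cases i <;> fin_cases j <;> simp
      all_goals first | ring1 | linear_combination hdet | linear_combination -hdet)
  have c10 := hmk (.transvection h10 1) (.transvection h10 (A 0 0 - 1)) (.transvection h20 (A 1 0))
    (hN _ _ _ _ ha) (hN _ _ _ _ hc) (by
      refine Subtype.ext ?_
      simp only [Matrix.SpecialLinearGroup.coe_mul, coe_transvection_fin_three, coe_slSucc_two]
      ext i j
      fin_cases i <;> fin_cases j <;> simp)
  have c20 := hmk (.transvection h20 1) (.transvection h10 (A 0 1)) (.transvection h20 (A 1 1 - 1))
    (hN _ _ _ _ hb) (hN _ _ _ _ hd) (by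
      refine Subtype.ext ?_
      simp only [Matrix.SpecialLinearGroup.coe_mul, coe_transvection_fin_three, coe_slSucc_two]
      ext i j
      fin_cases i <;> fin_cases j <;> simp)
  refine commute_mk_of_closure_eq_top (closure_slElementary (n := 3) (by norm_num)) ?_ g
  rintro _ ⟨i, j, h, rfl⟩
  have hcomm : ∀ x y : SpecialLinearGroup (Fin 3) ℤ,
      Commute (QuotientGroup.mk' N x) (QuotientGroup.mk' N (slSucc 2 A)) →
      Commute (QuotientGroup.mk' N y) (QuotientGroup.mk' N (slSucc 2 A)) →
      Commute (QuotientGroup.mk' N (x * y * x⁻¹ * y⁻¹)) (QuotientGroup.mk' N (slSucc 2 A)) := by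
    intro x y hx hy
    rw [map_mul, map_mul, map_mul, map_inv, map_inv]
    exact ((hx.mul_left hy).mul_left hx.inv_left).mul_left hy.inv_left
  have c12 := hcomm _ _ c10 c02
  have c21 := hcomm _ _ c20 c01
  fin_cases i <;> fin_cases j
  · exact absurd rfl h
  · exact c01
  · exact c02
  · exact c10
  · exact absurd rfl h
  · convert c12
    rw [SpecialLinearGroup.transvection_inv, SpecialLinearGroup.transvection_inv]
    refine Subtype.ext ?_
    simp only [Matrix.SpecialLinearGroup.coe_mul, coe_transvection_fin_three]
    decide
  · exact c20
  · convert c21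
    rw [SpecialLinearGroup.transvection_inv, SpecialLinearGroup.transvection_inv]
    refine Subtype.ext ?_
    simp only [Matrix.SpecialLinearGroup.coe_mul, coe_transvection_fin_three]
    decide
  · exact absurd rfl h

/-- The congruence subgroup of `SL(2, ℤ)` in the lower right corner of `SL(3, ℤ)` is contained in
every normal subgroup that contains the elementary matrices of the same level. -/
theorem slSucc_two_mem (hm : 0 < m) (hN : ∀ (i j : Fin 3) (h : i ≠ j) (t : ℤ), (m : ℤ) ∣ t →
      SpecialLinearGroup.transvection h t ∈ N)
    {A : SpecialLinearGroup (Fin 2) ℤ} (hA : A ∈ slPCS 2 m) : slSucc 2 A ∈ N := by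
  have hmem : ∀ x : SpecialLinearGroup (Fin 3) ℤ, QuotientGroup.mk' N x = 1 ↔ x ∈ N :=
    fun x => QuotientGroup.eq_one_iff x
  have h10 : (1 : Fin 3) ≠ 0 := by decide
  have h01 : (0 : Fin 3) ≠ 1 := by decide
  have h12 : (1 : Fin 3) ≠ 2 := by decide
  have h21 : (2 : Fin 3) ≠ 1 := by decide
  have hL : ∀ t, (m : ℤ) ∣ t → (QuotientGroup.mk' N).comp (slSucc 2) (lowerUnip t) = 1 := by
    intro t ht
    rw [MonoidHom.comp_apply, hmem, lowerUnip_eq_transvection, slSucc_transvection]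
    exact hN _ _ _ _ ht
  have hU : ∀ t, (m : ℤ) ∣ t → (QuotientGroup.mk' N).comp (slSucc 2) (upperUnip t) = 1 := by
    intro t ht
    rw [MonoidHom.comp_apply, hmem, upperUnip_eq_transvection, slSucc_transvection]
    exact hN _ _ _ _ ht
  have hlin : ∀ a c : ℤ, (m : ℤ) ∣ a - 1 → (m : ℤ) ∣ c → IsCoprime a c → ∃ σ : _ ⧸ N,
      ∀ A ∈ slPCS 2 m, ∀ B ∈ slPCS 2 m, A 0 0 = a → B 0 0 = a → B 0 1 = A 0 1 * c →
        (QuotientGroup.mk' N).comp (slSucc 2) B = (QuotientGroup.mk' N).comp (slSucc 2) A * σ := by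
    intro a c ha hc hac
    obtain ⟨D, hD, hD0, hD1⟩ := exists_mem_slPCS_two_row hac ha hc
    have hDdet : a * D 1 1 - c * D 1 0 = 1 := by rw [← hD0, ← hD1, ← det_fin_two]; exact D.2
    -- The factor of the symbol: `D` with its off-diagonal signs changed, placed in the upper left
    -- corner. It depends on `a` and `c` but not on `A`.
    let Y : SpecialLinearGroup (Fin 3) ℤ :=
      ⟨!![a, -c, 0; -D 1 0, D 1 1, 0; 0, 0, 1], by
        simp [det_fin_three]; linear_combination hDdet⟩
    have hY : (Y : Matrix (Fin 3) (Fin 3) ℤ) = !![a, -c, 0; -D 1 0, D 1 1, 0; 0, 0, 1] := rfl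
    refine ⟨QuotientGroup.mk' N Y, fun A hA B hB hA0 hB0 hAB => ?_⟩
    have hAdet : a * A 1 1 - A 0 1 * A 1 0 = 1 := by rw [← hA0, ← det_fin_two]; exact A.2
    obtain ⟨hD1', hD2', hD3', hD4'⟩ := mem_slPCS_two_iff.mp hD
    obtain ⟨hA1', hA2', hA3', hA4'⟩ := mem_slPCS_two_iff.mp hA
    let Z : SpecialLinearGroup (Fin 2) ℤ :=
      ⟨!![a, A 0 1 * c; -(A 1 0 * D 1 0), A 1 1 - A 0 1 * A 1 0 * D 1 1], by
        rw [det_fin_two_of]; linear_combination hAdet - A 0 1 * A 1 0 * hDdet⟩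
    have hZ : (Z : Matrix (Fin 2) (Fin 2) ℤ) =
      !![a, A 0 1 * c; -(A 1 0 * D 1 0), A 1 1 - A 0 1 * A 1 0 * D 1 1] := rfl
    have hZm : Z ∈ slPCS 2 m := by
      rw [mem_slPCS_two_iff]
      simp only [hZ, of_apply, cons_val', cons_val_zero, cons_val_one, cons_val_fin_one]
      refine ⟨ha, hA2'.mul_right _, (hA3'.mul_right _).neg_right, ?_⟩
      rw [sub_right_comm]
      exact dvd_sub hA4' ((hA2'.mul_right _).mul_right _)
    rw [map_eq_of_row_eq _ hL hB hZm (hB0.trans rfl) (hAB.trans rfl), MonoidHom.comp_apply,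
      MonoidHom.comp_apply]
    let g : SpecialLinearGroup (Fin 3) ℤ := ⟨!![0, -1, 0; 1, 0, 0; 0, 0, 1], by decide⟩
    have hg : (g : Matrix (Fin 3) (Fin 3) ℤ) = !![0, -1, 0; 1, 0, 0; 0, 0, 1] := rfl
    -- Modulo `N` the transvections disappear and `g` commutes with `slSucc 2 Z`, which leaves the
    -- product of `slSucc 2 A` and `Y` equal to `slSucc 2 Z`.
    have key : g * (.transvection h01 c * .transvection h21 (-(A 1 0 * D 1 1)) *
        .transvection h10 (D 1 0) * slSucc 2 A * Y * .transvection h12 (-A 0 1)) =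
        slSucc 2 Z * g := by
      refine Subtype.ext ?_
      simp only [Matrix.SpecialLinearGroup.coe_mul, coe_transvection_fin_three, coe_slSucc_two,
        hY, hZ, hg, hA0]
      ext i j
      fin_cases i <;> fin_cases j <;> simp
      all_goals first
        | ring1
        | linear_combination -hDdet
        | linear_combination A 0 1 * hDdet
        | linear_combination c * hDdet
        | linear_combination -c * A 0 1 * hDdet
        | linear_combination -A 1 0 * D 1 1 * hDdet
        | linear_combination A 1 0 * D 1 1 * A 0 1 * hDdet
    have h1 := congrArg (QuotientGroup.mk' N) key
    simp only [map_mul] at h1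
    rw [(hmem _).mpr (hN _ _ h01 _ hc), (hmem _).mpr (hN _ _ h21 _ (hA3'.mul_right _).neg_right),
      (hmem _).mpr (hN _ _ h10 _ hD3'), (hmem _).mpr (hN _ _ h12 _ hA2'.neg_right),
      (commute_mk_transvection_slSucc hN hZm g).symm.eq, one_mul, one_mul, one_mul, mul_one] at h1
    exact (mul_left_cancel h1).symm
  rw [← hmem]
  refine eq_one_of_mem_slPCS_two (f := (QuotientGroup.mk' N).comp (slSucc 2)) hm hL hU ?_ ?_ hA
  · intro A hA t
    rw [map_mul, map_mul, map_inv, MonoidHom.comp_apply, MonoidHom.comp_apply,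
      (commute_mk_transvection_slSucc hN hA _).eq, mul_inv_cancel_right]
  · intro a c ha hc hac
    obtain ⟨σ, hσ⟩ := hlin a c ha hc hac
    -- In SL(3, ℤ) the symbol is multiplicative in `c` itself; the square law is two applications of
    -- this.
    refine ⟨σ * σ, fun A hA B hB hA0 hB0 hAB => ?_⟩
    have hco : IsCoprime a (A 0 1) := hA0 ▸ A.isCoprime_row 0
    obtain ⟨D, hD, hD0, hD1⟩ := exists_mem_slPCS_two_row (hco.mul_right hac) ha (hc.mul_left _)
    rw [hσ D hD B hB hD0 hB0 (by rw [hAB, hD1]; ring), hσ A hA D hD hA0 hD0 hD1, mul_assoc]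

end SLThree

/-! ### The congruence subgroup theorem for SL(n, ℤ). -/

/-- The congruence subgroup theorem for `SL(n, ℤ)`, `n ≥ 3`: a normal subgroup that contains the
elementary matrices of level `m` contains the principal congruence subgroup of level `m`. -/
theorem slPCS_le_of_transvection_mem {n m : ℕ} (hn : 3 ≤ n) (hm : 0 < m)
    (N : Subgroup (SpecialLinearGroup (Fin n) ℤ)) (hNn : N.Normal)
    (hN : ∀ (i j : Fin n) (h : i ≠ j) (t : ℤ), (m : ℤ) ∣ t →
      SpecialLinearGroup.transvection h t ∈ N) : slPCS n m ≤ N := by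
  induction n, hn using Nat.le_induction with
  | base =>
    have hE : IsSLElementary m N :=
      ⟨fun h t => hN _ _ h t, fun h t A hA => hNn.conj_mem A hA _⟩
    exact hE.slPCS_succ_le hm le_rfl fun B hB => slSucc_two_mem hm hN hB
  | succ n hn ih =>
    have hE : IsSLElementary m N :=
      ⟨fun h t => hN _ _ h t, fun h t A hA => hNn.conj_mem A hA _⟩
    refine hE.slPCS_succ_le hm (by omega) ?_
    exact ih (N.comap (slSucc n)) inferInstance fun i j h t ht => by
      rw [Subgroup.mem_comap, slSucc_transvection]
      exact hN _ _ _ _ ht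

/-! ### Elementary symplectic matrices. -/

section Symplectic

variable {l : Type*} [DecidableEq l] [Fintype l]

/-- For symmetric `S` the matrix `J * S` lies in the symplectic Lie algebra, and `S * J * S = 0`
makes its square vanish; so `1 + J * S` is its exponential. -/
theorem mem_symplecticGroup_one_add {S : Matrix (l ⊕ l) (l ⊕ l) ℤ} (h1 : Sᵀ = S)
    (h2 : S * J l ℤ * S = 0) : 1 + J l ℤ * S ∈ symplecticGroup l ℤ := by
  rw [SymplecticGroup.mem_iff, transpose_add, transpose_mul, h1, J_transpose, transpose_one,
    mul_neg, mul_add, add_mul, add_mul, mul_one, one_mul, mul_neg]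
  have h3 : J l ℤ * S * J l ℤ * (S * J l ℤ) = 0 := by
    rw [Matrix.mul_assoc (J l ℤ * S), Matrix.mul_assoc (J l ℤ), ← Matrix.mul_assoc S,
      ← Matrix.mul_assoc (S * J l ℤ), h2]
    simp
  rw [mul_one, add_mul, h3, Matrix.mul_assoc (J l ℤ) S]
  abel

theorem J_mulVec_inl (v : l ⊕ l → ℤ) (k : l) : (J l ℤ *ᵥ v) (Sum.inl k) = -v (Sum.inr k) := by
  simp [J, mulVec, dotProduct, Matrix.one_apply]

theorem J_mulVec_inr (v : l ⊕ l → ℤ) (k : l) : (J l ℤ *ᵥ v) (Sum.inr k) = v (Sum.inl k) := by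
  simp [J, mulVec, dotProduct, Matrix.one_apply]

theorem J_mulVec_eq_zero {v : l ⊕ l → ℤ} {p : l ⊕ l} (h : v p.swap = 0) : (J l ℤ *ᵥ v) p = 0 := by
  rcases p with k | k
  · rw [J_mulVec_inl]; simpa using h
  · rw [J_mulVec_inr]; simpa using h

theorem dotProduct_J_mulVec_comm (u v : l ⊕ l → ℤ) : u ⬝ᵥ J l ℤ *ᵥ v = -(v ⬝ᵥ J l ℤ *ᵥ u) := by
  rw [dotProduct_mulVec, dotProduct_comm, ← mulVec_transpose, J_transpose, neg_mulVec,
    dotProduct_neg]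

/-- The symmetric matrix `e vᵀ + v eᵀ + c e eᵀ`, where `e` is the basis vector with index `p`. -/
def spSymm (p : l ⊕ l) (v : l ⊕ l → ℤ) (c : ℤ) : Matrix (l ⊕ l) (l ⊕ l) ℤ :=
  vecMulVec (Pi.single p 1) v + vecMulVec v (Pi.single p 1) +
    c • vecMulVec (Pi.single p 1) (Pi.single p 1)

omit [Fintype l] in
theorem spSymm_apply (p : l ⊕ l) (v : l ⊕ l → ℤ) (c : ℤ) (i j : l ⊕ l) :
    spSymm p v c i j = (if i = p then v j else 0) + (if j = p then v i else 0) +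
      if i = p ∧ j = p then c else 0 := by
  simp only [spSymm, Matrix.add_apply, Matrix.smul_apply, vecMulVec_apply, Pi.single_apply]
  split_ifs <;> simp_all

omit [Fintype l] in
theorem spSymm_transpose (p : l ⊕ l) (v : l ⊕ l → ℤ) (c : ℤ) : (spSymm p v c)ᵀ = spSymm p v c := by
  simp only [spSymm, transpose_add, transpose_smul, transpose_vecMulVec]
  rw [add_comm (vecMulVec v _)]

/-- The basis vector `e` is isotropic and orthogonal to `v` and `v'`, so only the multiple of `e eᵀ`
survives. -/
theorem spSymm_mul_J_mul {p : l ⊕ l} {v v' : l ⊕ l → ℤ} (c c' : ℤ) (h : v p.swap = 0)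
    (h' : v' p.swap = 0) : spSymm p v c * J l ℤ * spSymm p v' c' = spSymm p 0 (v ⬝ᵥ J l ℤ *ᵥ v') := by
  have e1 : (Pi.single p 1 : l ⊕ l → ℤ) ⬝ᵥ J l ℤ *ᵥ Pi.single p 1 = 0 := by
    have := dotProduct_J_mulVec_comm (Pi.single p 1 : l ⊕ l → ℤ) (Pi.single p 1)
    omega
  have e2 : (Pi.single p 1 : l ⊕ l → ℤ) ⬝ᵥ J l ℤ *ᵥ v' = 0 := by
    simpa using J_mulVec_eq_zero h'
  have e3 : v ⬝ᵥ J l ℤ *ᵥ Pi.single p 1 = 0 := by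
    rw [dotProduct_J_mulVec_comm]
    simpa using J_mulVec_eq_zero h
  have hJ : J l ℤ * spSymm p v' c' = vecMulVec (J l ℤ *ᵥ Pi.single p 1) v' +
      vecMulVec (J l ℤ *ᵥ v') (Pi.single p 1) +
      c' • vecMulVec (J l ℤ *ᵥ Pi.single p 1) (Pi.single p 1) := by
    simp only [spSymm, mul_add, mul_vecMulVec, Matrix.mul_smul]
  rw [Matrix.mul_assoc, hJ]
  simp only [spSymm, mul_add, add_mul, Matrix.mul_smul, Matrix.smul_mul,
    vecMulVec_mul_vecMulVec, e1, e2, e3]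
  simp only [zero_smul, vecMulVec_smul, vecMulVec_zero, zero_vecMulVec, smul_zero, add_zero,
    zero_add]

omit [Fintype l] in
theorem spSymm_add (p : l ⊕ l) (v v' : l ⊕ l → ℤ) (c c' : ℤ) :
    spSymm p v c + spSymm p v' c' = spSymm p (v + v') (c + c') := by
  simp only [spSymm, vecMulVec_add, add_vecMulVec, add_smul]
  abel

omit [Fintype l] in
theorem spSymm_zero (p : l ⊕ l) : spSymm p 0 0 = 0 := by simp [spSymm]

/-- The unipotent symplectic matrix `1 + J (e vᵀ + v eᵀ + c e eᵀ)`, where `e` is the basis vector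
with index `p` and `v` is orthogonal to `e`. -/
def spVec (p : l ⊕ l) (v : l ⊕ l → ℤ) (c : ℤ) (h : v p.swap = 0) : symplecticGroup l ℤ :=
  ⟨1 + J l ℤ * spSymm p v c, mem_symplecticGroup_one_add (spSymm_transpose p v c) (by
    rw [spSymm_mul_J_mul c c h h]
    have := dotProduct_J_mulVec_comm v v
    rw [show v ⬝ᵥ J l ℤ *ᵥ v = 0 by omega, spSymm_zero])⟩

theorem coe_spVec (p : l ⊕ l) (v : l ⊕ l → ℤ) (c : ℤ) (h : v p.swap = 0) :
    (spVec p v c h : Matrix (l ⊕ l) (l ⊕ l) ℤ) = 1 + J l ℤ * spSymm p v c := rfl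

/-- A Heisenberg group law: the vectors add, and the central parameter picks up the symplectic form
of the two vectors. -/
theorem spVec_mul {p : l ⊕ l} {v v' : l ⊕ l → ℤ} (c c' : ℤ) (h : v p.swap = 0)
    (h' : v' p.swap = 0) : spVec p v c h * spVec p v' c' h' =
      spVec p (v + v') (c + c' + v ⬝ᵥ J l ℤ *ᵥ v') (by simp [h, h']) := by
  refine Subtype.ext ?_
  rw [Submonoid.coe_mul, coe_spVec, coe_spVec, coe_spVec, add_mul, one_mul, mul_add, mul_one,
    Matrix.mul_assoc, ← Matrix.mul_assoc (spSymm p v c), spSymm_mul_J_mul c c' h h', add_assoc,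
    ← mul_add, ← mul_add, add_right_inj, ← add_assoc, add_comm (spSymm p v' c'), spSymm_add,
    spSymm_add, add_zero]

theorem spVec_congr {p : l ⊕ l} {v v' : l ⊕ l → ℤ} {c c' : ℤ} (h : v p.swap = 0) (hv : v = v')
    (hc : c = c') : spVec p v c h = spVec p v' c' (hv ▸ h) := by subst hv hc; rfl

theorem spVec_zero (p : l ⊕ l) : spVec p 0 0 rfl = (1 : symplecticGroup l ℤ) :=
  Subtype.ext (by rw [coe_spVec, spSymm_zero, mul_zero, add_zero]; rfl)

/-- Short root elements are symmetric in their two indices; this allows a choice of the index to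
which such an element is attached. -/
theorem spVec_single_comm {p q : l ⊕ l} (t : ℤ) (h h') :
    spVec p (Pi.single q t) 0 h = spVec q (Pi.single p t) 0 h' := by
  refine Subtype.ext ?_
  rw [coe_spVec, coe_spVec]
  congr 2
  ext i j
  simp only [spSymm_apply, Pi.single_apply]
  split_ifs <;> simp_all

theorem spVec_inv {p : l ⊕ l} {v : l ⊕ l → ℤ} (c : ℤ) (h : v p.swap = 0) :
    (spVec p v c h)⁻¹ = spVec p (-v) (-c) (by simp [h]) := by
  rw [inv_eq_iff_mul_eq_one, spVec_mul, ← spVec_zero p]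
  have := dotProduct_J_mulVec_comm v v
  refine spVec_congr _ (by simp) ?_
  rw [mulVec_neg, dotProduct_neg]
  omega

theorem spVec_pow {p : l ⊕ l} {v : l ⊕ l → ℤ} (c : ℤ) (h : v p.swap = 0) (k : ℕ) :
    spVec p v c h ^ k = spVec p ((k : ℤ) • v) (k * c) (by simp [h]) := by
  induction k with
  | zero => rw [pow_zero, ← spVec_zero p]; exact spVec_congr _ (by simp) (by simp)
  | succ k ih =>
    rw [pow_succ, ih, spVec_mul]
    refine spVec_congr _ (by push_cast; rw [add_smul, one_smul]) ?_
    have := dotProduct_J_mulVec_comm v v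
    rw [smul_dotProduct, show v ⬝ᵥ J l ℤ *ᵥ v = 0 by omega]
    push_cast
    simp
    ring

/-- Conjugation by a symplectic matrix that fixes the basis row vector with index `p`. -/
theorem mul_spVec (g : symplecticGroup l ℤ) {p : l ⊕ l} {v v' : l ⊕ l → ℤ} (c : ℤ)
    (h : v p.swap = 0) (h' : v' p.swap = 0) (hv : v' ᵥ* g.1 = v)
    (hp : ∀ j, g.1 p j = (1 : Matrix (l ⊕ l) (l ⊕ l) ℤ) p j) :
    g * spVec p v c h = spVec p v' c h' * g := by
  have hp' : Pi.single p 1 ᵥ* g.1 = Pi.single p 1 := by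
    ext j
    rw [single_one_vecMul, row, hp, Matrix.one_apply, Pi.single_apply]
    simp only [eq_comm]
  have hS : (g.1)ᵀ * spSymm p v' c * g.1 = spSymm p v c := by
    simp only [spSymm, mul_add, add_mul, mul_vecMulVec, vecMulVec_mul, Matrix.mul_smul,
      Matrix.smul_mul, mulVec_transpose, hv, hp']
  refine Subtype.ext ?_
  rw [Submonoid.coe_mul, Submonoid.coe_mul, coe_spVec, coe_spVec, ← hS, mul_add, add_mul, mul_one,
    one_mul, add_right_inj]
  have hg := SymplecticGroup.mem_iff.mp g.2
  calc _ = g.1 * J l ℤ * (g.1)ᵀ * (spSymm p v' c * g.1) := by simp only [Matrix.mul_assoc]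
    _ = _ := by rw [hg, Matrix.mul_assoc]

/-- The row operation performed by right multiplication with `spVec p v c`. -/
theorem mul_spVec_apply (A : symplecticGroup l ℤ) {p : l ⊕ l} {v : l ⊕ l → ℤ} (c : ℤ)
    (h : v p.swap = 0) (i k : l ⊕ l) :
    (A * spVec p v c h).1 i k = A.1 i k + (A.1 * J l ℤ) i p * v k +
      (if k = p then (A.1 * J l ℤ) i ⬝ᵥ v + c * (A.1 * J l ℤ) i p else 0) := by
  rw [Submonoid.coe_mul, coe_spVec, mul_add, mul_one, ← Matrix.mul_assoc, Matrix.add_apply,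
    add_assoc, add_right_inj]
  simp only [spSymm, mul_add, Matrix.add_apply, mul_vecMulVec, vecMulVec_apply, Matrix.mul_smul,
    Matrix.smul_apply]
  simp only [mulVec, Pi.single_apply]
  split_ifs <;> simp [dotProduct_single]
  ring

theorem mul_J_apply_inl (A : Matrix (l ⊕ l) (l ⊕ l) ℤ) (i : l ⊕ l) (k : l) :
    (A * J l ℤ) i (Sum.inl k) = A i (Sum.inr k) := by
  simp [J, Matrix.mul_apply, Matrix.one_apply]

theorem mul_J_apply_inr (A : Matrix (l ⊕ l) (l ⊕ l) ℤ) (i : l ⊕ l) (k : l) :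
    (A * J l ℤ) i (Sum.inr k) = -A i (Sum.inl k) := by
  simp [J, Matrix.mul_apply, Matrix.one_apply]

/-- The rows of a symplectic matrix are orthogonal with respect to the symplectic form. -/
theorem mul_J_mul_transpose_apply (A : symplecticGroup l ℤ) (i k : l ⊕ l) :
    (A.1 * J l ℤ) i ⬝ᵥ A.1 k = J l ℤ i k := by
  conv_rhs => rw [← SymplecticGroup.mem_iff.mp A.2]
  rw [Matrix.mul_apply]
  rfl

end Symplectic

/-! ### Reduction of Sp(2(s + 1), ℤ) to Sp(2s, ℤ) by row operations. -/

theorem single_swap_eq_zero {l : Type*} [DecidableEq l] {p q : l ⊕ l} (h : q ≠ p.swap) (t : ℤ) :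
    (Pi.single q t : l ⊕ l → ℤ) p.swap = 0 := Pi.single_eq_of_ne h.symm _

/-- A subgroup that contains the elementary symplectic matrices of level `m` and is normalized by
the elementary matrices of long roots. -/
structure IsSpElementary {l : Type*} [DecidableEq l] [Fintype l] (m : ℕ)
    (N : Subgroup (symplecticGroup l ℤ)) : Prop where
  short_mem {p q : l ⊕ l} (hpq : p ≠ q) (h : q ≠ p.swap) {t : ℤ} (ht : (m : ℤ) ∣ t) :
    spVec p (Pi.single q t) 0 (single_swap_eq_zero h t) ∈ N
  long_mem (p : l ⊕ l) {t : ℤ} (ht : (m : ℤ) ∣ t) : spVec p 0 t rfl ∈ N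
  long_conj_mem (p : l ⊕ l) (t : ℤ) {A : symplecticGroup l ℤ} (hA : A ∈ N) :
    spVec p 0 t rfl * A * (spVec p 0 t rfl)⁻¹ ∈ N

theorem mem_spPCS_iff {s m : ℕ} {A : symplecticGroup (Fin s) ℤ} :
    A ∈ spPCS s m ↔
      ∀ i j, (m : ℤ) ∣ A.1 i j - (1 : Matrix (Fin s ⊕ Fin s) (Fin s ⊕ Fin s) ℤ) i j := by
  rw [spPCS, MonoidHom.mem_ker, ← Matrix.ext_iff]
  refine forall₂_congr fun i j => ?_
  rw [← ZMod.intCast_zmod_eq_zero_iff_dvd, Int.cast_sub, sub_eq_zero]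
  simp [spReduction, Matrix.one_apply]

instance spPCS_normal (s m : ℕ) : (spPCS s m).Normal := MonoidHom.normal_ker _

theorem spVec_mem_spPCS {s m : ℕ} {p : Fin s ⊕ Fin s} {v : Fin s ⊕ Fin s → ℤ} {c : ℤ}
    (h : v p.swap = 0) (hv : ∀ j, (m : ℤ) ∣ v j) (hc : (m : ℤ) ∣ c) :
    spVec p v c h ∈ spPCS s m := by
  rw [mem_spPCS_iff]
  intro i j
  rw [coe_spVec, Matrix.add_apply, add_sub_cancel_left, Matrix.mul_apply]
  refine Finset.dvd_sum fun k _ => Dvd.dvd.mul_left ?_ _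
  rw [spSymm_apply]
  split_ifs <;> simp [hv, hc, dvd_add]

namespace IsSpElementary

variable {s m : ℕ}

/-- The matrix is a product of short root elements, one for each entry of `v`, and a long one. Each
multiplication shifts the central parameter by a multiple of `m`, so the induction is over all `c`
at once. -/
theorem spVec_mem {l : Type*} [DecidableEq l] [Fintype l] {N : Subgroup (symplecticGroup l ℤ)}
    (hN : IsSpElementary m N) {p : l ⊕ l} {v : l ⊕ l → ℤ} {c : ℤ} (h : v p.swap = 0)
    (hp : v p = 0) (hv : ∀ j, (m : ℤ) ∣ v j) (hc : (m : ℤ) ∣ c) : spVec p v c h ∈ N := by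
  suffices H : ∀ t : Finset (l ⊕ l), ∀ c : ℤ, (m : ℤ) ∣ c →
      spVec p (fun j => if j ∈ t then v j else 0) c (by simp [h]) ∈ N by
    have := H Finset.univ c hc
    simpa using this
  intro t
  induction t using Finset.induction_on with
  | empty => exact fun c hc => hN.long_mem p hc
  | insert a t ha ih =>
    intro c hc
    by_cases hav : v a = 0
    · convert ih c hc using 3 with j
      by_cases hj : j = a <;> simp [hj, hav]
    have hap : p ≠ a := by rintro rfl; exact hav hp
    have has : a ≠ p.swap := by rintro rfl; exact hav h
    set u : l ⊕ l → ℤ := fun j => if j ∈ t then v j else 0 with hu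
    have hus : u p.swap = 0 := by simp [hu, h]
    have hd : (m : ℤ) ∣ u ⬝ᵥ J l ℤ *ᵥ Pi.single a (v a) := by
      refine Finset.dvd_sum fun j _ => Dvd.dvd.mul_right ?_ _
      simp only [hu]
      split_ifs
      exacts [hv j, dvd_zero _]
    have h1 := mul_mem (ih _ (dvd_sub hc hd)) (hN.short_mem hap has (hv a))
    rw [spVec_mul _ _ hus] at h1
    convert h1 using 2
    · ext j
      by_cases hj : j = a
      · subst hj; simp [hu, ha]
      · simp [hu, hj]
    · ring

/-- With this, the operations used for the reduction lie in `N` and in the congruence subgroup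
simultaneously. -/
theorem inf_spPCS {N : Subgroup (symplecticGroup (Fin s) ℤ)} (hN : IsSpElementary m N) :
    IsSpElementary m (N ⊓ spPCS s m) where
  short_mem hpq h t ht := ⟨hN.short_mem hpq h ht, spVec_mem_spPCS _ (fun j => by
    rw [Pi.single_apply]; split_ifs; exacts [ht, dvd_zero _]) (dvd_zero _)⟩
  long_mem p t ht := ⟨hN.long_mem p ht, spVec_mem_spPCS _ (fun j => dvd_zero _) ht⟩
  long_conj_mem p t A hA := ⟨hN.long_conj_mem p t hA.1, (spPCS_normal s m).conj_mem A hA.2 _⟩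

theorem exists_clear_row {N : Subgroup (symplecticGroup (Fin s) ℤ)} (hN : IsSpElementary m N)
    {A : symplecticGroup (Fin s) ℤ} (hA : A ∈ spPCS s m) {p : Fin s ⊕ Fin s}
    (h : A.1 p.swap p.swap = 1) : ∃ v c, ∃ h : v p.swap = 0, v p = 0 ∧ spVec p v c h ∈ N ∧
      ∀ k, (A * spVec p v c h).1 p.swap k =
        (1 : Matrix (Fin s ⊕ Fin s) (Fin s ⊕ Fin s) ℤ) p.swap k := by
  obtain ⟨e, he, heq⟩ : ∃ e : ℤ, e * e = 1 ∧ (A.1 * J (Fin s) ℤ) p.swap p = e := by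
    rcases p with k | k
    · exact ⟨1, by norm_num, by rw [mul_J_apply_inl]; exact h⟩
    · exact ⟨-1, by norm_num, by rw [mul_J_apply_inr]; exact congrArg _ h⟩
  have hA' := mem_spPCS_iff.mp hA
  have hdvd : ∀ k, k ≠ p.swap → (m : ℤ) ∣ A.1 p.swap k := fun k hk => by
    simpa [Matrix.one_apply_ne hk.symm] using hA' p.swap k
  have hpp : p ≠ p.swap := by rcases p with k | k <;> simp
  -- The vector `v` clears the entries outside the pair of `p`; the parameter `c` then clears the
  -- entry at `p`, which also receives a contribution from `v`. The sign `e` comes from `J`.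
  let v : Fin s ⊕ Fin s → ℤ := fun k => if k = p ∨ k = p.swap then 0 else -e * A.1 p.swap k
  have hv : ∀ j, (m : ℤ) ∣ v j := fun j => by
    simp only [v]
    split_ifs with hj
    · exact dvd_zero _
    · exact (hdvd j (fun h => hj (Or.inr h))).mul_left _
  have hvs : v p.swap = 0 := by simp [v]
  have hvp : v p = 0 := by simp [v]
  let c := -e * (A.1 p.swap p + (A.1 * J (Fin s) ℤ) p.swap ⬝ᵥ v)
  have hc : (m : ℤ) ∣ c :=
    (dvd_add (hdvd p hpp) (Finset.dvd_sum fun j _ => (hv j).mul_left _)).mul_left _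
  refine ⟨v, c, hvs, hvp, hN.spVec_mem hvs hvp hv hc, fun k => ?_⟩
  rw [mul_spVec_apply, heq]
  by_cases hk : k = p
  · subst hk
    rw [if_pos rfl, hvp, Matrix.one_apply_ne hpp.symm]
    simp only [c]
    linear_combination -(A.1 k.swap k + (A.1 * J (Fin s) ℤ) k.swap ⬝ᵥ v) * he
  · rw [if_neg hk, add_zero]
    by_cases hks : k = p.swap
    · rw [hks, hvs, h, Matrix.one_apply_eq, mul_zero, add_zero]
    · have hvk : v k = -e * A.1 p.swap k := if_neg (by tauto)
      rw [hvk, Matrix.one_apply_ne (Ne.symm hks)]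
      linear_combination -A.1 p.swap k * he

end IsSpElementary

/-- Separation of the first pair of coordinates. -/
def splitPair (s : ℕ) :
    Fin (s + 1) ⊕ Fin (s + 1) ≃ (Fin s ⊕ Fin s) ⊕ (PUnit.{1} ⊕ PUnit.{1}) :=
  (Equiv.sumCongr ((finSuccEquiv s).trans (Equiv.optionEquivSumPUnit.{0} _))
    ((finSuccEquiv s).trans (Equiv.optionEquivSumPUnit.{0} _))).trans
    (Equiv.sumSumSumComm _ _ _ _)

@[simp] theorem splitPair_inl_zero (s : ℕ) : splitPair s (Sum.inl 0) = Sum.inr (Sum.inl ⟨⟩) := by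
  simp [splitPair]
@[simp] theorem splitPair_inr_zero (s : ℕ) : splitPair s (Sum.inr 0) = Sum.inr (Sum.inr ⟨⟩) := by
  simp [splitPair]
@[simp] theorem splitPair_inl_succ (s : ℕ) (i : Fin s) :
    splitPair s (Sum.inl i.succ) = Sum.inl (Sum.inl i) := by
  simp [splitPair]
@[simp] theorem splitPair_inr_succ (s : ℕ) (i : Fin s) :
    splitPair s (Sum.inr i.succ) = Sum.inl (Sum.inr i) := by
  simp [splitPair]

/-- The matrix that is `A` on all coordinates except for the first pair, and the identity there. -/
def spCorner {s : ℕ} (A : Matrix (Fin s ⊕ Fin s) (Fin s ⊕ Fin s) ℤ) :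
    Matrix (Fin (s + 1) ⊕ Fin (s + 1)) (Fin (s + 1) ⊕ Fin (s + 1)) ℤ :=
  (fromBlocks A 0 0 1).submatrix (splitPair s) (splitPair s)

theorem spCorner_mul {s : ℕ} (A B : Matrix (Fin s ⊕ Fin s) (Fin s ⊕ Fin s) ℤ) :
    spCorner (A * B) = spCorner A * spCorner B := by
  rw [spCorner, spCorner, spCorner, Matrix.submatrix_mul_equiv, fromBlocks_multiply]
  simp

theorem spCorner_one {s : ℕ} : spCorner (1 : Matrix (Fin s ⊕ Fin s) (Fin s ⊕ Fin s) ℤ) = 1 := by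
  rw [spCorner, fromBlocks_one, Matrix.submatrix_one_equiv]

theorem J_eq_submatrix (s : ℕ) : J (Fin (s + 1)) ℤ =
    (fromBlocks (J (Fin s) ℤ) 0 0 (J PUnit.{1} ℤ)).submatrix (splitPair s) (splitPair s) := by
  ext (i | i) (j | j) <;> refine Fin.cases ?_ (fun i => ?_) i <;>
    refine Fin.cases ?_ (fun j => ?_) j <;>
    simp [J, Matrix.one_apply, Fin.succ_ne_zero, (Fin.succ_ne_zero _).symm]

theorem spCorner_mem_iff {s : ℕ} {A : Matrix (Fin s ⊕ Fin s) (Fin s ⊕ Fin s) ℤ} :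
    spCorner A ∈ symplecticGroup (Fin (s + 1)) ℤ ↔ A ∈ symplecticGroup (Fin s) ℤ := by
  rw [SymplecticGroup.mem_iff, SymplecticGroup.mem_iff, J_eq_submatrix, spCorner,
    transpose_submatrix, Matrix.submatrix_mul_equiv, Matrix.submatrix_mul_equiv,
    fromBlocks_transpose, fromBlocks_multiply, fromBlocks_multiply]
  constructor
  · intro h
    have h1 := congrArg (fun M => M.submatrix (splitPair s).symm (splitPair s).symm) h
    simp only [submatrix_submatrix, Equiv.self_comp_symm, submatrix_id_id, fromBlocks_inj] at h1
    simpa using h1.1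
  · intro h
    simp [h]

/-- The embedding of `Sp(2s, ℤ)` into `Sp(2(s+1), ℤ)` that is trivial on the first pair of
coordinates. -/
def spSucc (s : ℕ) : symplecticGroup (Fin s) ℤ →* symplecticGroup (Fin (s + 1)) ℤ where
  toFun A := ⟨spCorner A.1, spCorner_mem_iff.mpr A.2⟩
  map_one' := Subtype.ext spCorner_one
  map_mul' A B := Subtype.ext (spCorner_mul A.1 B.1)

theorem coe_spSucc {s : ℕ} (A : symplecticGroup (Fin s) ℤ) : (spSucc s A).1 = spCorner A.1 := rfl

/-- The shift of the coordinates by one pair. -/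
def pairSucc {s : ℕ} : Fin s ⊕ Fin s → Fin (s + 1) ⊕ Fin (s + 1) := Sum.map Fin.succ Fin.succ

theorem spCorner_pairSucc {s : ℕ} (A : Matrix (Fin s ⊕ Fin s) (Fin s ⊕ Fin s) ℤ)
    (i j : Fin s ⊕ Fin s) : spCorner A (pairSucc i) (pairSucc j) = A i j := by
  rcases i with i | i <;> rcases j with j | j <;> simp [spCorner, pairSucc]

theorem eq_spCorner {s : ℕ} {A : Matrix (Fin (s + 1) ⊕ Fin (s + 1)) (Fin (s + 1) ⊕ Fin (s + 1)) ℤ}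
    (hr : ∀ p k, p = Sum.inl 0 ∨ p = Sum.inr 0 → A p k = (1 : Matrix _ _ ℤ) p k)
    (hc : ∀ p k, p = Sum.inl 0 ∨ p = Sum.inr 0 → A k p = (1 : Matrix _ _ ℤ) k p) :
    A = spCorner (A.submatrix pairSucc pairSucc) := by
  ext (i | i) (j | j) <;> refine Fin.cases ?_ (fun i => ?_) i <;>
    refine Fin.cases ?_ (fun j => ?_) j <;>
    simp [hr, hc, spCorner, pairSucc, Fin.succ_ne_zero, (Fin.succ_ne_zero _).symm]

theorem swap_pairSucc {s : ℕ} (p : Fin s ⊕ Fin s) : (pairSucc p).swap = pairSucc p.swap := by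
  rcases p with i | i <;> rfl

theorem pairSucc_injective {s : ℕ} : Function.Injective (pairSucc (s := s)) :=
  Sum.map_injective.mpr ⟨Fin.succ_injective _, Fin.succ_injective _⟩

theorem spSucc_spVec {s : ℕ} {p : Fin s ⊕ Fin s} {v : Fin s ⊕ Fin s → ℤ}
    {v' : Fin (s + 1) ⊕ Fin (s + 1) → ℤ} (c : ℤ) (h : v p.swap = 0) (hv : ∀ i, v' (pairSucc i) = v i)
    (hl : v' (Sum.inl 0) = 0) (hr : v' (Sum.inr 0) = 0) : spSucc s (spVec p v c h) =
      spVec (pairSucc p) v' c (by rw [swap_pairSucc, hv, h]) := by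
  refine Subtype.ext ?_
  rw [coe_spSucc, coe_spVec, coe_spVec, J_eq_submatrix]
  have hS : spSymm (pairSucc p) v' c =
      (fromBlocks (spSymm p v c) 0 0 0).submatrix (splitPair s) (splitPair s) := by
    ext i j
    rw [spSymm_apply]
    rcases i with i | i <;> rcases j with j | j <;> refine Fin.cases ?_ (fun i => ?_) i <;>
      refine Fin.cases ?_ (fun j => ?_) j <;> rcases p with p | p <;>
      simp [hl, hr, spSymm_apply, pairSucc, ← hv, Fin.succ_inj, (Fin.succ_ne_zero _).symm]
  rw [hS, Matrix.submatrix_mul_equiv, ← Matrix.submatrix_one_equiv (splitPair s), spCorner]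
  rw [← fromBlocks_one (l := Fin s ⊕ Fin s) (m := PUnit.{1} ⊕ PUnit.{1}), fromBlocks_multiply]
  rw [← show ∀ M M' : Matrix ((Fin s ⊕ Fin s) ⊕ (PUnit.{1} ⊕ PUnit.{1})) _ ℤ,
    (M + M').submatrix (splitPair s) (splitPair s) = M.submatrix (splitPair s) (splitPair s) +
      M'.submatrix (splitPair s) (splitPair s) from fun _ _ => rfl, fromBlocks_add]
  simp

namespace IsSpElementary

variable {s m : ℕ} {N : Subgroup (symplecticGroup (Fin (s + 1)) ℤ)}

theorem mem_of_apply_eq_one (hN : IsSpElementary m N) (hsub : ∀ B ∈ spPCS s m, spSucc s B ∈ N)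
    {A : symplecticGroup (Fin (s + 1)) ℤ} (hA : A ∈ spPCS (s + 1) m)
    (h : A.1 (Sum.inl 0) (Sum.inl 0) = 1) : A ∈ N := by
  obtain ⟨v, c, hv, -, ⟨hU, hU'⟩, hrow⟩ :=
    hN.inf_spPCS.exists_clear_row hA (p := Sum.inr 0) h
  rw [← N.mul_mem_cancel_right hU]
  replace hA := mul_mem hA hU'
  generalize A * spVec (Sum.inr 0) v c hv = B at *
  clear! A v c
  replace hrow : ∀ k, B.1 (Sum.inl 0) k =
    (1 : Matrix (Fin (s + 1) ⊕ Fin (s + 1)) (Fin (s + 1) ⊕ Fin (s + 1)) ℤ) (Sum.inl 0) k := hrow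
  have horth := mul_J_mul_transpose_apply B
  -- Once row `inl 0` is a basis vector, its pairing with row `inr 0` determines this corner, so the
  -- second row can be cleared as well.
  have hB : B.1 (Sum.inr 0) (Sum.inr 0) = 1 := by
    have h1 := horth (Sum.inr 0) (Sum.inl 0)
    have h2 : B.1 (Sum.inl 0) = Pi.single (Sum.inl 0) 1 := by
      ext k
      rw [hrow, Matrix.one_apply, Pi.single_apply]
      simp only [eq_comm]
    rw [h2, dotProduct_single, mul_one, mul_J_apply_inl] at h1
    rw [h1]
    simp [J]
  obtain ⟨v, c, hv, hvp, ⟨hU, hU'⟩, hrow'⟩ :=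
    hN.inf_spPCS.exists_clear_row hA (p := Sum.inl 0) hB
  -- The second clearing leaves row `inl 0` alone: that row pairs nontrivially with the entry at
  -- `inr 0` only, and there `v` vanishes.
  have hrow0 : ∀ k, (B * spVec (Sum.inl 0) v c hv).1 (Sum.inl 0) k =
      (1 : Matrix (Fin (s + 1) ⊕ Fin (s + 1)) (Fin (s + 1) ⊕ Fin (s + 1)) ℤ) (Sum.inl 0) k := by
    intro k
    rw [mul_spVec_apply, hrow, mul_J_apply_inl, hrow]
    have : (B.1 * J (Fin (s + 1)) ℤ) (Sum.inl 0) ⬝ᵥ v = 0 := by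
      refine Finset.sum_eq_zero fun j _ => ?_
      rcases j with j | j
      · rw [mul_J_apply_inl, hrow]; simp
      · rw [mul_J_apply_inr, hrow]
        by_cases hj : j = 0
        · rw [hj, show v (Sum.inr 0) = 0 from hv, mul_zero]
        · rw [Matrix.one_apply_ne (by simpa using Ne.symm hj)]; simp
    rw [this]
    simp
  rw [← N.mul_mem_cancel_right hU]
  replace hA := mul_mem hA hU'
  generalize B * spVec (Sum.inl 0) v c hv = D at *
  clear! B v c
  replace hrow' : ∀ k, D.1 (Sum.inr 0) k =
    (1 : Matrix (Fin (s + 1) ⊕ Fin (s + 1)) (Fin (s + 1) ⊕ Fin (s + 1)) ℤ) (Sum.inr 0) k := hrow'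
  have horth := mul_J_mul_transpose_apply D
  have e1 : D.1 (Sum.inl 0) = Pi.single (Sum.inl 0) 1 := by
    ext k
    rw [hrow0, Matrix.one_apply, Pi.single_apply]
    simp only [eq_comm]
  have e2 : D.1 (Sum.inr 0) = Pi.single (Sum.inr 0) 1 := by
    ext k
    rw [hrow', Matrix.one_apply, Pi.single_apply]
    simp only [eq_comm]
  -- The two columns need no operations: pairing any row with the two cleared rows yields its
  -- entries there.
  have hD : D.1 = spCorner (D.1.submatrix pairSucc pairSucc) := by
    refine eq_spCorner ?_ ?_
    · rintro p k (rfl | rfl)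
      exacts [hrow0 k, hrow' k]
    · rintro p k (rfl | rfl)
      · have h1 := horth k (Sum.inr 0)
        rw [e2, dotProduct_single, mul_one, mul_J_apply_inr] at h1
        rw [eq_comm, ← neg_inj, h1]
        rcases k with k | k <;> simp [J, Matrix.one_apply]
      · have h1 := horth k (Sum.inl 0)
        rw [e1, dotProduct_single, mul_one, mul_J_apply_inl] at h1
        rw [h1]
        rcases k with k | k <;> simp [J, Matrix.one_apply]
  have hD' : D = spSucc s ⟨D.1.submatrix pairSucc pairSucc, spCorner_mem_iff.mp (hD ▸ D.2)⟩ :=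
    Subtype.ext hD
  rw [hD']
  refine hsub _ ?_
  rw [mem_spPCS_iff] at hA ⊢
  intro i j
  have := hA (pairSucc i) (pairSucc j)
  simpa [Matrix.one_apply, pairSucc_injective.eq_iff] using this

/-- Conjugation by a long root element adds column `inr 0` to column `inl 0` and, on the left,
changes row `inr 0` only. So normalization by long root elements is enough. -/
theorem mem_of_apply_add_apply_eq_one (hN : IsSpElementary m N)
    (hsub : ∀ B ∈ spPCS s m, spSucc s B ∈ N) {A : symplecticGroup (Fin (s + 1)) ℤ}
    (hA : A ∈ spPCS (s + 1) m)
    (h : A.1 (Sum.inl 0) (Sum.inl 0) + A.1 (Sum.inl 0) (Sum.inr 0) = 1) : A ∈ N := by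
  set T : symplecticGroup (Fin (s + 1)) ℤ := spVec (Sum.inl 0) 0 1 rfl with hT
  have h1 : T⁻¹ * (A * T) ∈ N := by
    refine hN.mem_of_apply_eq_one hsub ?_ ?_
    · have := (spPCS_normal (s + 1) m).conj_mem A hA T⁻¹
      rwa [inv_inv, mul_assoc] at this
    · rw [hT, spVec_inv, Submonoid.coe_mul, coe_spVec, add_mul, one_mul, Matrix.add_apply,
        mul_spVec_apply, mul_J_apply_inl]
      rw [Matrix.mul_assoc, Matrix.mul_apply, Finset.sum_eq_zero]
      · simpa using h
      · rintro (j | j) -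
        · simp [J]
        · simp [J, Matrix.mul_apply, spSymm_apply]
  have := hN.long_conj_mem (Sum.inl 0) 1 h1
  rw [← hT] at this
  simpa [mul_assoc] using this

end IsSpElementary

/-- The integer provided by `exists_isCoprime_add_mul` can be taken to be nonzero. -/
theorem exists_isCoprime_add_mul_ne_zero {x y g : ℤ} (hx : x ≠ 0) (hg : g ≠ 0)
    (h : ∀ p : ℕ, p.Prime → (p : ℤ) ∣ x → (p : ℤ) ∣ y → ¬ (p : ℤ) ∣ g) :
    ∃ k, IsCoprime (x + k * y) g ∧ x + k * y ≠ 0 := by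
  obtain ⟨k, hk⟩ := exists_isCoprime_add_mul hg h
  by_cases h0 : x + k * y = 0
  · have hy : y ≠ 0 := by
      rintro rfl
      simp [hx] at h0
    refine ⟨k + g, ?_, ?_⟩
    · rw [show x + (k + g) * y = x + k * y + g * y by ring]
      exact hk.add_mul_left_left y
    · rw [show x + (k + g) * y = x + k * y + g * y by ring, h0, zero_add]
      exact mul_ne_zero hg hy
  · exact ⟨k, hk, h0⟩

theorem not_dvd_of_dvd_sub_one {m a : ℤ} (h : m ∣ a - 1) {p : ℕ} (hp : p.Prime)
    (ha : (p : ℤ) ∣ a) : ¬ (p : ℤ) ∣ m := fun hm =>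
  (Nat.prime_iff_prime_int.mp hp).not_isUnit
    (isUnit_of_dvd_one (by simpa using dvd_sub ha (hm.trans h)))

/-- The values of `w ⬝ᵥ z` form an ideal of ℤ; some `z` attains a generator. -/
theorem exists_dotProduct_dvd {ι : Type*} [Fintype ι] [DecidableEq ι] (w : ι → ℤ) :
    ∃ z : ι → ℤ, ∀ j, w ⬝ᵥ z ∣ w j := by
  obtain ⟨g, hg⟩ := (IsPrincipalIdealRing.principal
    (LinearMap.range (dotProductBilin ℤ ℤ w))).principal
  have h1 : g ∈ LinearMap.range (dotProductBilin ℤ ℤ w) := by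
    rw [hg]; exact Submodule.mem_span_singleton_self g
  obtain ⟨z, hz⟩ := h1
  refine ⟨z, fun j => ?_⟩
  have h2 : w j ∈ LinearMap.range (dotProductBilin ℤ ℤ w) :=
    ⟨Pi.single j 1, by simp [dotProductBilin]⟩
  rw [hg, Submodule.mem_span_singleton] at h2
  obtain ⟨a, ha⟩ := h2
  refine ⟨a, ?_⟩
  rw [← ha, smul_eq_mul, mul_comm, ← hz]
  rfl

namespace IsSpElementary

variable {s m : ℕ} {N : Subgroup (symplecticGroup (Fin (s + 1)) ℤ)}

/-- The operation subtracts `d` times the Bézout combination, that is `d`, from the entry at `inr 0`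
and keeps the corner. The two entries then add up to `1`. -/
theorem mem_of_isCoprime (hN : IsSpElementary m N) (hsub : ∀ B ∈ spPCS s m, spSucc s B ∈ N)
    {A : symplecticGroup (Fin (s + 1)) ℤ} (hA : A ∈ spPCS (s + 1) m) {e : Fin (s + 1)} (he : e ≠ 0)
    (h : IsCoprime (A.1 (Sum.inl 0) (Sum.inl 0)) (A.1 (Sum.inl 0) (Sum.inl e))) : A ∈ N := by
  obtain ⟨x, y, hxy⟩ := h
  set d := A.1 (Sum.inl 0) (Sum.inl 0) + A.1 (Sum.inl 0) (Sum.inr 0) - 1 with hd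
  have hm : (m : ℤ) ∣ d := by
    have h0 := mem_spPCS_iff.mp hA (Sum.inl 0) (Sum.inl 0)
    have h1 := mem_spPCS_iff.mp hA (Sum.inl 0) (Sum.inr 0)
    rw [Matrix.one_apply_ne (by simp), sub_zero] at h1
    rw [Matrix.one_apply_eq] at h0
    rw [hd, add_sub_right_comm]
    exact dvd_add h0 h1
  have hv : (Pi.single (Sum.inr e) (y * d) : Fin (s + 1) ⊕ Fin (s + 1) → ℤ) (Sum.inr 0).swap = 0 :=
    rfl
  obtain ⟨hU, hU'⟩ := hN.inf_spPCS.spVec_mem (p := Sum.inr 0) (c := x * d) hv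
    (by simp [he.symm])
    (fun j => by rw [Pi.single_apply]; split_ifs; exacts [hm.mul_left _, dvd_zero _])
    (hm.mul_left _)
  rw [← N.mul_mem_cancel_right hU]
  refine hN.mem_of_apply_add_apply_eq_one hsub (mul_mem hA hU') ?_
  rw [mul_spVec_apply, mul_spVec_apply, mul_J_apply_inr, dotProduct_single, mul_J_apply_inr]
  simp [he.symm]
  linear_combination -d * hxy

/-- A multiple of `m * (w ⬝ᵥ z)`, less the term at `inl e`, is added to the entry at `inl e` so that
it becomes coprime to the corner. The vector `v` accounts for the coordinates outside the pair of
`e`, and the parameter `c` for `inr e`. The condition on `z` makes `v` vanish at `inl 0`, so the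
corner stays fixed. -/
theorem mem_of_isCoprime_dotProduct (hN : IsSpElementary m N)
    (hsub : ∀ B ∈ spPCS s m, spSucc s B ∈ N) {A : symplecticGroup (Fin (s + 1)) ℤ}
    (hA : A ∈ spPCS (s + 1) m) {e : Fin (s + 1)} (he : e ≠ 0)
    (h0 : A.1 (Sum.inl 0) (Sum.inl 0) ≠ 0) {z : Fin (s + 1) ⊕ Fin (s + 1) → ℤ}
    (hr : z (Sum.inr 0) = 0)
    (h : IsCoprime (A.1 (Sum.inl 0) (Sum.inl 0)) (A.1 (Sum.inl 0) ⬝ᵥ z)) : A ∈ N := by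
  set w := A.1 (Sum.inl 0) with hw
  have hA0 := mem_spPCS_iff.mp hA (Sum.inl 0) (Sum.inl 0)
  rw [Matrix.one_apply_eq, ← hw] at hA0
  obtain ⟨k, hk⟩ : ∃ k, IsCoprime (w (Sum.inl e) +
      k * (m * (w ⬝ᵥ z - w (Sum.inl e) * z (Sum.inl e)))) (w (Sum.inl 0)) := by
    refine exists_isCoprime_add_mul h0 fun p hp h1 h2 h3 => ?_
    have hpp := Nat.prime_iff_prime_int.mp hp
    have h4 := (hpp.dvd_or_dvd h2).resolve_left (not_dvd_of_dvd_sub_one hA0 hp h3)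
    have h5 : (p : ℤ) ∣ w ⬝ᵥ z := by simpa using dvd_add h4 (h1.mul_right (z (Sum.inl e)))
    exact hpp.not_isUnit (h.isUnit_of_dvd' h3 h5)
  set z' := z - Pi.single (Sum.inl e) (z (Sum.inl e)) - Pi.single (Sum.inr e) (z (Sum.inr e))
    with hz'
  set v := (-(k * m)) • (J (Fin (s + 1)) ℤ *ᵥ z') with hv
  have hvl : ∀ i, v (Sum.inl i) = k * m * z' (Sum.inr i) := fun i => by
    simp [hv, J_mulVec_inl]
  have hvr : ∀ i, v (Sum.inr i) = -(k * m) * z' (Sum.inl i) := fun i => by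
    simp [hv, J_mulVec_inr]
  have hdot : (A.1 * J (Fin (s + 1)) ℤ) (Sum.inl 0) ⬝ᵥ v = k * m * (w ⬝ᵥ z') := by
    rw [hv, dotProduct_smul]
    have : (A.1 * J (Fin (s + 1)) ℤ) (Sum.inl 0) = w ᵥ* J (Fin (s + 1)) ℤ := rfl
    rw [this, ← dotProduct_mulVec, mulVec_mulVec, J_squared, neg_mulVec, one_mulVec,
      dotProduct_neg]
    simp
  have hwz : w ⬝ᵥ z' = w ⬝ᵥ z - w (Sum.inl e) * z (Sum.inl e) - w (Sum.inr e) * z (Sum.inr e) := by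
    rw [hz', dotProduct_sub, dotProduct_sub, dotProduct_single, dotProduct_single]
  have hvs : v (Sum.inl e : Fin (s + 1) ⊕ Fin (s + 1)).swap = 0 := by
    rw [Sum.swap_inl, hvr]; simp [hz']
  have hvp : v (Sum.inl e) = 0 := by rw [hvl]; simp [hz']
  have hv0 : v (Sum.inl 0) = 0 := by rw [hvl]; simp [hz', hr, he]
  obtain ⟨hU, hU'⟩ := hN.inf_spPCS.spVec_mem (p := Sum.inl e) (c := k * m * z (Sum.inr e)) hvs hvp
    (by
      rintro (j | j)
      · rw [hvl]; exact ((dvd_mul_left _ _).mul_right _)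
      · rw [hvr]; exact ((dvd_neg.mpr (dvd_mul_left _ _)).mul_right _))
    ((dvd_mul_left _ _).mul_right _)
  rw [← N.mul_mem_cancel_right hU]
  refine hN.mem_of_isCoprime hsub (mul_mem hA hU') he ?_
  rw [mul_spVec_apply, mul_spVec_apply, mul_J_apply_inl, hdot, hwz, hv0, hvp,
    if_neg (by simpa using he.symm), if_pos rfl, ← hw]
  convert hk.symm using 1
  · ring
  · ring

/-- Outside the first pair the entries of the row have greatest common divisor `w' ⬝ᵥ z` up to sign.
As the row is unimodular, a long root operation makes the corner coprime to this number and keeps it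
nonzero; that operation does not touch the other entries. -/
theorem mem_of_ne_zero (hN : IsSpElementary m N)
    (hsub : ∀ B ∈ spPCS s m, spSucc s B ∈ N) {A : symplecticGroup (Fin (s + 1)) ℤ}
    (hA : A ∈ spPCS (s + 1) m) {e : Fin (s + 1)} (he : e ≠ 0)
    (h0 : A.1 (Sum.inl 0) (Sum.inl 0) ≠ 0) (h1 : A.1 (Sum.inl 0) (Sum.inl e) ≠ 0) : A ∈ N := by
  set w := A.1 (Sum.inl 0) with hw
  have hA0 := mem_spPCS_iff.mp hA (Sum.inl 0) (Sum.inl 0)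
  rw [Matrix.one_apply_eq, ← hw] at hA0
  set w' := w - Pi.single (Sum.inl 0) (w (Sum.inl 0)) - Pi.single (Sum.inr 0) (w (Sum.inr 0))
    with hw'
  obtain ⟨z, hz⟩ := exists_dotProduct_dvd w'
  have hww : ∀ j, j ≠ 0 → w' (Sum.inl j) = w (Sum.inl j) ∧ w' (Sum.inr j) = w (Sum.inr j) :=
    fun j hj => by simp [hw', hj]
  have hg : w' ⬝ᵥ z ≠ 0 := fun h => by
    have := hz (Sum.inl e)
    rw [h, zero_dvd_iff, (hww e he).1] at this
    exact h1 this
  obtain ⟨k, hk, hk0⟩ : ∃ k, IsCoprime (w (Sum.inl 0) + k * (m * w (Sum.inr 0))) (w' ⬝ᵥ z) ∧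
      w (Sum.inl 0) + k * (m * w (Sum.inr 0)) ≠ 0 := by
    refine exists_isCoprime_add_mul_ne_zero h0 hg fun p hp h2 h3 h4 => ?_
    have hpp := Nat.prime_iff_prime_int.mp hp
    have h5 := (hpp.dvd_or_dvd h3).resolve_left (not_dvd_of_dvd_sub_one hA0 hp h2)
    have h6 : ∀ j, (p : ℤ) ∣ w j := by
      rintro (j | j) <;> by_cases hj : j = 0
      · rwa [hj]
      · rw [← (hww j hj).1]; exact h4.trans (hz _)
      · rwa [hj]
      · rw [← (hww j hj).2]; exact h4.trans (hz _)
    have h7 : (A.1 * J (Fin (s + 1)) ℤ) (Sum.inr 0) ⬝ᵥ w = 1 := by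
      rw [hw, mul_J_mul_transpose_apply]
      simp [J]
    refine hpp.not_isUnit (isUnit_of_dvd_one ?_)
    rw [← h7]
    exact Finset.dvd_sum fun j _ => (h6 j).mul_left _
  set z' := z - Pi.single (Sum.inl 0) (z (Sum.inl 0)) - Pi.single (Sum.inr 0) (z (Sum.inr 0))
    with hz'
  have hwz : w ⬝ᵥ z' = w' ⬝ᵥ z := by
    simp only [hz', hw', dotProduct_sub, sub_dotProduct, dotProduct_single, single_dotProduct]
  have hl : z' (Sum.inl 0) = 0 := by simp [hz']
  have hr : z' (Sum.inr 0) = 0 := by simp [hz']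
  obtain ⟨hU, hU'⟩ := hN.inf_spPCS.spVec_mem (p := Sum.inl 0) (v := 0) (c := k * m) rfl rfl
    (fun _ => dvd_zero _) (dvd_mul_left _ _)
  have hrow : ∀ j, (A * spVec (Sum.inl 0) 0 (k * m) rfl).1 (Sum.inl 0) j =
      w j + if j = Sum.inl 0 then k * (m * w (Sum.inr 0)) else 0 := fun j => by
    rw [mul_spVec_apply, mul_J_apply_inl, ← hw]
    split_ifs <;> simp [mul_assoc]
  rw [← N.mul_mem_cancel_right hU]
  refine hN.mem_of_isCoprime_dotProduct hsub (mul_mem hA hU') he ?_ hr ?_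
  · rwa [hrow, if_pos rfl]
  · rw [hrow, if_pos rfl]
    convert hk using 1
    rw [← hwz]
    refine Finset.sum_congr rfl fun j _ => ?_
    rw [hrow]
    split_ifs with hj
    · rw [hj, hl, mul_zero, mul_zero]
    · rw [add_zero]

/-- Reduction of the congruence subgroup of `Sp(2(s + 1), ℤ)` to that of `Sp(2s, ℤ)`. -/
theorem spPCS_succ_le (hm : 0 < m) (hs : 1 ≤ s) (hN : IsSpElementary m N)
    (hsub : ∀ B ∈ spPCS s m, spSucc s B ∈ N) : spPCS (s + 1) m ≤ N := by
  have hm0 : (m : ℤ) ≠ 0 := by exact_mod_cast hm.ne'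
  have he : (⟨1, by omega⟩ : Fin (s + 1)) ≠ 0 := by simp [Fin.ext_iff]
  have key : ∀ A ∈ spPCS (s + 1) m, A.1 (Sum.inl 0) (Sum.inl 0) ≠ 0 → A ∈ N := by
    intro A hA h0
    by_cases h1 : A.1 (Sum.inl 0) (Sum.inl ⟨1, by omega⟩) = 0
    · obtain ⟨hU, hU'⟩ := hN.inf_spPCS.spVec_mem (p := Sum.inr 0)
        (v := Pi.single (Sum.inl ⟨1, by omega⟩) (m : ℤ)) (c := 0)
        (by rw [Sum.swap_inr]; simp [he.symm]) (by simp)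
        (fun j => by rw [Pi.single_apply]; split_ifs; exacts [dvd_rfl, dvd_zero _]) (dvd_zero _)
      rw [← N.mul_mem_cancel_right hU]
      refine hN.mem_of_ne_zero hsub (mul_mem hA hU') he ?_ ?_
      · rw [mul_spVec_apply]
        simpa [he.symm, hm.ne'] using h0
      · rw [mul_spVec_apply, h1, mul_J_apply_inr]
        simpa [hm.ne'] using h0
    · exact hN.mem_of_ne_zero hsub hA he h0 h1
  intro A hA
  by_cases h0 : A.1 (Sum.inl 0) (Sum.inl 0) = 0
  · obtain ⟨q, hq⟩ : ∃ q, (A.1 * J (Fin (s + 1)) ℤ) (Sum.inl 0) q ≠ 0 := by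
      by_contra! hz
      have h1 := mul_J_mul_transpose_apply A (Sum.inl 0) (Sum.inr 0)
      rw [show (A.1 * J (Fin (s + 1)) ℤ) (Sum.inl 0) = 0 from funext hz, zero_dotProduct] at h1
      simp [J] at h1
    have hqr : q ≠ Sum.inr 0 := by
      rintro rfl
      rw [mul_J_apply_inr, h0] at hq
      exact hq neg_zero
    by_cases hql : q = Sum.inl 0
    · obtain ⟨hU, hU'⟩ := hN.inf_spPCS.spVec_mem (p := Sum.inl 0) (v := 0) (c := m) rfl rfl
        (fun _ => dvd_zero _) dvd_rfl
      rw [← N.mul_mem_cancel_right hU]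
      refine key _ (mul_mem hA hU') ?_
      rw [mul_spVec_apply, h0]
      rw [hql] at hq
      simpa [hm.ne'] using hq
    · obtain ⟨hU, hU'⟩ := hN.inf_spPCS.spVec_mem (p := Sum.inl 0)
        (v := Pi.single q (m : ℤ)) (c := 0) (single_swap_eq_zero hqr _)
        (Pi.single_eq_of_ne (Ne.symm hql) _)
        (fun j => by rw [Pi.single_apply]; split_ifs; exacts [dvd_rfl, dvd_zero _]) (dvd_zero _)
      rw [← N.mul_mem_cancel_right hU]
      refine key _ (mul_mem hA hU') ?_
      rw [mul_spVec_apply, h0, dotProduct_single, Pi.single_eq_of_ne (Ne.symm hql)]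
      simpa [hm.ne'] using hq
  · exact key A hA h0

end IsSpElementary

/-! ### Generation of Sp(2s, ℤ) by elementary matrices. -/

/-- The elementary symplectic matrices with parameter `1`. -/
def spElementary (s : ℕ) : Set (symplecticGroup (Fin s) ℤ) :=
  {A | (∃ p q, ∃ h : q ≠ Sum.swap p, p ≠ q ∧ A = spVec p (Pi.single q 1) 0 (single_swap_eq_zero h 1)) ∨
    ∃ p, A = spVec p 0 1 rfl}

theorem spVec_zsmul_mem {l : Type*} [DecidableEq l] [Fintype l]
    {N : Subgroup (symplecticGroup l ℤ)} {p : l ⊕ l} {v : l ⊕ l → ℤ} {c : ℤ} {h : v p.swap = 0}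
    (hN : spVec p v c h ∈ N) (k : ℤ) : spVec p (k • v) (k * c) (by simp [h]) ∈ N := by
  obtain ⟨n, rfl | rfl⟩ := k.eq_nat_or_neg
  · rw [← spVec_pow]
    exact pow_mem hN n
  · have h1 := inv_mem (pow_mem hN n)
    rw [spVec_pow, spVec_inv] at h1
    rwa [spVec_congr (by simp [h]) (neg_smul (n : ℤ) v) (neg_mul (n : ℤ) c)]

theorem spVec_mem_of_dvd {l : Type*} [DecidableEq l] [Fintype l] {m : ℕ}
    {N : Subgroup (symplecticGroup l ℤ)} {p : l ⊕ l} (hN : spVec p 0 m rfl ∈ N) {t : ℤ}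
    (ht : (m : ℤ) ∣ t) : spVec p 0 t rfl ∈ N := by
  obtain ⟨k, rfl⟩ := ht
  rw [spVec_congr rfl (smul_zero k).symm (mul_comm (m : ℤ) k)]
  exact spVec_zsmul_mem hN k

theorem spVec_single_mem_of_dvd {l : Type*} [DecidableEq l] [Fintype l] {m : ℕ}
    {N : Subgroup (symplecticGroup l ℤ)} {p q : l ⊕ l} (h : q ≠ p.swap)
    (hN : spVec p (Pi.single q (m : ℤ)) 0 (single_swap_eq_zero h _) ∈ N) {t : ℤ}
    (ht : (m : ℤ) ∣ t) : spVec p (Pi.single q t) 0 (single_swap_eq_zero h _) ∈ N := by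
  obtain ⟨k, rfl⟩ := ht
  have h1 : (Pi.single q (m * k) : l ⊕ l → ℤ) = k • Pi.single q (m : ℤ) := by
    rw [← Pi.single_smul, smul_eq_mul, mul_comm]
  rw [spVec_congr (single_swap_eq_zero h _) h1 (mul_zero k).symm]
  exact spVec_zsmul_mem hN k

theorem isSpElementary_closure (s : ℕ) :
    IsSpElementary 1 (Subgroup.closure (spElementary s)) where
  short_mem hpq h t ht := spVec_single_mem_of_dvd (m := 1) h
    (Subgroup.subset_closure (Or.inl ⟨_, _, h, hpq, rfl⟩)) ht
  long_mem p t ht := spVec_mem_of_dvd (m := 1) (Subgroup.subset_closure (Or.inr ⟨p, rfl⟩)) ht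
  long_conj_mem p t A hA := by
    have := spVec_mem_of_dvd (m := 1) (Subgroup.subset_closure (Or.inr ⟨p, rfl⟩) : _ ∈ Subgroup.closure (spElementary s)) (one_dvd t)
    exact mul_mem (mul_mem this hA) (inv_mem this)

theorem spPCS_one (s : ℕ) : spPCS s 1 = ⊤ :=
  eq_top_iff.mpr fun A _ => mem_spPCS_iff.mpr fun i j => by simp

/-- The isomorphism from `SL(2, ℤ)` onto `Sp(2, ℤ)`. -/
def slTwoToSp : SpecialLinearGroup (Fin 2) ℤ →* symplecticGroup (Fin 1) ℤ where
  toFun A := ⟨fromBlocks !![A 0 0] !![A 0 1] !![A 1 0] !![A 1 1], by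
    have hd : A 0 0 * A 1 1 - A 0 1 * A 1 0 = 1 := by rw [← det_fin_two]; exact A.2
    rw [SymplecticGroup.mem_iff, J, fromBlocks_transpose, fromBlocks_multiply, fromBlocks_multiply,
      fromBlocks_inj]
    refine ⟨?_, ?_, ?_, ?_⟩ <;> ext i j <;> fin_cases i <;> fin_cases j <;>
      simp [vecMul, dotProduct] <;> linarith⟩
  map_one' := Subtype.ext (by
    change fromBlocks _ _ _ _ = 1
    rw [← fromBlocks_one, fromBlocks_inj]
    refine ⟨?_, ?_, ?_, ?_⟩ <;> ext i j <;> fin_cases i <;> fin_cases j <;> simp)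
  map_mul' A B := Subtype.ext (by
    change fromBlocks _ _ _ _ = fromBlocks _ _ _ _ * fromBlocks _ _ _ _
    rw [fromBlocks_multiply, fromBlocks_inj]
    refine ⟨?_, ?_, ?_, ?_⟩ <;> ext i j <;> fin_cases i <;> fin_cases j <;>
      simp [Matrix.mul_apply])

theorem coe_slTwoToSp (A : SpecialLinearGroup (Fin 2) ℤ) :
    (slTwoToSp A).1 = fromBlocks !![A 0 0] !![A 0 1] !![A 1 0] !![A 1 1] := rfl

theorem exists_slTwoToSp_eq (B : symplecticGroup (Fin 1) ℤ) : ∃ A, slTwoToSp A = B ∧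
    A 0 0 = B.1 (Sum.inl 0) (Sum.inl 0) ∧ A 0 1 = B.1 (Sum.inl 0) (Sum.inr 0) ∧
    A 1 0 = B.1 (Sum.inr 0) (Sum.inl 0) ∧ A 1 1 = B.1 (Sum.inr 0) (Sum.inr 0) := by
  have h1 := mul_J_mul_transpose_apply B (Sum.inr 0) (Sum.inl 0)
  simp only [dotProduct, Fintype.sum_sum_type, mul_J_apply_inl, mul_J_apply_inr] at h1
  simp [J] at h1
  refine ⟨⟨!![B.1 (Sum.inl 0) (Sum.inl 0), B.1 (Sum.inl 0) (Sum.inr 0);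
    B.1 (Sum.inr 0) (Sum.inl 0), B.1 (Sum.inr 0) (Sum.inr 0)], ?_⟩, ?_, rfl, rfl, rfl, rfl⟩
  · rw [det_fin_two_of]
    linarith
  · refine Subtype.ext ?_
    ext (i | i) (j | j) <;> fin_cases i <;> fin_cases j <;> rfl

theorem spVec_inl_zero_slTwoToSp (t : ℤ) :
    slTwoToSp (lowerUnip t) = spVec (Sum.inl 0) 0 t rfl := by
  refine Subtype.ext ?_
  rw [coe_slTwoToSp, coe_spVec, J, ← fromBlocks_one]
  ext (i | i) (j | j) <;> fin_cases i <;> fin_cases j <;>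
    simp [Matrix.mul_apply, spSymm_apply]

theorem spVec_inr_zero_slTwoToSp (t : ℤ) :
    slTwoToSp (upperUnip t) = spVec (Sum.inr 0) 0 (-t) rfl := by
  refine Subtype.ext ?_
  rw [coe_slTwoToSp, coe_spVec, J, ← fromBlocks_one]
  ext (i | i) (j | j) <;> fin_cases i <;> fin_cases j <;>
    simp [Matrix.mul_apply, spSymm_apply]

theorem closure_spElementary {s : ℕ} (hs : 1 ≤ s) : Subgroup.closure (spElementary s) = ⊤ := by
  induction s, hs using Nat.le_induction with
  | base =>
    have h : Subgroup.closure (slElementary 2) ≤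
        (Subgroup.closure (spElementary 1)).comap slTwoToSp := by
      rw [Subgroup.closure_le]
      rintro - ⟨i, j, h, rfl⟩
      rw [SetLike.mem_coe, Subgroup.mem_comap]
      fin_cases i <;> fin_cases j
      · exact absurd rfl h
      · have := upperUnip_eq_transvection 1
        rw [show SpecialLinearGroup.transvection h 1 = upperUnip 1 from this.symm, spVec_inr_zero_slTwoToSp]
        exact (isSpElementary_closure 1).long_mem _ (one_dvd _)
      · have := lowerUnip_eq_transvection 1
        rw [show SpecialLinearGroup.transvection h 1 = lowerUnip 1 from this.symm, spVec_inl_zero_slTwoToSp]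
        exact (isSpElementary_closure 1).long_mem _ (one_dvd _)
      · exact absurd rfl h
    rw [closure_slElementary le_rfl] at h
    refine eq_top_iff.mpr fun B _ => ?_
    obtain ⟨A, rfl, -⟩ := exists_slTwoToSp_eq B
    exact h (Subgroup.mem_top A)
  | succ s hs ih =>
    rw [eq_top_iff, ← spPCS_one]
    refine (isSpElementary_closure (s + 1)).spPCS_succ_le one_pos hs fun B _ => ?_
    have h : Subgroup.closure (spElementary s) ≤
        (Subgroup.closure (spElementary (s + 1))).comap (spSucc s) := by
      rw [Subgroup.closure_le]
      rintro - (⟨p, q, hqs, hpq, rfl⟩ | ⟨p, rfl⟩)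
      · rw [SetLike.mem_coe, Subgroup.mem_comap, spSucc_spVec (v' := Pi.single (pairSucc q) 1) _ _
          (fun i => by simp [Pi.single_apply, pairSucc_injective.eq_iff])
          (by rcases q with q | q <;> simp [pairSucc, (Fin.succ_ne_zero _).symm])
          (by rcases q with q | q <;> simp [pairSucc, (Fin.succ_ne_zero _).symm])]
        exact (isSpElementary_closure (s + 1)).short_mem (pairSucc_injective.ne hpq)
          (by rw [swap_pairSucc]; exact pairSucc_injective.ne hqs) (one_dvd _)
      · rw [SetLike.mem_coe, Subgroup.mem_comap, spSucc_spVec (v := 0) (v' := 0) _ _ (fun i => rfl) rfl rfl]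
        exact (isSpElementary_closure (s + 1)).long_mem _ (one_dvd _)
    rw [ih] at h
    exact h (Subgroup.mem_top B)

/-! ### The corner Sp(2, ℤ) in Sp(4, ℤ). -/

theorem spCorner_apply_left {s : ℕ} (A : Matrix (Fin s ⊕ Fin s) (Fin s ⊕ Fin s) ℤ)
    {p : Fin (s + 1) ⊕ Fin (s + 1)} (hp : p = Sum.inl 0 ∨ p = Sum.inr 0)
    (k : Fin (s + 1) ⊕ Fin (s + 1)) : spCorner A p k = (1 : Matrix _ _ ℤ) p k := by
  rcases hp with rfl | rfl <;> rcases k with k | k <;> refine Fin.cases ?_ (fun k => ?_) k <;>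
    simp [spCorner, (Fin.succ_ne_zero _).symm]

theorem spCorner_apply_right {s : ℕ} (A : Matrix (Fin s ⊕ Fin s) (Fin s ⊕ Fin s) ℤ)
    {p : Fin (s + 1) ⊕ Fin (s + 1)} (hp : p = Sum.inl 0 ∨ p = Sum.inr 0)
    (k : Fin (s + 1) ⊕ Fin (s + 1)) : spCorner A k p = (1 : Matrix _ _ ℤ) k p := by
  rcases hp with rfl | rfl <;> rcases k with k | k <;> refine Fin.cases ?_ (fun k => ?_) k <;>
    simp [spCorner, Fin.succ_ne_zero]

theorem spSucc_mem_spPCS {s m : ℕ} {B : symplecticGroup (Fin s) ℤ} (hB : B ∈ spPCS s m) :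
    spSucc s B ∈ spPCS (s + 1) m := by
  rw [mem_spPCS_iff] at hB ⊢
  intro i j
  rw [coe_spSucc]
  by_cases hi : i = Sum.inl 0 ∨ i = Sum.inr 0
  · rw [spCorner_apply_left _ hi, sub_self]; exact dvd_zero _
  by_cases hj : j = Sum.inl 0 ∨ j = Sum.inr 0
  · rw [spCorner_apply_right _ hj, sub_self]; exact dvd_zero _
  have key : ∀ i : Fin (s + 1) ⊕ Fin (s + 1), ¬ (i = Sum.inl 0 ∨ i = Sum.inr 0) →
      ∃ i', i = pairSucc i' := by
    rintro (i | i) hi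
    · obtain ⟨k, rfl⟩ := Fin.exists_succ_eq.mpr (show i ≠ 0 by rintro rfl; exact hi (Or.inl rfl))
      exact ⟨Sum.inl k, rfl⟩
    · obtain ⟨k, rfl⟩ := Fin.exists_succ_eq.mpr (show i ≠ 0 by rintro rfl; exact hi (Or.inr rfl))
      exact ⟨Sum.inr k, rfl⟩
  obtain ⟨i, rfl⟩ := key i hi
  obtain ⟨j, rfl⟩ := key j hj
  simpa [spCorner_pairSucc, Matrix.one_apply, pairSucc_injective.eq_iff] using hB i j

/-- Modulo a normal subgroup that contains the elementary matrices of level `m`, the congruence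
subgroup of `Sp(2s, ℤ)` commutes with the unipotent matrices of the first pair of coordinates. -/
theorem IsSpElementary.commute_mk_spVec {s m : ℕ} {N : Subgroup (symplecticGroup (Fin (s + 1)) ℤ)}
    [N.Normal] (hN : IsSpElementary m N) {B : symplecticGroup (Fin s) ℤ} (hB : B ∈ spPCS s m)
    {p : Fin (s + 1) ⊕ Fin (s + 1)} (hp : p = Sum.inl 0 ∨ p = Sum.inr 0)
    {v : Fin (s + 1) ⊕ Fin (s + 1) → ℤ} (c : ℤ) (h : v p.swap = 0) (hvp : v p = 0) :
    Commute (QuotientGroup.mk' N (spVec p v c h)) (QuotientGroup.mk' N (spSucc s B)) := by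
  set g := spSucc s B with hg
  have hgc : ∀ k, (g⁻¹).1 k p = (1 : Matrix _ _ ℤ) k p := fun k => by
    rw [hg, ← map_inv, coe_spSucc]; exact spCorner_apply_right _ hp k
  have hgc' : ∀ k, (g⁻¹).1 k p.swap = (1 : Matrix _ _ ℤ) k p.swap := fun k => by
    rw [hg, ← map_inv, coe_spSucc]
    exact spCorner_apply_right _ (by rcases hp with rfl | rfl <;> simp) k
  -- Conjugation by `g` replaces `v` by `v'`, which is congruent to `v` modulo `m`; the two matrices
  -- therefore differ by an element of `N`.
  set v' := v ᵥ* (g⁻¹).1 with hv'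
  have h0 : v' p = 0 := by simp [hv', vecMul, dotProduct, hgc, Matrix.one_apply, hvp]
  have h1 : v' p.swap = 0 := by simp [hv', vecMul, dotProduct, hgc', Matrix.one_apply, h]
  have hd : ∀ j, (m : ℤ) ∣ v' j - v j := by
    intro j
    have hgm := mem_spPCS_iff.mp (inv_mem (spSucc_mem_spPCS hB))
    have : v' j - v j = ∑ k, v k * ((g⁻¹).1 k j - (1 : Matrix _ _ ℤ) k j) := by
      simp [hv', vecMul, dotProduct, mul_sub, Finset.sum_sub_distrib, Matrix.one_apply]
    rw [this]
    exact Finset.dvd_sum fun k _ => (hgm k j).mul_left _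
  have hmul : g * spVec p v c h = spVec p v' c h1 * g := by
    refine mul_spVec g c h h1 ?_ fun j => spCorner_apply_left _ hp j
    rw [hv', vecMul_vecMul, ← Submonoid.coe_mul, inv_mul_cancel, Submonoid.coe_one, vecMul_one]
  have hmem : spVec p (v' - v) (-((v' - v) ⬝ᵥ J (Fin (s + 1)) ℤ *ᵥ v)) (by simp [h, h1]) ∈ N :=
    hN.spVec_mem _ (by simp [h0, hvp]) hd
      (dvd_neg.mpr (Finset.dvd_sum fun j _ => (hd j).mul_right _))
  have hv : spVec p v' c h1 = spVec p (v' - v) (-((v' - v) ⬝ᵥ J (Fin (s + 1)) ℤ *ᵥ v))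
      (by simp [h, h1]) * spVec p v c h := by
    rw [spVec_mul]
    exact spVec_congr _ (by simp) (by ring)
  have h2 : QuotientGroup.mk' N (spVec p v' c h1) = QuotientGroup.mk' N (spVec p v c h) := by
    rw [hv, map_mul, show QuotientGroup.mk' N _ = 1 from (QuotientGroup.eq_one_iff _).mpr hmem,
      one_mul]
  have h3 := congrArg (QuotientGroup.mk' N) hmul
  rw [map_mul, map_mul, h2] at h3
  exact h3.symm

section SpFour

variable {m : ℕ} {N : Subgroup (symplecticGroup (Fin 2) ℤ)} [N.Normal]

theorem IsSpElementary.commute_mk_spSucc (hN : IsSpElementary m N)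
    {B : symplecticGroup (Fin 1) ℤ} (hB : B ∈ spPCS 1 m) (y : symplecticGroup (Fin 2) ℤ) :
    Commute (QuotientGroup.mk' N y) (QuotientGroup.mk' N (spSucc 1 B)) := by
  refine commute_mk_of_closure_eq_top (closure_spElementary (s := 2) (by norm_num)) ?_ y
  clear y
  have hone : ∀ p : Fin 2 ⊕ Fin 2, ¬ (p = Sum.inl 0 ∨ p = Sum.inr 0) →
      p = Sum.inl 1 ∨ p = Sum.inr 1 := by decide
  rintro - (⟨p, q, hqs, hpq, rfl⟩ | ⟨p, rfl⟩)
  · by_cases hp : p = Sum.inl 0 ∨ p = Sum.inr 0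
    · exact hN.commute_mk_spVec hB hp _ _ (Pi.single_eq_of_ne hpq _)
    -- In Sp(4, ℤ) a short root has one index in each pair, so after exchanging the indices it is
    -- attached to the first pair.
    · have hq : q = Sum.inl 0 ∨ q = Sum.inr 0 := by
        by_contra hq
        rcases hone p hp with rfl | rfl <;> rcases hone q hq with rfl | rfl <;>
          first | exact hpq rfl | exact hqs rfl
      have hps : p ≠ q.swap := by rintro rfl; exact hqs (Sum.swap_swap q).symm
      rw [spVec_single_comm _ _ (single_swap_eq_zero hps 1)]
      exact hN.commute_mk_spVec hB hq _ _ (Pi.single_eq_of_ne (Ne.symm hpq) _)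
  · by_cases hp : p = Sum.inl 0 ∨ p = Sum.inr 0
    · exact hN.commute_mk_spVec hB hp _ _ rfl
    -- A long root element of the second pair is expressed through elements attached to the first
    -- pair, by conjugating a long root element with a short one.
    have key : ∀ p : Fin 2 ⊕ Fin 2, ¬ (p = Sum.inl 0 ∨ p = Sum.inr 0) → ∀ h1 h2, spVec (Sum.inr 0) (-Pi.single p 1) 1 h1 *
        spVec p 0 1 rfl * spVec (Sum.inl 0) (Pi.single p 1) 0 h2 =
        spVec (Sum.inl 0) (Pi.single p 1) 0 h2 * spVec (Sum.inr 0) 0 1 rfl := by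
      intro p hp h1 h2
      refine Subtype.ext ?_
      rw [Submonoid.coe_mul, Submonoid.coe_mul, Submonoid.coe_mul, coe_spVec, coe_spVec, coe_spVec,
        coe_spVec]
      clear h1 h2
      revert p
      decide
    have hp0 : p ≠ Sum.inl 0 ∧ p ≠ Sum.inr 0 := by tauto
    have h1 : (-Pi.single p 1 : Fin 2 ⊕ Fin 2 → ℤ) (Sum.inr 0).swap = 0 := by
      simp [hp0.1.symm]
    have h2 : (Pi.single p 1 : Fin 2 ⊕ Fin 2 → ℤ) (Sum.inl 0).swap = 0 := by
      simp [hp0.2.symm]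
    have hx := hN.commute_mk_spVec hB (Or.inr rfl) 1 h1
      (by simp [hp0.2.symm])
    have hy := hN.commute_mk_spVec hB (Or.inl rfl) 0 h2
      (by simp [hp0.1.symm])
    have hz := hN.commute_mk_spVec hB (Or.inr rfl) 1 (v := 0) rfl rfl
    have h3 : spVec p 0 1 rfl = (spVec (Sum.inr 0) (-Pi.single p 1) 1 h1)⁻¹ *
        (spVec (Sum.inl 0) (Pi.single p 1) 0 h2 * spVec (Sum.inr 0) 0 1 rfl *
          (spVec (Sum.inl 0) (Pi.single p 1) 0 h2)⁻¹) := by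
      rw [← key p hp h1 h2]; group
    rw [h3, map_mul, map_mul, map_mul, map_inv, map_inv]
    exact hx.inv_left.mul_left ((hy.mul_left hz).mul_left hy.inv_left)

end SpFour

theorem coe_spSucc_slTwoToSp (A : SpecialLinearGroup (Fin 2) ℤ) :
    (spSucc 1 (slTwoToSp A)).1 =
      fromBlocks !![1, 0; 0, A 0 0] !![0, 0; 0, A 0 1] !![0, 0; 0, A 1 0] !![1, 0; 0, A 1 1] := by
  rw [coe_spSucc]
  ext p q
  by_cases hp : p = Sum.inl 0 ∨ p = Sum.inr 0
  · rw [spCorner_apply_left _ hp]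
    rcases hp with rfl | rfl <;> rcases q with j | j <;> fin_cases j <;> simp [Matrix.one_apply]
  by_cases hq : q = Sum.inl 0 ∨ q = Sum.inr 0
  · rw [spCorner_apply_right _ hq]
    rcases hq with rfl | rfl <;> rcases p with j | j <;> fin_cases j <;> simp [Matrix.one_apply]
  have key : ∀ p : Fin 2 ⊕ Fin 2, ¬ (p = Sum.inl 0 ∨ p = Sum.inr 0) →
      p = pairSucc (Sum.inl 0) ∨ p = pairSucc (Sum.inr 0) := by decide
  rcases key p hp with rfl | rfl <;> rcases key q hq with rfl | rfl <;>
    rw [spCorner_pairSucc] <;> simp [coe_slTwoToSp, pairSucc]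

theorem coe_spVec_inr_one (t c : ℤ) :
    (spVec (Sum.inr 1) (Pi.single (Sum.inr 0) t) c (single_swap_eq_zero (by simp) t) :
      symplecticGroup (Fin 2) ℤ).1 = fromBlocks 1 !![0, -t; -t, -c] 0 1 := by
  rw [coe_spVec, J, ← fromBlocks_one]
  ext (i | i) (j | j) <;> fin_cases i <;> fin_cases j <;>
    simp [Matrix.mul_apply, spSymm_apply, Fin.sum_univ_two]

theorem coe_spVec_inl_one (t c : ℤ) :
    (spVec (Sum.inl 1) (Pi.single (Sum.inl 0) t) c (single_swap_eq_zero (by simp) t) :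
      symplecticGroup (Fin 2) ℤ).1 = fromBlocks 1 0 !![0, t; t, c] 1 := by
  rw [coe_spVec, J, ← fromBlocks_one]
  ext (i | i) (j | j) <;> fin_cases i <;> fin_cases j <;>
    simp [Matrix.mul_apply, spSymm_apply, Fin.sum_univ_two]

theorem coe_spVec_inr_one_inl_zero (t : ℤ) :
    (spVec (Sum.inr 1) (Pi.single (Sum.inl 0) t) 0 (single_swap_eq_zero (by simp) t) :
      symplecticGroup (Fin 2) ℤ).1 = fromBlocks !![1, 0; -t, 1] 0 0 !![1, t; 0, 1] := by
  rw [coe_spVec, J, ← fromBlocks_one]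
  ext (i | i) (j | j) <;> fin_cases i <;> fin_cases j <;>
    simp [Matrix.mul_apply, spSymm_apply, Fin.sum_univ_two]

theorem coe_spVec_inr_zero_inl_one (t : ℤ) :
    (spVec (Sum.inr 0) (Pi.single (Sum.inl 1) t) 0 (single_swap_eq_zero (by simp) t) :
      symplecticGroup (Fin 2) ℤ).1 = fromBlocks !![1, -t; 0, 1] 0 0 !![1, 0; t, 1] := by
  rw [coe_spVec, J, ← fromBlocks_one]
  ext (i | i) (j | j) <;> fin_cases i <;> fin_cases j <;>
    simp [Matrix.mul_apply, spSymm_apply, Fin.sum_univ_two]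

theorem fromBlocks_mem_symplecticGroup {l : Type*} [DecidableEq l] [Fintype l] {P Q : Matrix l l ℤ}
    (h : P * Qᵀ = 1) : fromBlocks P 0 0 Q ∈ symplecticGroup l ℤ := by
  have h' : Q * Pᵀ = 1 := by rw [← transpose_inj, transpose_mul, transpose_transpose, h, transpose_one]
  rw [SymplecticGroup.mem_iff, J, fromBlocks_transpose, fromBlocks_multiply, fromBlocks_multiply]
  simp [h, h']

/-- The matrix identity behind the multiplicativity of the symplectic symbol in squares. -/
theorem sp_square_identity {a b c d β γ δ : ℤ} (hA : a * d - b * c = 1) (hD : a * δ - β * γ = 1) :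
    fromBlocks 1 0 !![0, γ * c * δ; γ * c * δ, -(a * c * δ ^ 2)] 1 *
      fromBlocks !![1, β; 0, 1] 0 0 !![1, 0; -β, 1] *
      fromBlocks !![1, 0; γ, 1] 0 0 !![1, -γ; 0, 1] *
      fromBlocks !![1, 0; 0, a] !![0, 0; 0, b] !![0, 0; 0, c] !![1, 0; 0, d] *
      fromBlocks !![a, -β; -γ, δ] 0 0 !![δ, γ; β, a] *
      fromBlocks 1 !![0, -(b * β); -(b * β), -(b * a)] 0 1 *
      fromBlocks !![0, 1; 1, 0] 0 0 !![0, 1; 1, 0] =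
    fromBlocks !![0, 1; 1, 0] 0 0 !![0, 1; 1, 0] *
      fromBlocks !![1, 0; 0, a] !![0, 0; 0, b * β ^ 2] !![0, 0; 0, c * γ ^ 2]
        !![1, 0; 0, δ - γ * β * d + b * c * β * γ * δ] := by
  simp only [fromBlocks_multiply, fromBlocks_inj]
  refine ⟨?_, ?_, ?_, ?_⟩ <;> ext i j <;> fin_cases i <;> fin_cases j <;>
    simp
  all_goals grind

section SpFour

variable {m : ℕ} {N : Subgroup (symplecticGroup (Fin 2) ℤ)} [N.Normal]

/-- The congruence subgroup of `SL(2, ℤ)`, embedded in `Sp(4, ℤ)` at the second pair of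
coordinates, is contained in every normal subgroup that contains the elementary matrices of the
same level. -/
theorem IsSpElementary.spSucc_slTwoToSp_mem (hm : 0 < m) (hN : IsSpElementary m N)
    {A : SpecialLinearGroup (Fin 2) ℤ} (hA : A ∈ slPCS 2 m) : spSucc 1 (slTwoToSp A) ∈ N := by
  have hmem : ∀ x : symplecticGroup (Fin 2) ℤ, QuotientGroup.mk' N x = 1 ↔ x ∈ N :=
    fun x => QuotientGroup.eq_one_iff x
  have hlong : ∀ (p : Fin 1 ⊕ Fin 1) (t : ℤ), (m : ℤ) ∣ t → spSucc 1 (spVec p 0 t rfl) ∈ N := by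
    intro p t ht
    rw [spSucc_spVec (v := 0) (v' := 0) _ _ (fun i => rfl) rfl rfl]
    exact hN.long_mem _ ht
  have hsp : ∀ A ∈ slPCS 2 m, slTwoToSp A ∈ spPCS 1 m := by
    intro A hA
    rw [mem_slPCS_two_iff] at hA
    rw [mem_spPCS_iff]
    rintro (i | i) (j | j) <;> fin_cases i <;> fin_cases j <;> simp [coe_slTwoToSp, hA]
  set f := ((QuotientGroup.mk' N).comp (spSucc 1)).comp slTwoToSp with hf
  have hL : ∀ t, (m : ℤ) ∣ t → f (lowerUnip t) = 1 := by
    intro t ht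
    rw [hf, MonoidHom.comp_apply, MonoidHom.comp_apply, hmem, spVec_inl_zero_slTwoToSp]
    exact hlong _ _ ht
  have hU : ∀ t, (m : ℤ) ∣ t → f (upperUnip t) = 1 := by
    intro t ht
    rw [hf, MonoidHom.comp_apply, MonoidHom.comp_apply, hmem, spVec_inr_zero_slTwoToSp]
    exact hlong _ _ (dvd_neg.mpr ht)
  rw [← hmem]
  refine eq_one_of_mem_slPCS_two (f := f) hm hL hU ?_ ?_ hA
  · intro A hA t
    rw [map_mul, map_mul, map_inv]
    have := hN.commute_mk_spSucc (hsp A hA) (spSucc 1 (slTwoToSp (lowerUnip t)))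
    simp only [hf, MonoidHom.comp_apply]
    rw [this.eq, mul_inv_cancel_right]
  · intro a β ha hβ haβ
    obtain ⟨D, hD, hD0, hD1⟩ := exists_mem_slPCS_two_row haβ ha hβ
    have hDdet : a * D 1 1 - β * D 1 0 = 1 := by rw [← hD0, ← hD1, ← det_fin_two]; exact D.2
    -- The factor for the square law, a block diagonal matrix built from `D`, independent of `A`. In
    -- contrast to SL(3, ℤ), multiplicativity is derived for squares only.
    let Y : symplecticGroup (Fin 2) ℤ := ⟨fromBlocks !![a, -β; -D 1 0, D 1 1] 0 0
      !![D 1 1, D 1 0; β, a], fromBlocks_mem_symplecticGroup (by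
        ext i j
        fin_cases i <;> fin_cases j <;> simp [vecMul, dotProduct] <;>
          first | ring1 | linear_combination hDdet)⟩
    refine ⟨QuotientGroup.mk' N Y, fun A hA B hB hA0 hB0 hAB => ?_⟩
    have hAdet : a * A 1 1 - A 0 1 * A 1 0 = 1 := by rw [← hA0, ← det_fin_two]; exact A.2
    obtain ⟨hD1', hD2', hD3', hD4'⟩ := mem_slPCS_two_iff.mp hD
    obtain ⟨hA1', hA2', hA3', hA4'⟩ := mem_slPCS_two_iff.mp hA
    let Z : SpecialLinearGroup (Fin 2) ℤ :=
      ⟨!![a, A 0 1 * β ^ 2; A 1 0 * D 1 0 ^ 2,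
        D 1 1 - D 1 0 * β * A 1 1 + A 0 1 * A 1 0 * β * D 1 0 * D 1 1], by
        rw [det_fin_two_of]
        linear_combination (1 + A 0 1 * A 1 0 * β * D 1 0) * hDdet - β * D 1 0 * hAdet⟩
    have hZ : (Z : Matrix (Fin 2) (Fin 2) ℤ) = !![a, A 0 1 * β ^ 2; A 1 0 * D 1 0 ^ 2,
      D 1 1 - D 1 0 * β * A 1 1 + A 0 1 * A 1 0 * β * D 1 0 * D 1 1] := rfl
    have hZm : Z ∈ slPCS 2 m := by
      rw [mem_slPCS_two_iff]
      simp only [hZ, of_apply, cons_val', cons_val_zero, cons_val_one, cons_val_fin_one]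
      refine ⟨ha, hA2'.mul_right _, hA3'.mul_right _, ?_⟩
      rw [show D 1 1 - D 1 0 * β * A 1 1 + A 0 1 * A 1 0 * β * D 1 0 * D 1 1 - 1 =
        (D 1 1 - 1) + D 1 0 * (-β * A 1 1 + A 0 1 * A 1 0 * β * D 1 1) by ring]
      exact dvd_add hD4' (hD3'.mul_right _)
    rw [map_eq_of_row_eq _ hL hB hZm (hB0.trans rfl) (hAB.trans rfl)]
    let W : symplecticGroup (Fin 2) ℤ := ⟨fromBlocks !![0, 1; 1, 0] 0 0 !![0, 1; 1, 0],
      fromBlocks_mem_symplecticGroup (by decide)⟩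
    have hsingle : ∀ {q : Fin 2 ⊕ Fin 2} {t : ℤ}, (m : ℤ) ∣ t →
        ∀ j, (m : ℤ) ∣ (Pi.single q t : Fin 2 ⊕ Fin 2 → ℤ) j := by
      intro q t ht j
      rw [Pi.single_apply]
      split_ifs
      exacts [ht, dvd_zero _]
    let E₁ : symplecticGroup (Fin 2) ℤ := spVec (Sum.inl 1) (Pi.single (Sum.inl 0)
      (D 1 0 * A 1 0 * D 1 1)) (-(a * A 1 0 * D 1 1 ^ 2)) (single_swap_eq_zero (by simp) _)
    let E₂ : symplecticGroup (Fin 2) ℤ :=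
      spVec (Sum.inr 0) (Pi.single (Sum.inl 1) (-β)) 0 (single_swap_eq_zero (by simp) _)
    let E₃ : symplecticGroup (Fin 2) ℤ :=
      spVec (Sum.inr 1) (Pi.single (Sum.inl 0) (-D 1 0)) 0 (single_swap_eq_zero (by simp) _)
    let E₄ : symplecticGroup (Fin 2) ℤ := spVec (Sum.inr 1) (Pi.single (Sum.inr 0) (A 0 1 * β))
      (A 0 1 * a) (single_swap_eq_zero (by simp) _)
    have hE₁ : QuotientGroup.mk' N E₁ = 1 := (hmem _).mpr (hN.spVec_mem _ (by simp)
      (hsingle ((hD3'.mul_right _).mul_right _)) (dvd_neg.mpr ((hA3'.mul_left _).mul_right _)))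
    have hE₂ : QuotientGroup.mk' N E₂ = 1 :=
      (hmem _).mpr (hN.spVec_mem _ (by simp) (hsingle (dvd_neg.mpr hβ)) (dvd_zero _))
    have hE₃ : QuotientGroup.mk' N E₃ = 1 :=
      (hmem _).mpr (hN.spVec_mem _ (by simp) (hsingle (dvd_neg.mpr hD3')) (dvd_zero _))
    have hE₄ : QuotientGroup.mk' N E₄ = 1 :=
      (hmem _).mpr (hN.spVec_mem _ (by simp) (hsingle (hA2'.mul_right _)) (hA2'.mul_right _))
    have key : ∀ F G : symplecticGroup (Fin 2) ℤ, F = spSucc 1 (slTwoToSp A) →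
        G = spSucc 1 (slTwoToSp Z) → E₁ * E₂ * E₃ * F * Y * E₄ * W = W * G := by
      intro F G hF hG
      have hFc := (congrArg Subtype.val hF).trans (coe_spSucc_slTwoToSp A)
      have hGc := (congrArg Subtype.val hG).trans (coe_spSucc_slTwoToSp Z)
      rw [hA0] at hFc
      have h1 : E₁.1 = _ := coe_spVec_inl_one _ _
      have h2 : E₂.1 = _ := coe_spVec_inr_zero_inl_one _
      have h3 : E₃.1 = _ := coe_spVec_inr_one_inl_zero _
      have h4 : E₄.1 = _ := coe_spVec_inr_one _ _
      rw [neg_neg] at h2 h3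
      refine Subtype.ext ?_
      rw [Submonoid.coe_mul, Submonoid.coe_mul, Submonoid.coe_mul, Submonoid.coe_mul,
        Submonoid.coe_mul, Submonoid.coe_mul, Submonoid.coe_mul, h1, h2, h3, h4, hFc, hGc]
      exact sp_square_identity hAdet hDdet
    -- Modulo `N` the four elementary factors vanish, and `W`, which exchanges the two pairs,
    -- commutes with the image of `Z` and cancels.
    have h1 := congrArg (QuotientGroup.mk' N) (key _ _ rfl rfl)
    rw [map_mul, map_mul, map_mul, map_mul, map_mul, map_mul, map_mul, hE₁, hE₂, hE₃, hE₄,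
      (hN.commute_mk_spSucc (hsp Z hZm) W).eq, one_mul, one_mul, one_mul, mul_one] at h1
    exact (mul_right_cancel h1).symm

end SpFour

/-! ### The congruence subgroup theorem for Sp(2s, ℤ), and the factorial of the index as a level. -/

/-- The congruence subgroup theorem for `Sp(2s, ℤ)`, `s ≥ 2`: a normal subgroup that contains the
elementary matrices of level `m` contains the principal congruence subgroup of level `m`. -/
theorem IsSpElementary.spPCS_le {s m : ℕ} (hs : 2 ≤ s) (hm : 0 < m)
    {N : Subgroup (symplecticGroup (Fin s) ℤ)} (hNn : N.Normal) (hN : IsSpElementary m N) :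
    spPCS s m ≤ N := by
  induction s, hs using Nat.le_induction with
  | base =>
    refine hN.spPCS_succ_le hm le_rfl fun B hB => ?_
    obtain ⟨A, rfl, h0, h1, h2, h3⟩ := exists_slTwoToSp_eq B
    refine hN.spSucc_slTwoToSp_mem hm ?_
    rw [mem_slPCS_two_iff, h0, h1, h2, h3]
    have hB' := mem_spPCS_iff.mp hB
    have h4 := hB' (Sum.inl 0) (Sum.inl 0)
    have h5 := hB' (Sum.inl 0) (Sum.inr 0)
    have h6 := hB' (Sum.inr 0) (Sum.inl 0)
    have h7 := hB' (Sum.inr 0) (Sum.inr 0)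
    simp only [Matrix.one_apply_eq] at h4 h7
    rw [Matrix.one_apply_ne (by simp), sub_zero] at h5 h6
    exact ⟨h4, h5, h6, h7⟩
  | succ s hs ih =>
    refine hN.spPCS_succ_le hm (by omega) ?_
    refine ih (N := N.comap (spSucc s)) inferInstance ⟨?_, ?_, ?_⟩
    · intro p q hpq hqs t ht
      rw [Subgroup.mem_comap, spSucc_spVec (v' := Pi.single (pairSucc q) t) _ _
          (fun i => by simp [Pi.single_apply, pairSucc_injective.eq_iff])
          (by rcases q with q | q <;> simp [pairSucc, (Fin.succ_ne_zero _).symm])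
          (by rcases q with q | q <;> simp [pairSucc, (Fin.succ_ne_zero _).symm])]
      exact hN.short_mem (pairSucc_injective.ne hpq)
          (by rw [swap_pairSucc]; exact pairSucc_injective.ne hqs) ht
    · intro p t ht
      rw [Subgroup.mem_comap, spSucc_spVec (v := 0) (v' := 0) _ _ (fun i => rfl) rfl rfl]
      exact hN.long_mem _ ht
    · intro p t A hA
      exact Subgroup.Normal.conj_mem inferInstance A hA _

/-- Each conjugate of `x` has a positive power with exponent at most the index in `H`. The exponent
depends on the conjugate, and the factorial is a common multiple. -/
theorem pow_factorial_index_mem_normalCore {G : Type*} [Group G] (H : Subgroup G)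
    (hH : H.FiniteIndex) (x : G) : x ^ (H.index)! ∈ H.normalCore := by
  intro g
  rw [← conj_pow]
  exact H.pow_mem_of_index_ne_zero_of_dvd hH.index_ne_zero _ fun m hm hle => Nat.dvd_factorial hm hle

theorem slPCS_factorial_index_le {n : ℕ} (hn : 2 < n)
    (H : Subgroup (SpecialLinearGroup (Fin n) ℤ)) (hH : H.FiniteIndex) :
    slPCS n (H.index)! ≤ H := by
  refine le_trans ?_ H.normalCore_le
  refine slPCS_le_of_transvection_mem hn (Nat.factorial_pos _) _ inferInstance fun i j h t ht =>
    transvection_mem_of_dvd h ?_ ht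
  have := pow_factorial_index_mem_normalCore H hH (SpecialLinearGroup.transvection h 1)
  rwa [transvection_pow, mul_one] at this

theorem spPCS_factorial_index_le {s : ℕ} (hs : 2 < 2 * s)
    (H : Subgroup (symplecticGroup (Fin s) ℤ)) (hH : H.FiniteIndex) :
    spPCS s (H.index)! ≤ H := by
  refine le_trans ?_ H.normalCore_le
  refine IsSpElementary.spPCS_le (by omega) (Nat.factorial_pos _) inferInstance ⟨?_, ?_, ?_⟩
  · intro p q _ hqs t ht
    refine spVec_single_mem_of_dvd hqs ?_ ht
    have := pow_factorial_index_mem_normalCore H hH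
      (spVec p (Pi.single q 1) 0 (single_swap_eq_zero hqs 1))
    rwa [spVec_pow, spVec_congr (v' := Pi.single q (((H.index)! : ℕ) : ℤ)) (c' := 0) _
      (by rw [← Pi.single_smul, smul_eq_mul, mul_one]) (mul_zero _)] at this
  · intro p t ht
    refine spVec_mem_of_dvd ?_ ht
    have := pow_factorial_index_mem_normalCore H hH (spVec p 0 1 rfl)
    rwa [spVec_pow, spVec_congr (v' := 0) (c' := (((H.index)! : ℕ) : ℤ)) _
      (smul_zero _) (mul_one _)] at this
  · intro p t A hA
    exact H.normalCore_normal.conj_mem A hA _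

theorem slPCS_le_of_dvd {n k m : ℕ} (h : k ∣ m) : slPCS n m ≤ slPCS n k := fun A hA => by
  rw [mem_slPCS_iff] at hA ⊢
  exact fun i j => (Int.natCast_dvd_natCast.mpr h).trans (hA i j)

theorem spPCS_le_of_dvd {s k m : ℕ} (h : k ∣ m) : spPCS s m ≤ spPCS s k := fun A hA => by
  rw [mem_spPCS_iff] at hA ⊢
  exact fun i j => (Int.natCast_dvd_natCast.mpr h).trans (hA i j)

/-! ### Primitive recursive arithmetic of integers and integer matrices. -/

section PrimrecInt

/-- The code of an integer is even for nonnegative and odd for negative integers, so sign and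
absolute value can be read off by division by two. -/
theorem encode_int_ofNat (n : ℕ) : Encodable.encode (Int.ofNat n) = 2 * n := rfl

theorem encode_int_negSucc (n : ℕ) : Encodable.encode (Int.negSucc n) = 2 * n + 1 := rfl

theorem primrec_int_toNat : Primrec Int.toNat := by
  refine (Primrec.ite (c := fun z : ℤ => Encodable.encode z % 2 = 0)
    (Primrec.eq.comp (Primrec.nat_mod.comp Primrec.encode (Primrec.const 2)) (Primrec.const 0))
    (Primrec.nat_div.comp Primrec.encode (Primrec.const 2)) (Primrec.const 0)).of_eq fun z => ?_
  rcases z with n | n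
  · rw [encode_int_ofNat, if_pos (by omega)]
    change _ = n
    omega
  · rw [encode_int_negSucc, if_neg (by omega)]
    rfl

theorem primrec_int_neg_toNat : Primrec fun z : ℤ => (-z).toNat := by
  refine (Primrec.ite (c := fun z : ℤ => Encodable.encode z % 2 = 0)
    (Primrec.eq.comp (Primrec.nat_mod.comp Primrec.encode (Primrec.const 2)) (Primrec.const 0))
    (Primrec.const 0) (Primrec.succ.comp
      (Primrec.nat_div.comp Primrec.encode (Primrec.const 2)))).of_eq fun z => ?_
  rcases z with n | n
  · rw [encode_int_ofNat, if_pos (by omega)]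
    change _ = (-(n : ℤ)).toNat
    omega
  · rw [encode_int_negSucc, if_neg (by omega)]
    change _ = n + 1
    rw [Nat.succ_eq_add_one]
    omega

theorem primrec_natCast_sub_natCast : Primrec₂ fun a b : ℕ => (a : ℤ) - b := by
  rw [← Primrec₂.encode_iff]
  refine (Primrec.ite (c := fun p : ℕ × ℕ => p.2 ≤ p.1) (Primrec.nat_le.comp Primrec.snd Primrec.fst)
    (Primrec.nat_mul.comp (Primrec.const 2) Primrec.nat_sub)
    (Primrec.succ.comp (Primrec.nat_mul.comp (Primrec.const 2) (Primrec.pred.comp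
      (Primrec.nat_sub.comp Primrec.snd Primrec.fst))))).of_eq fun p => ?_
  obtain ⟨a, b⟩ := p
  dsimp only
  split_ifs with h
  · rw [show (a : ℤ) - b = Int.ofNat (a - b) from (Int.ofNat_sub h).symm, encode_int_ofNat]
  · rw [show (a : ℤ) - b = Int.negSucc (b - a - 1) by rw [Int.negSucc_eq]; omega,
      encode_int_negSucc]
    rfl

/-- An integer is the difference of the natural numbers `z.toNat` and `(-z).toNat`, which reduces
the arithmetic to that of ℕ. -/
theorem primrec_int_add : Primrec₂ ((· + ·) : ℤ → ℤ → ℤ) := by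
  refine (primrec_natCast_sub_natCast.comp
    (Primrec.nat_add.comp (primrec_int_toNat.comp Primrec.fst) (primrec_int_toNat.comp Primrec.snd))
    (Primrec.nat_add.comp (primrec_int_neg_toNat.comp Primrec.fst)
      (primrec_int_neg_toNat.comp Primrec.snd))).of_eq fun p => ?_
  push_cast
  rw [add_sub_add_comm, Int.toNat_sub_toNat_neg, Int.toNat_sub_toNat_neg]

theorem primrec_int_mul : Primrec₂ ((· * ·) : ℤ → ℤ → ℤ) := by
  have hx := primrec_int_toNat.comp (Primrec.fst (α := ℤ) (β := ℤ))
  have hy := primrec_int_toNat.comp (Primrec.snd (α := ℤ) (β := ℤ))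
  have hx' := primrec_int_neg_toNat.comp (Primrec.fst (α := ℤ) (β := ℤ))
  have hy' := primrec_int_neg_toNat.comp (Primrec.snd (α := ℤ) (β := ℤ))
  refine (primrec_natCast_sub_natCast.comp
    (Primrec.nat_add.comp (Primrec.nat_mul.comp hx hy) (Primrec.nat_mul.comp hx' hy'))
    (Primrec.nat_add.comp (Primrec.nat_mul.comp hx hy') (Primrec.nat_mul.comp hx' hy))).of_eq
      fun p => ?_
  conv_rhs => rw [← Int.toNat_sub_toNat_neg p.1, ← Int.toNat_sub_toNat_neg p.2]
  push_cast
  ring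

end PrimrecInt

theorem primrec_factorial : Primrec Nat.factorial :=
  (Primrec.nat_rec₁ (f := fun n k => (n + 1) * k) 1
    (Primrec.nat_mul.comp (Primrec.succ.comp Primrec.fst) Primrec.snd).to₂).of_eq
    fun n => by induction n with
      | zero => rfl
      | succ n ih => rw [Nat.factorial_succ, ← ih]

/-- The list of rows of the `n × n` matrix with the entries `e (i, j)`. -/
def rowsOf (n : ℕ) (e : ℕ × ℕ → ℤ) : List (List ℤ) :=
  (List.range n).map fun i => (List.range n).map fun j => e (i, j)

/-- The entries of a matrix that is given by its rows. -/
def rowsEntry (A : List (List ℤ)) (i j : ℕ) : ℤ := (A.getD i []).getD j 0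

/-- The product of two matrices that are given by their rows. -/
def mulRows (n : ℕ) (A B : List (List ℤ)) : List (List ℤ) :=
  rowsOf n fun p => ((List.range n).map fun k => rowsEntry A p.1 k * rowsEntry B k p.2).sum

/-- The rows of the identity matrix. -/
def oneRows (n : ℕ) : List (List ℤ) := rowsOf n fun p => if p.1 = p.2 then 1 else 0

/-- The rows of the product of a list of matrices. -/
def prodRows (n : ℕ) (w : List (List (List ℤ))) : List (List ℤ) :=
  w.foldr (mulRows n) (oneRows n)

/-- The matrix with the given rows. -/
def ofRows (n : ℕ) (A : List (List ℤ)) : Matrix (Fin n) (Fin n) ℤ :=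
  Matrix.of fun i j => rowsEntry A i j

section Rows

variable {n : ℕ}

theorem ofRows_matrixRows (A : Matrix (Fin n) (Fin n) ℤ) : ofRows n (matrixRows A) = A := by
  ext i j
  simp [ofRows, rowsEntry, matrixRows]

theorem ofRows_rowsOf (e : ℕ × ℕ → ℤ) :
    ofRows n (rowsOf n e) = Matrix.of fun i j : Fin n => e (i, j) := by
  ext i j
  simp [ofRows, rowsEntry, rowsOf]

theorem rowsOf_inj {e e' : ℕ × ℕ → ℤ} :
    rowsOf n e = rowsOf n e' ↔ ofRows n (rowsOf n e) = ofRows n (rowsOf n e') := by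
  refine ⟨fun h => by rw [h], fun h => ?_⟩
  rw [ofRows_rowsOf, ofRows_rowsOf] at h
  refine List.map_congr_left fun i hi => List.map_congr_left fun j hj => ?_
  exact congrFun (congrFun h ⟨i, List.mem_range.mp hi⟩) ⟨j, List.mem_range.mp hj⟩

theorem ofRows_mulRows (A B : List (List ℤ)) :
    ofRows n (mulRows n A B) = ofRows n A * ofRows n B := by
  rw [mulRows, ofRows_rowsOf]
  ext i j
  rw [Matrix.mul_apply]
  exact Finset.sum_range fun k => rowsEntry A i k * rowsEntry B k j

theorem ofRows_oneRows : ofRows n (oneRows n) = 1 := by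
  rw [oneRows, ofRows_rowsOf]
  ext i j
  simp [Matrix.one_apply, Fin.ext_iff]

/-- A list of rows need not be determined by its matrix, since `rowsEntry` ignores surplus entries
and fills in zeros. Products are always in the normal form `rowsOf`, so for them equality of lists
is equality of matrices. -/
theorem mulRows_eq_mulRows_iff {A B C D : List (List ℤ)} : mulRows n A B = mulRows n C D ↔
    ofRows n A * ofRows n B = ofRows n C * ofRows n D := by
  rw [← ofRows_mulRows, ← ofRows_mulRows]
  exact rowsOf_inj

theorem mulRows_eq_oneRows_iff {A B : List (List ℤ)} : mulRows n A B = oneRows n ↔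
    ofRows n A * ofRows n B = 1 := by
  rw [← ofRows_mulRows, ← ofRows_oneRows]
  exact rowsOf_inj

end Rows

section PrimrecRows

variable {α : Type*} [Primcodable α]

theorem primrec_rowsOf {n : α → ℕ} {e : α → ℕ × ℕ → ℤ} (hn : Primrec n) (he : Primrec₂ e) :
    Primrec fun a => rowsOf (n a) (e a) := by
  refine Primrec.list_map (Primrec.list_range.comp hn) ?_
  refine Primrec.list_map (Primrec.list_range.comp (hn.comp Primrec.fst)) ?_
  exact he.comp (Primrec.fst.comp Primrec.fst)
    (Primrec.pair (Primrec.snd.comp Primrec.fst) Primrec.snd)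

theorem primrec_rowsEntry {A : α → List (List ℤ)} {i j : α → ℕ} (hA : Primrec A) (hi : Primrec i)
    (hj : Primrec j) : Primrec fun a => rowsEntry (A a) (i a) (j a) :=
  (Primrec.list_getD 0).comp ((Primrec.list_getD []).comp hA hi) hj

theorem primrec_list_int_sum {l : α → List ℤ} (hl : Primrec l) : Primrec fun a => (l a).sum :=
  Primrec.list_foldr (h := fun _ p => p.1 + p.2) hl (Primrec.const 0)
    (primrec_int_add.comp (Primrec.fst.comp Primrec.snd) (Primrec.snd.comp Primrec.snd)).to₂

theorem primrec_mulRows {n : α → ℕ} {A B : α → List (List ℤ)} (hn : Primrec n) (hA : Primrec A)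
    (hB : Primrec B) : Primrec fun a => mulRows (n a) (A a) (B a) := by
  refine primrec_rowsOf hn (primrec_list_int_sum
    (Primrec.list_map (Primrec.list_range.comp (hn.comp Primrec.fst)) ?_))
  have h1 : Primrec fun q : (α × (ℕ × ℕ)) × ℕ => q.1.1 := Primrec.fst.comp Primrec.fst
  have h2 : Primrec fun q : (α × (ℕ × ℕ)) × ℕ => q.1.2 := Primrec.snd.comp Primrec.fst
  exact primrec_int_mul.comp (primrec_rowsEntry (hA.comp h1) (Primrec.fst.comp h2) Primrec.snd)
    (primrec_rowsEntry (hB.comp h1) Primrec.snd (Primrec.snd.comp h2))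

theorem primrec_oneRows {n : α → ℕ} (hn : Primrec n) : Primrec fun a => oneRows (n a) :=
  primrec_rowsOf hn (Primrec.ite (Primrec.eq.comp (Primrec.fst.comp Primrec.snd)
    (Primrec.snd.comp Primrec.snd)) (Primrec.const 1) (Primrec.const 0))

theorem primrec_prodRows {n : α → ℕ} {w : α → List (List (List ℤ))} (hn : Primrec n)
    (hw : Primrec w) : Primrec fun a => prodRows (n a) (w a) :=
  Primrec.list_foldr (h := fun a p => mulRows (n a) p.1 p.2) hw (primrec_oneRows hn)
    (primrec_mulRows (hn.comp Primrec.fst) (Primrec.fst.comp Primrec.snd)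
      (Primrec.snd.comp Primrec.snd)).to₂

theorem PrimrecPred.exists_mem_list_of {β : Type*} [Primcodable β] {l : α → List β}
    {R : α → β → Prop} (hl : Primrec l) (hR : PrimrecPred fun p : α × β => R p.1 p.2) :
    PrimrecPred fun a => ∃ b ∈ l a, R a b :=
  (PrimrecRel.exists_mem_list (R := fun b a => R a b)
    (hR.comp (Primrec.pair Primrec.snd Primrec.fst))).comp hl
    Primrec.id

theorem PrimrecPred.forall_mem_list_of {β : Type*} [Primcodable β] {l : α → List β}
    {R : α → β → Prop} (hl : Primrec l) (hR : PrimrecPred fun p : α × β => R p.1 p.2) :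
    PrimrecPred fun a => ∀ b ∈ l a, R a b :=
  (PrimrecRel.forall_mem_list (R := fun b a => R a b)
    (hR.comp (Primrec.pair Primrec.snd Primrec.fst))).comp hl
    Primrec.id

end PrimrecRows

/-! ### Coset tables and the search for them. -/

/-- The list of the `n × n` matrices with the entries `e (n, i, j, ±1)`. -/
def rowsFamily (e : ℕ × ℕ × ℕ × ℤ → ℕ × ℕ → ℤ) (n : ℕ) : List (List (List ℤ)) :=
  (List.range n).flatMap fun i => (List.range n).flatMap fun j =>
    [1, -1].map fun c => rowsOf n (e (n, i, j, c))

theorem primrec_rowsFamily {e : ℕ × ℕ × ℕ × ℤ → ℕ × ℕ → ℤ} (he : Primrec₂ e) :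
    Primrec (rowsFamily e) := by
  refine Primrec.list_flatMap Primrec.list_range
    (Primrec.list_flatMap (Primrec.list_range.comp Primrec.fst)
      (Primrec.list_map (Primrec.const [1, -1]) ?_))
  have h1 : Primrec fun q : ((ℕ × ℕ) × ℕ) × ℤ => q.1.1 := Primrec.fst.comp Primrec.fst
  have h2 : Primrec fun q : (((ℕ × ℕ) × ℕ) × ℤ) × (ℕ × ℕ) => q.1.1.1 := h1.comp Primrec.fst
  refine primrec_rowsOf (Primrec.fst.comp h1) (he.comp (Primrec.pair (Primrec.fst.comp h2)
    (Primrec.pair (Primrec.snd.comp h2) (Primrec.pair (Primrec.snd.comp (Primrec.fst.comp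
      Primrec.fst)) (Primrec.snd.comp Primrec.fst)))) Primrec.snd)

/-- The condition that `T` contains representatives of all right cosets of the group generated by
the list `L`, as witnessed by the words in `W`; the matrices in `X` generate the ambient group. -/
def IsCosetTable (n : ℕ) (X L T : List (List (List ℤ))) (W : List (List (List (List ℤ)))) : Prop :=
  oneRows n ∈ T ∧ ∀ x ∈ X, ∀ t ∈ T, ∃ w ∈ W,
    -- The inverse of a generator is recognized by a product, so none has to be computed. Members of
    -- `T` may repeat or lie outside the group.
    (∀ y ∈ w, y ∈ L ∨ ∃ s ∈ L, mulRows n y s = oneRows n) ∧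
    ∃ t' ∈ T, mulRows n t x = mulRows n (prodRows n w) t'

/-- All quantifiers run over given lists; this is why the words are part of the certificate. -/
theorem primrecPred_isCosetTable {α : Type*} [Primcodable α] {n : α → ℕ}
    {X L T : α → List (List (List ℤ))} {W : α → List (List (List (List ℤ)))} (hn : Primrec n)
    (hX : Primrec X) (hL : Primrec L) (hT : Primrec T) (hW : Primrec W) :
    PrimrecPred fun a => IsCosetTable (n a) (X a) (L a) (T a) (W a) := by
  have h1 : PrimrecPred fun a => ∃ t ∈ T a, t = oneRows (n a) := by
    refine PrimrecPred.exists_mem_list_of hT ?_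
    exact Primrec.eq.comp Primrec.snd (primrec_oneRows (hn.comp Primrec.fst))
  refine PrimrecPred.and (h1.of_eq fun a => by simp) ?_
  refine PrimrecPred.forall_mem_list_of hX (PrimrecPred.forall_mem_list_of (hT.comp Primrec.fst)
    (PrimrecPred.exists_mem_list_of (hW.comp (Primrec.fst.comp Primrec.fst)) ?_))
  have p1 : Primrec fun q : ((α × List (List ℤ)) × List (List ℤ)) × List (List (List ℤ)) =>
    q.1.1.1 := Primrec.fst.comp (Primrec.fst.comp Primrec.fst)
  refine PrimrecPred.and (PrimrecPred.forall_mem_list_of Primrec.snd (PrimrecPred.or ?_ ?_)) ?_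
  · have h2 : PrimrecPred fun q : (((α × List (List ℤ)) × List (List ℤ)) × List (List (List ℤ))) ×
        List (List ℤ) => ∃ s ∈ L q.1.1.1.1, s = q.2 := by
      refine PrimrecPred.exists_mem_list_of (hL.comp (p1.comp Primrec.fst)) ?_
      exact Primrec.eq.comp Primrec.snd (Primrec.snd.comp Primrec.fst)
    exact h2.of_eq fun q => by simp
  · refine PrimrecPred.exists_mem_list_of (hL.comp (p1.comp Primrec.fst)) ?_
    have hn' := hn.comp (p1.comp (Primrec.fst.comp (Primrec.fst (α := (((α × List (List ℤ)) ×
      List (List ℤ)) × List (List (List ℤ))) × List (List ℤ)) (β := List (List ℤ)))))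
    exact Primrec.eq.comp (primrec_mulRows hn' (Primrec.snd.comp Primrec.fst) Primrec.snd)
      (primrec_oneRows hn')
  · refine PrimrecPred.exists_mem_list_of (hT.comp p1) ?_
    have hn' := hn.comp (p1.comp (Primrec.fst (β := List (List ℤ))))
    exact Primrec.eq.comp (primrec_mulRows hn' (Primrec.snd.comp (Primrec.fst.comp Primrec.fst))
        (Primrec.snd.comp (Primrec.fst.comp (Primrec.fst.comp Primrec.fst))))
      (primrec_mulRows hn' (primrec_prodRows hn' (Primrec.snd.comp Primrec.fst)) Primrec.snd)

theorem ofRows_prodRows_mem_range {n : ℕ} {Γ : Type*} [Group Γ] (ψ : Γ →* Matrix (Fin n) (Fin n) ℤ)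
    {H : Subgroup Γ} {w : List (List (List ℤ))} (hw : ∀ y ∈ w, ∃ h ∈ H, ofRows n y = ψ h) :
    ∃ h ∈ H, ofRows n (prodRows n w) = ψ h := by
  induction w with
  | nil => exact ⟨1, one_mem _, by rw [map_one]; exact ofRows_oneRows⟩
  | cons y w ih =>
    obtain ⟨h, hh, he⟩ := ih fun z hz => hw z (List.mem_cons_of_mem _ hz)
    obtain ⟨k, hk, hke⟩ := hw y List.mem_cons_self
    refine ⟨k * h, mul_mem hk hh, ?_⟩
    rw [map_mul, ← he, ← hke]
    exact ofRows_mulRows _ _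

section CosetTable

variable {n : ℕ} {Γ : Type*} [Group Γ] {ψ : Γ →* Matrix (Fin n) (Fin n) ℤ} {S : List Γ} {Y : Set Γ}
  {X T : List (List (List ℤ))} {W : List (List (List (List ℤ)))}

/-- The union of the cosets `H * t` contains the identity and is stable under right multiplication
by the generators and their inverses, so it is the whole group. As `T` may be redundant, only an
inequality results. -/
theorem IsCosetTable.index_le (hψ : Function.Injective ψ) (hY : Subgroup.closure Y = ⊤)
    (hYX : ∀ y ∈ Y, ∃ x ∈ X, ∃ x' ∈ X, ofRows n x = ψ y ∧ ofRows n x' = ψ y⁻¹)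
    (h : IsCosetTable n X (S.map fun A => matrixRows (ψ A)) T W) :
    (Subgroup.closure {A | A ∈ S}).index ≤ T.length := by
  set H := Subgroup.closure {A | A ∈ S} with hH
  have hword : ∀ x ∈ X, ∀ t ∈ T, ∃ k ∈ H, ∃ t' ∈ T,
      ofRows n t * ofRows n x = ψ k * ofRows n t' := by
    intro x hx t ht
    obtain ⟨w, -, hw, t', ht', he⟩ := h.2 x hx t ht
    obtain ⟨k, hk, hke⟩ := ofRows_prodRows_mem_range (H := H) ψ (w := w) (by
      intro y hy
      rcases hw y hy with hy | ⟨s, hs, hys⟩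
      · obtain ⟨A, hA, rfl⟩ := List.mem_map.mp hy
        exact ⟨A, Subgroup.subset_closure hA, ofRows_matrixRows _⟩
      · obtain ⟨A, hA, rfl⟩ := List.mem_map.mp hs
        refine ⟨A⁻¹, inv_mem (Subgroup.subset_closure hA), ?_⟩
        rw [mulRows_eq_oneRows_iff, ofRows_matrixRows] at hys
        have h1 : ψ A * ψ A⁻¹ = 1 := by rw [← map_mul, mul_inv_cancel, map_one]
        rw [← mul_one (ofRows n y), ← h1, ← mul_assoc, hys, one_mul])
    refine ⟨k, hk, t', ht', ?_⟩
    rw [← hke]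
    exact mulRows_eq_mulRows_iff.mp he
  have hcov : ∀ g, ∃ k ∈ H, ∃ t ∈ T, ψ g = ψ k * ofRows n t := by
    intro g
    have hg : g ∈ Subgroup.closure Y := hY ▸ Subgroup.mem_top g
    have hstep : ∀ g y, (∃ x ∈ X, ofRows n x = ψ y) →
        (∃ k ∈ H, ∃ t ∈ T, ψ g = ψ k * ofRows n t) →
        ∃ k ∈ H, ∃ t ∈ T, ψ (g * y) = ψ k * ofRows n t := by
      rintro g y ⟨x, hx, hxe⟩ ⟨k, hk, t, ht, he⟩
      obtain ⟨k', hk', t', ht', he'⟩ := hword x hx t ht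
      refine ⟨k * k', mul_mem hk hk', t', ht', ?_⟩
      rw [map_mul, map_mul, he, ← hxe, mul_assoc, he', mul_assoc]
    induction hg using Subgroup.closure_induction_right with
    | one => exact ⟨1, one_mem _, _, h.1, by rw [ofRows_oneRows, mul_one]⟩
    | mul_right g _ y hy ih =>
      obtain ⟨x, hx, x', hx', he, he'⟩ := hYX y hy
      exact hstep g y ⟨x, hx, he⟩ ih
    | mul_inv_cancel g _ y hy ih =>
      obtain ⟨x, hx, x', hx', he, he'⟩ := hYX y hy
      exact hstep g y⁻¹ ⟨x', hx', he'⟩ ih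
  -- The table lists right cosets, whereas `Γ ⧸ H` consists of left cosets; hence the inverse of the
  -- representative.
  choose k hk t ht he using fun q : Γ ⧸ H => hcov q.out⁻¹
  have hinj : Function.Injective fun q => (⟨t q, List.mem_toFinset.mpr (ht q)⟩ : T.toFinset) := by
    intro q q' hqq
    have hqq' : t q = t q' := congrArg Subtype.val hqq
    have h1 : ∀ q, ψ ((k q)⁻¹ * q.out⁻¹) = ofRows n (t q) := fun q => by
      rw [map_mul, he, ← mul_assoc, ← map_mul, inv_mul_cancel, map_one, one_mul]
    have h2 : (k q)⁻¹ * q.out⁻¹ = (k q')⁻¹ * q'.out⁻¹ := hψ (by rw [h1, h1, hqq'])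
    rw [← q.out_eq', ← q'.out_eq']
    refine QuotientGroup.eq.mpr ?_
    have h3 : q.out⁻¹ * q'.out = k q * (k q')⁻¹ := by
      have h4 : q.out⁻¹ = k q * ((k q')⁻¹ * q'.out⁻¹) := by rw [← h2]; group
      rw [h4]
      group
    rw [h3]
    exact mul_mem (hk q) (inv_mem (hk q'))
  calc H.index = Nat.card (Γ ⧸ H) := rfl
    _ ≤ Nat.card T.toFinset := Nat.card_le_card_of_injective _ hinj
    _ = T.toFinset.card := by rw [Nat.card_eq_fintype_card, Fintype.card_coe]
    _ ≤ T.length := T.toFinset_card_le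

/-- Representatives of the finitely many cosets form `T`. Each product `t * x` is `k * t'` with `k ∈
H`, and a word for `k` is recorded for each of the finitely many pairs. -/
theorem exists_isCosetTable (hX : ∀ x ∈ X, ∃ g, ofRows n x = ψ g)
    (hfin : (Subgroup.closure {A | A ∈ S}).FiniteIndex) :
    ∃ T W, IsCosetTable n X (S.map fun A => matrixRows (ψ A)) T W := by
  classical
  set H := Subgroup.closure {A | A ∈ S} with hH
  have := Fintype.ofFinite (Γ ⧸ H)
  set T : List (List (List ℤ)) := oneRows n :: (Finset.univ : Finset (Γ ⧸ H)).toList.map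
    fun q => matrixRows (ψ q.out⁻¹) with hT
  have hTmem : ∀ t ∈ T, ∃ g, ofRows n t = ψ g := by
    intro t ht
    rcases List.mem_cons.mp ht with rfl | ht
    · exact ⟨1, by rw [map_one, ofRows_oneRows]⟩
    · obtain ⟨q, -, rfl⟩ := List.mem_map.mp ht
      exact ⟨_, ofRows_matrixRows _⟩
  have hrep : ∀ g, ∃ k ∈ H, ∃ t ∈ T, ψ g = ψ k * ofRows n t := by
    intro g
    obtain ⟨h, hh⟩ := QuotientGroup.mk_out_eq_mul H g⁻¹
    refine ⟨h, h.2, matrixRows (ψ (QuotientGroup.mk g⁻¹ : Γ ⧸ H).out⁻¹),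
      List.mem_cons_of_mem _ (List.mem_map.mpr ⟨_, by simp, rfl⟩), ?_⟩
    rw [ofRows_matrixRows, ← map_mul, hh]
    congr 1
    group
  have hword : ∀ k ∈ H, ∃ w : List (List (List ℤ)),
      (∀ y ∈ w, y ∈ S.map (fun A => matrixRows (ψ A)) ∨
        ∃ s ∈ S.map (fun A => matrixRows (ψ A)), mulRows n y s = oneRows n) ∧
      ofRows n (prodRows n w) = ψ k := by
    intro k hk
    have hprod : ∀ l : List Γ, ofRows n (prodRows n (l.map fun A => matrixRows (ψ A))) =
        ψ l.prod := by
      intro l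
      induction l with
      | nil => rw [List.prod_nil, map_one]; exact ofRows_oneRows
      | cons a l ih =>
        rw [List.prod_cons, map_mul, ← ih, ← ofRows_matrixRows (ψ a)]
        exact ofRows_mulRows _ _
    rw [hH, ← Subgroup.mem_toSubmonoid, Subgroup.closure_toSubmonoid] at hk
    obtain ⟨l, hl, rfl⟩ := Submonoid.exists_list_of_mem_closure hk
    refine ⟨l.map fun A => matrixRows (ψ A), fun y hy => ?_, hprod l⟩
    obtain ⟨A, hA, rfl⟩ := List.mem_map.mp hy
    rcases hl A hA with h | h
    · exact Or.inl (List.mem_map.mpr ⟨A, h, rfl⟩)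
    · refine Or.inr ⟨_, List.mem_map.mpr ⟨_, h, rfl⟩, ?_⟩
      rw [mulRows_eq_oneRows_iff, ofRows_matrixRows, ofRows_matrixRows, ← map_mul,
        mul_inv_cancel, map_one]
  have hstep : ∀ p : (List (List ℤ)) × (List (List ℤ)), p.1 ∈ X → p.2 ∈ T →
      ∃ w : List (List (List ℤ)), (∀ y ∈ w, y ∈ S.map (fun A => matrixRows (ψ A)) ∨
        ∃ s ∈ S.map (fun A => matrixRows (ψ A)), mulRows n y s = oneRows n) ∧
      ∃ t' ∈ T, mulRows n p.2 p.1 = mulRows n (prodRows n w) t' := by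
    rintro ⟨x, t⟩ hx ht
    obtain ⟨g, hg⟩ := hX x hx
    obtain ⟨r, hr⟩ := hTmem t ht
    obtain ⟨k, hk, t', ht', he⟩ := hrep (r * g)
    obtain ⟨w, hw, hwe⟩ := hword k hk
    refine ⟨w, hw, t', ht', ?_⟩
    rw [mulRows_eq_mulRows_iff, hwe, ← he, map_mul, hg, hr]
  choose! f hf using hstep
  refine ⟨T, (X.product T).map f, List.mem_cons_self, fun x hx t ht => ?_⟩
  exact ⟨f (x, t), List.mem_map.mpr ⟨_, List.mem_product.mpr ⟨hx, ht⟩, rfl⟩, hf (x, t) hx ht⟩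

end CosetTable

/-- Search for a coset table. -/
theorem exists_partrec_factorial {e : ℕ × ℕ × ℕ × ℤ → ℕ × ℕ → ℤ} (he : Primrec₂ e) :
    ∃ f : ℕ × List (List (List ℤ)) →. ℕ, Partrec f ∧
      ∀ (n : ℕ) {Γ : Type} [Group Γ] (ψ : Γ →* Matrix (Fin n) (Fin n) ℤ) (Y : Set Γ),
        Function.Injective ψ → Subgroup.closure Y = ⊤ →
        (∀ y ∈ Y, ∃ i j : Fin n, (Matrix.of fun a b : Fin n => e (n, i, j, 1) (a, b)) = ψ y ∧
          (Matrix.of fun a b : Fin n => e (n, i, j, -1) (a, b)) = ψ y⁻¹) →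
        (∀ (i j : Fin n) (c : ℤ), ∃ g, (Matrix.of fun a b : Fin n => e (n, i, j, c) (a, b)) = ψ g) →
        ∀ S : List Γ, (Subgroup.closure {A | A ∈ S}).FiniteIndex →
          ∃ m ∈ f (n, S.map fun A => matrixRows (ψ A)),
            0 < m ∧ (Subgroup.closure {A | A ∈ S}).index ! ∣ m := by
  classical
  -- A natural number is decoded as a candidate `(T, W)`; a valid one yields the factorial of the
  -- length of `T`.
  let check : ℕ × List (List (List ℤ)) → ℕ → Option ℕ := fun a k =>
    (Encodable.decode (α := List (List (List ℤ)) × List (List (List (List ℤ)))) k).bind fun c =>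
      if IsCosetTable a.1 (rowsFamily e a.1) a.2 c.1 c.2 then some (c.1.length)! else none
  have hcheck : Primrec₂ check := by
    refine Primrec.option_bind (Primrec.decode.comp Primrec.snd) (Primrec.ite
      (primrecPred_isCosetTable (Primrec.fst.comp ?_)
        ((primrec_rowsFamily he).comp (Primrec.fst.comp ?_)) (Primrec.snd.comp ?_)
        (Primrec.fst.comp Primrec.snd) (Primrec.snd.comp Primrec.snd)) (Primrec.option_some.comp
          (primrec_factorial.comp (Primrec.list_length.comp (Primrec.fst.comp Primrec.snd))))
      (Primrec.const none)) <;> exact Primrec.fst.comp Primrec.fst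
  refine ⟨fun a => Nat.rfindOpt (check a), Partrec.rfindOpt hcheck.to_comp, ?_⟩
  intro n Γ _ ψ Y hψ hY hYe he' S hS
  have hXmem : ∀ x, x ∈ rowsFamily e n ↔ ∃ i j : Fin n, ∃ c : ℤ, (c = 1 ∨ c = -1) ∧
      x = rowsOf n (e (n, i, j, c)) := by
    intro x
    constructor
    · intro hx
      simp only [rowsFamily, List.mem_flatMap, List.mem_range, List.mem_map, List.mem_cons,
        List.not_mem_nil, or_false] at hx
      obtain ⟨i, hi, j, hj, c, hc, rfl⟩ := hx
      exact ⟨⟨i, hi⟩, ⟨j, hj⟩, c, hc, rfl⟩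
    · rintro ⟨i, j, c, hc, rfl⟩
      simp only [rowsFamily, List.mem_flatMap, List.mem_range, List.mem_map, List.mem_cons,
        List.not_mem_nil, or_false]
      exact ⟨i, i.2, j, j.2, c, hc, rfl⟩
  have hdom : (Nat.rfindOpt (check (n, S.map fun A => matrixRows (ψ A)))).Dom := by
    obtain ⟨T, W, hTW⟩ := exists_isCosetTable (X := rowsFamily e n) (ψ := ψ) (S := S) (by
      intro x hx
      obtain ⟨i, j, c, -, rfl⟩ := (hXmem x).mp hx
      obtain ⟨g, hg⟩ := he' i j c
      exact ⟨g, by rw [ofRows_rowsOf, ← hg]⟩) hS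
    rw [Nat.rfindOpt_dom]
    refine ⟨Encodable.encode (T, W), (T.length)!, ?_⟩
    simp only [check, Encodable.encodek, Option.bind_some, if_pos hTW]
    rfl
  refine ⟨_, Part.get_mem hdom, ?_⟩
  obtain ⟨k, hk⟩ := Nat.rfindOpt_spec (Part.get_mem hdom)
  simp only [check, Option.mem_def, Option.bind_eq_some_iff] at hk
  obtain ⟨c, -, hk⟩ := hk
  split_ifs at hk with hc
  rw [← Option.some_inj.mp hk]
  -- The search may stop at a table longer than the index; its factorial is still a multiple of the
  -- factorial of the index.
  refine ⟨Nat.factorial_pos _, Nat.factorial_dvd_factorial (hc.index_le hψ hY ?_)⟩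
  intro y hy
  obtain ⟨i, j, h1, h2⟩ := hYe y hy
  exact ⟨_, (hXmem _).mpr ⟨i, j, 1, Or.inl rfl, rfl⟩, _, (hXmem _).mpr ⟨i, j, -1, Or.inr rfl, rfl⟩,
    by rw [ofRows_rowsOf, h1], by rw [ofRows_rowsOf, h2]⟩

/-- The entries of the transvections, and of the identity matrix if `i = j`. -/
def slEntry (x : ℕ × ℕ × ℕ × ℤ) (y : ℕ × ℕ) : ℤ :=
  (if y.1 = y.2 then 1 else 0) +
    if (¬ x.2.1 = x.2.2.1) ∧ y.1 = x.2.1 ∧ y.2 = x.2.2.1 then x.2.2.2 else 0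

theorem primrec_slEntry : Primrec₂ slEntry := by
  have hi : Primrec fun p : (ℕ × ℕ × ℕ × ℤ) × (ℕ × ℕ) => p.1.2.1 :=
    Primrec.fst.comp (Primrec.snd.comp Primrec.fst)
  have hj : Primrec fun p : (ℕ × ℕ × ℕ × ℤ) × (ℕ × ℕ) => p.1.2.2.1 :=
    Primrec.fst.comp (Primrec.snd.comp (Primrec.snd.comp Primrec.fst))
  have hc : Primrec fun p : (ℕ × ℕ × ℕ × ℤ) × (ℕ × ℕ) => p.1.2.2.2 :=
    Primrec.snd.comp (Primrec.snd.comp (Primrec.snd.comp Primrec.fst))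
  have ha : Primrec fun p : (ℕ × ℕ × ℕ × ℤ) × (ℕ × ℕ) => p.2.1 := Primrec.fst.comp Primrec.snd
  have hb : Primrec fun p : (ℕ × ℕ × ℕ × ℤ) × (ℕ × ℕ) => p.2.2 := Primrec.snd.comp Primrec.snd
  exact primrec_int_add.comp (Primrec.ite (Primrec.eq.comp ha hb) (Primrec.const 1)
    (Primrec.const 0)) (Primrec.ite ((Primrec.eq.comp hi hj).not.and
      ((Primrec.eq.comp ha hi).and (Primrec.eq.comp hb hj))) hc (Primrec.const 0))

theorem of_slEntry {n : ℕ} {i j : Fin n} (h : i ≠ j) (c : ℤ) :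
    (Matrix.of fun a b : Fin n => slEntry (n, i, j, c) (a, b)) =
      (SpecialLinearGroup.transvection h c : SpecialLinearGroup (Fin n) ℤ).1 := by
  have h' : ¬ (i : ℕ) = j := fun e => h (Fin.ext e)
  ext a b
  rw [SpecialLinearGroup.transvection_coe]
  simp only [of_apply, slEntry, Matrix.add_apply, Matrix.one_apply, Matrix.single_apply, h',
    not_false_iff, true_and, ← Fin.ext_iff]
  simp only [eq_comm]

theorem of_slEntry_self {n : ℕ} (i : Fin n) (c : ℤ) :
    (Matrix.of fun a b : Fin n => slEntry (n, i, i, c) (a, b)) = 1 := by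
  ext a b
  simp [slEntry, Matrix.one_apply, Fin.ext_iff]

/-- The inclusion of the special linear group in the ring of matrices. -/
def slToMatrix (n : ℕ) : SpecialLinearGroup (Fin n) ℤ →* Matrix (Fin n) (Fin n) ℤ where
  toFun A := A.1
  map_one' := rfl
  map_mul' _ _ := rfl

theorem slInput_eq (n : ℕ) (S : List (SpecialLinearGroup (Fin n) ℤ)) :
    slInput n S = (n, S.map fun A => matrixRows (slToMatrix n A)) := by
  -- In `slInput` the coercion to matrices acts on the whole list as a monadic bind; both sides are
  -- brought to `flatMap`.
  rw [slInput, List.bind_eq_flatMap, List.map_flatMap, List.map_eq_flatMap]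
  rfl

theorem exists_partrec_slPCS_le : ∃ f : ℕ × List (List (List ℤ)) →. ℕ, Partrec f ∧
    ∀ n : ℕ, 2 < n → ∀ H : Subgroup (SpecialLinearGroup (Fin n) ℤ), H.FiniteIndex →
      ∀ S : List (SpecialLinearGroup (Fin n) ℤ), Subgroup.closure {A | A ∈ S} = H →
        ∃ m ∈ f (slInput n S), 0 < m ∧ slPCS n m ≤ H := by
  obtain ⟨f, hf, h⟩ := exists_partrec_factorial primrec_slEntry
  refine ⟨f, hf, ?_⟩
  rintro n hn - hH S rfl
  obtain ⟨m, hm, hm0, hd⟩ := h n (slToMatrix n)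
    (slElementary n) (fun _ _ e => Subtype.ext e) (closure_slElementary hn.le) (by
      rintro - ⟨i, j, hij, rfl⟩
      refine ⟨i, j, of_slEntry hij 1, ?_⟩
      rw [SpecialLinearGroup.transvection_inv]
      exact of_slEntry hij (-1)) (by
      intro i j c
      by_cases hij : i = j
      · subst hij
        exact ⟨1, of_slEntry_self i c⟩
      · exact ⟨.transvection hij c, of_slEntry hij c⟩) S hH
  refine ⟨m, ?_, hm0, (slPCS_le_of_dvd hd).trans (slPCS_factorial_index_le hn _ hH)⟩
  rwa [slInput_eq]

/-- The involution that interchanges the two halves of the first `2 * s` natural numbers. -/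
def natSwap (s x : ℕ) : ℕ := if x < s then x + s else x - s

/-- The entries of the elementary symplectic matrices, and of the identity matrix if `q` and `p`
form a pair. -/
def spEntry (x : ℕ × ℕ × ℕ × ℤ) (y : ℕ × ℕ) : ℤ :=
  (if y.1 = y.2 then 1 else 0) +
    -- Here `x.1 / 2` is `s`, and the factor `± 1` is the sign of the row of `J`. For equal indices
    -- the two alternatives below coincide and the parameter enters once, as in a long root element.
    if x.2.2.1 = natSwap (x.1 / 2) x.2.1 then 0 else (if y.1 < x.1 / 2 then -1 else 1) *
      if (natSwap (x.1 / 2) y.1 = x.2.1 ∧ y.2 = x.2.2.1) ∨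
        (natSwap (x.1 / 2) y.1 = x.2.2.1 ∧ y.2 = x.2.1) then x.2.2.2 else 0

theorem primrec_natSwap : Primrec₂ natSwap :=
  Primrec.ite (Primrec.nat_lt.comp Primrec.snd Primrec.fst) (Primrec.nat_add.comp Primrec.snd
    Primrec.fst) (Primrec.nat_sub.comp Primrec.snd Primrec.fst)

theorem primrec_spEntry : Primrec₂ spEntry := by
  have hs : Primrec fun p : (ℕ × ℕ × ℕ × ℤ) × (ℕ × ℕ) => p.1.1 / 2 :=
    Primrec.nat_div.comp (Primrec.fst.comp Primrec.fst) (Primrec.const 2)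
  have hi : Primrec fun p : (ℕ × ℕ × ℕ × ℤ) × (ℕ × ℕ) => p.1.2.1 :=
    Primrec.fst.comp (Primrec.snd.comp Primrec.fst)
  have hj : Primrec fun p : (ℕ × ℕ × ℕ × ℤ) × (ℕ × ℕ) => p.1.2.2.1 :=
    Primrec.fst.comp (Primrec.snd.comp (Primrec.snd.comp Primrec.fst))
  have hc : Primrec fun p : (ℕ × ℕ × ℕ × ℤ) × (ℕ × ℕ) => p.1.2.2.2 :=
    Primrec.snd.comp (Primrec.snd.comp (Primrec.snd.comp Primrec.fst))
  have ha : Primrec fun p : (ℕ × ℕ × ℕ × ℤ) × (ℕ × ℕ) => p.2.1 := Primrec.fst.comp Primrec.snd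
  have hb : Primrec fun p : (ℕ × ℕ × ℕ × ℤ) × (ℕ × ℕ) => p.2.2 := Primrec.snd.comp Primrec.snd
  have hw := primrec_natSwap.comp hs ha
  exact primrec_int_add.comp (Primrec.ite (Primrec.eq.comp ha hb) (Primrec.const 1)
    (Primrec.const 0)) (Primrec.ite (Primrec.eq.comp hj (primrec_natSwap.comp hs hi))
      (Primrec.const 0) (primrec_int_mul.comp (Primrec.ite (Primrec.nat_lt.comp ha hs)
        (Primrec.const (-1)) (Primrec.const 1)) (Primrec.ite
          (((Primrec.eq.comp hw hi).and (Primrec.eq.comp hb hj)).or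
            ((Primrec.eq.comp hw hj).and (Primrec.eq.comp hb hi))) hc (Primrec.const 0))))

theorem natSwap_finSumFinEquiv {s : ℕ} (p : Fin s ⊕ Fin s) :
    natSwap s (finSumFinEquiv p : Fin (s + s)) = (finSumFinEquiv p.swap : Fin (s + s)) := by
  rcases p with k | k <;> simp [natSwap]

theorem spEntry_finSumFinEquiv {s : ℕ} (p q a b : Fin s ⊕ Fin s) (c : ℤ) :
    spEntry (s + s, (finSumFinEquiv p : Fin (s + s)), (finSumFinEquiv q : Fin (s + s)), c)
      ((finSumFinEquiv a : Fin (s + s)), (finSumFinEquiv b : Fin (s + s))) =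
    (1 : Matrix (Fin s ⊕ Fin s) (Fin s ⊕ Fin s) ℤ) a b + if q = p.swap then 0 else
      (if a.isLeft then -1 else 1) *
        if (a.swap = p ∧ b = q) ∨ (a.swap = q ∧ b = p) then c else 0 := by
  have hs : (s + s) / 2 = s := by omega
  have hlt : ((finSumFinEquiv a : Fin (s + s)) : ℕ) < s ↔ a.isLeft := by
    rcases a with k | k <;> simp
  simp only [spEntry, hs, natSwap_finSumFinEquiv, ← Fin.ext_iff, finSumFinEquiv.injective.eq_iff,
    Matrix.one_apply, hlt]

theorem J_mul_apply {s : ℕ} (S : Matrix (Fin s ⊕ Fin s) (Fin s ⊕ Fin s) ℤ) (a b : Fin s ⊕ Fin s) :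
    (J (Fin s) ℤ * S) a b = (if a.isLeft then -1 else 1) * S a.swap b := by
  rcases a with k | k <;> simp [J, Matrix.mul_apply, Matrix.one_apply]

/-- The matrices of the symplectic group as matrices of size `2s`. -/
def spToMatrix (s : ℕ) : symplecticGroup (Fin s) ℤ →* Matrix (Fin (s + s)) (Fin (s + s)) ℤ where
  toFun A := A.1.reindex finSumFinEquiv finSumFinEquiv
  map_one' := Matrix.submatrix_one_equiv _
  map_mul' A B := (Matrix.submatrix_mul_equiv A.1 B.1 _ _ _).symm

theorem spToMatrix_injective (s : ℕ) : Function.Injective (spToMatrix s) := fun _ _ h =>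
  Subtype.ext ((Matrix.reindex finSumFinEquiv finSumFinEquiv).injective h)

theorem of_spEntry_eq_spToMatrix {s : ℕ} {p q : Fin s ⊕ Fin s} {c : ℤ}
    {A : symplecticGroup (Fin s) ℤ}
    (h : ∀ a b, A.1 a b = (1 : Matrix (Fin s ⊕ Fin s) (Fin s ⊕ Fin s) ℤ) a b +
      if q = p.swap then 0 else (if a.isLeft then -1 else 1) *
        if (a.swap = p ∧ b = q) ∨ (a.swap = q ∧ b = p) then c else 0) :
    (Matrix.of fun a b : Fin (s + s) => spEntry (s + s, (finSumFinEquiv p : Fin (s + s)),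
      (finSumFinEquiv q : Fin (s + s)), c) (a, b)) = spToMatrix s A := by
  ext a b
  obtain ⟨a, rfl⟩ := finSumFinEquiv.surjective a
  obtain ⟨b, rfl⟩ := finSumFinEquiv.surjective b
  rw [of_apply, spEntry_finSumFinEquiv, ← h]
  simp [spToMatrix]

theorem of_spEntry_short {s : ℕ} {p q : Fin s ⊕ Fin s} (hqs : q ≠ p.swap) (hpq : p ≠ q) (c : ℤ) :
    (Matrix.of fun a b : Fin (s + s) => spEntry (s + s, (finSumFinEquiv p : Fin (s + s)),
      (finSumFinEquiv q : Fin (s + s)), c) (a, b)) =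
      spToMatrix s (spVec p (Pi.single q c) 0 (single_swap_eq_zero hqs c)) := by
  refine of_spEntry_eq_spToMatrix fun a b => ?_
  rw [coe_spVec, Matrix.add_apply, J_mul_apply, if_neg hqs, spSymm_apply, Pi.single_apply,
    Pi.single_apply]
  congr 2
  split_ifs <;> simp_all

theorem of_spEntry_long {s : ℕ} (p : Fin s ⊕ Fin s) (c : ℤ) :
    (Matrix.of fun a b : Fin (s + s) => spEntry (s + s, (finSumFinEquiv p : Fin (s + s)),
      (finSumFinEquiv p : Fin (s + s)), c) (a, b)) = spToMatrix s (spVec p 0 c rfl) := by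
  refine of_spEntry_eq_spToMatrix fun a b => ?_
  have h : p ≠ p.swap := by rcases p with k | k <;> simp
  rw [coe_spVec, Matrix.add_apply, J_mul_apply, if_neg h, spSymm_apply]
  simp

theorem exists_partrec_spPCS_le : ∃ f : ℕ × List (List (List ℤ)) →. ℕ, Partrec f ∧
    ∀ s : ℕ, 2 < 2 * s → ∀ H : Subgroup (symplecticGroup (Fin s) ℤ), H.FiniteIndex →
      ∀ S : List (symplecticGroup (Fin s) ℤ), Subgroup.closure {A | A ∈ S} = H →
        ∃ m ∈ f (spInput s S), 0 < m ∧ spPCS s m ≤ H := by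
  obtain ⟨f, hf, h⟩ := exists_partrec_factorial primrec_spEntry
  refine ⟨f, hf, ?_⟩
  rintro s hs - hH S rfl
  obtain ⟨m, hm, hm0, hd⟩ := h (s + s) (spToMatrix s) (spElementary s) (spToMatrix_injective s)
    (closure_spElementary (by omega)) (by
      rintro - (⟨p, q, hqs, hpq, rfl⟩ | ⟨p, rfl⟩)
      · refine ⟨finSumFinEquiv p, finSumFinEquiv q, of_spEntry_short hqs hpq 1, ?_⟩
        rw [of_spEntry_short hqs hpq (-1), spVec_inv]
        exact congrArg _ (spVec_congr _ (Pi.single_neg _ _) neg_zero.symm)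
      · refine ⟨finSumFinEquiv p, finSumFinEquiv p, of_spEntry_long p 1, ?_⟩
        rw [of_spEntry_long p (-1), spVec_inv]
        exact congrArg _ (spVec_congr _ neg_zero.symm rfl)) (by
      intro i j c
      obtain ⟨p, rfl⟩ := finSumFinEquiv.surjective i
      obtain ⟨q, rfl⟩ := finSumFinEquiv.surjective j
      by_cases hqs : q = p.swap
      · exact ⟨1, of_spEntry_eq_spToMatrix fun a b => by simp [hqs]⟩
      by_cases hpq : p = q
      · subst hpq
        exact ⟨_, of_spEntry_long p c⟩
      · exact ⟨_, of_spEntry_short hqs hpq c⟩) S hH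
  refine ⟨m, ?_, hm0, (spPCS_le_of_dvd hd).trans (spPCS_factorial_index_le hs _ hH)⟩
  rw [spInput, two_mul]
  exact hm

theorem proposition2p3 :
    -- `Γ_n = SL(n, ℤ)`, `n > 2`: the explicit level, and the algorithm
    ((∀ n : ℕ, 2 < n → ∀ H : Subgroup (SpecialLinearGroup (Fin n) ℤ), H.FiniteIndex →
        slPCS n (H.index)! ≤ H) ∧
      ∃ f : ℕ × List (List (List ℤ)) →. ℕ, Partrec f ∧
        ∀ n : ℕ, 2 < n → ∀ H : Subgroup (SpecialLinearGroup (Fin n) ℤ), H.FiniteIndex →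
          ∀ S : List (SpecialLinearGroup (Fin n) ℤ), Subgroup.closure {A | A ∈ S} = H →
            ∃ m ∈ f (slInput n S), 0 < m ∧ slPCS n m ≤ H) ∧
    -- `Γ_n = Sp(n, ℤ)`, `n = 2 * s > 2`: the explicit level, and the algorithm
    ((∀ s : ℕ, 2 < 2 * s → ∀ H : Subgroup (symplecticGroup (Fin s) ℤ), H.FiniteIndex →
        spPCS s (H.index)! ≤ H) ∧
      ∃ f : ℕ × List (List (List ℤ)) →. ℕ, Partrec f ∧
        ∀ s : ℕ, 2 < 2 * s → ∀ H : Subgroup (symplecticGroup (Fin s) ℤ), H.FiniteIndex →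
          ∀ S : List (symplecticGroup (Fin s) ℤ), Subgroup.closure {A | A ∈ S} = H →
            ∃ m ∈ f (spInput s S), 0 < m ∧ spPCS s m ≤ H) :=
  ⟨⟨fun _ hn H hH => slPCS_factorial_index_le hn H hH, exists_partrec_slPCS_le⟩,
    fun _ hs H hH => spPCS_factorial_index_le hs H hH, exists_partrec_spPCS_le⟩
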